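/- **Setting.** An ATSP instance is a strongly connected digraph $G=(V,E)$ on a finite nonempty vertex set, $n=|V|$, with edge weights $w:E\to\mathbb R_{\ge 0}$. For $S\subseteq V$ let $\delta^+(S)$ and $\delta^-(S)$ be the sets of edges leaving and entering $S$. Sets of edges chosen from $E$ are multisets, weights are counted with multiplicity, and such a multiset is Eulerian if every vertex has equal in- and out-degree in it. A tour is an Eulerian multisubset $F$ of $E$ such that $(V,F)$ is connected (after undirecting the edges). Fix an optimal solution $x^*$ of the Held–Karp relaxation $$\min \sum_{e\in E}x_e w(e)\quad\text{s.t.}\quad x(\delta^+(v))=x(\delta^-(v))\ (v\in V),\quad x(\delta^+(S))\ge 1\ (\emptyset\ne S\subsetneq V),\quad x\ge 0,$$ and put $\mathrm{lb}(v)=\sum_{e\in\delta^+(v)}x^*_e w(e)$ and $\mathrm{lb}(S)=\sum_{v\in S}\mathrm{lb}(v)$. An algorithm $\mathcal A$ for Local-Connectivity ATSP receives $G$ (together with $x^*$) and a partition $V=V_1\cup\dots\cup V_k$ into $k\ge 2$ nonempty classes, each inducing a strongly connected graph. It is *$\alpha$-light on $G$* if for every such partition it halts and returns an Eulerian multisubset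 $F$ of $E$ with $|\delta^+_F(V_i)|\ge 1$ for $i=1,\dots,k$, and such that for every connected component $\tilde G=(\tilde V,\tilde E)$ of $(V,F)$ one has $w(\tilde E)\le\alpha\,\mathrm{lb}(\tilde V)$. Algorithms are programs for a real RAM: additions, subtractions and comparisons of natural and real numbers, multiplications and divisions of real numbers, and array accesses cost one step each; constants are rational, and there is no rounding. **Theorem.** Let $\mathcal A$ be an algorithm for Local-Connectivity ATSP that is $\alpha$-light on the ATSP instance $G$. 1. There exists a tour of $G$ of weight at most $5\alpha\,\mathrm{lb}(V)$. 2. For every $\varepsilon>0$, a tour of $G$ of weight at most $(9+\varepsilon)\alpha\,\mathrm{lb}(V)$ can be found in time polynomial in $n$, in $1/\varepsilon$ and in the running time of $\mathcal A$ on $G$. More precisely, there are a program $P$ that may call a subroutine and a polynomial $p$ such that, for all $\mathcal A$, $G$, $x^*$, $\alpha$ as above and all $\varepsilon>0$, if $\mathcal A$ needs at most $T$ steps on each of the partitions above, then $P$ with input $(G,x^*,\alpha,\varepsilon)$ and with subroutine $\mathcal A$ halts after at most $p(n,1/\varepsilon,T)$ steps, the steps of $\mathcal A$ included, and outputs such a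 tour. -/

import Mathlib

namespace ATSP

section Graphs

variable {V : Type*}

/-- The digraph `D` restricted to the vertex set `S` is strongly connected: any two vertices of `S`
are joined by a directed path all of whose vertices lie in `S`. -/
def StronglyConnectedOn (D : Digraph V) (S : Set V) : Prop :=
  ∀ u ∈ S, ∀ v ∈ S, Relation.ReflTransGen (fun a b => a ∈ S ∧ b ∈ S ∧ D.Adj a b) u v

/-- An ATSP instance: a nonempty strongly connected digraph with nonnegative edge weights.
The weight function is extended by `0` to the pairs that are not edges. -/
structure Instance (V : Type*) where
  graph : Digraph V
  weight : V → V → ℝ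
  weight_nonneg : ∀ u v, graph.Adj u v → 0 ≤ weight u v
  weight_eq_zero : ∀ u v, ¬ graph.Adj u v → weight u v = 0
  nonempty : Nonempty V
  strong : StronglyConnectedOn graph Set.univ

/-- The undirected graph `(V, F)` of a multiset `F` of edges; its connected components are the
components in `con(F)`. -/
def underlying (F : V → V → ℕ) : SimpleGraph V :=
  SimpleGraph.fromRel (fun u v => F u v ≠ 0)

variable [Fintype V] [DecidableEq V]

/-- `f(δ⁺(S))`, the total value of `f` on the pairs leaving `S`. -/
def outCut {M : Type*} [AddCommMonoid M] (f : V → V → M) (S : Finset V) : M :=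
  ∑ u ∈ S, ∑ v ∈ Sᶜ, f u v

/-- `f(δ⁻(S))`, the total value of `f` on the pairs entering `S`. -/
def inCut {M : Type*} [AddCommMonoid M] (f : V → V → M) (S : Finset V) : M :=
  ∑ u ∈ Sᶜ, ∑ v ∈ S, f u v

namespace Instance

variable (G : Instance V)

/-- Feasible solutions of the Held-Karp relaxation. A solution is a function on the edges, extended
by `0` to the pairs that are not edges. -/
structure HKFeasible (x : V → V → ℝ) : Prop where
  nonneg : ∀ u v, 0 ≤ x u v
  eq_zero : ∀ u v, ¬ G.graph.Adj u v → x u v = 0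
  balance : ∀ v, outCut x {v} = inCut x {v}
  cut : ∀ S : Finset V, S.Nonempty → S ≠ Finset.univ → 1 ≤ outCut x S

/-- The objective value of the Held-Karp relaxation. -/
def hkValue (x : V → V → ℝ) : ℝ := ∑ u, ∑ v, x u v * G.weight u v

/-- Optimal solutions of the Held-Karp relaxation. -/
def HKOptimal (x : V → V → ℝ) : Prop :=
  G.HKFeasible x ∧ ∀ y, G.HKFeasible y → G.hkValue x ≤ G.hkValue y

/-- The lower bound function `lb(v) = ∑_{e ∈ δ⁺(v)} x_e w(e)`. -/
def lb (x : V → V → ℝ) (v : V) : ℝ := outCut (fun a b => x a b * G.weight a b) {v}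

open Classical in
/-- `lb(S) = ∑_{v ∈ S} lb(v)`. -/
noncomputable def lbOn (x : V → V → ℝ) (S : Set V) : ℝ := ∑ v with v ∈ S, G.lb x v

/-- `F` is an Eulerian multisubset of the edge set. A multiset of edges is given by its
multiplicities: `F u v` is the number of copies of `(u, v)`. -/
structure IsEulerian (F : V → V → ℕ) : Prop where
  subset : ∀ u v, F u v ≠ 0 → G.graph.Adj u v
  balanced : ∀ v, outCut F {v} = inCut F {v}

/-- `w(F)`, counted with multiplicities. -/
def totalWeight (F : V → V → ℕ) : ℝ := ∑ u, ∑ v, (F u v : ℝ) * G.weight u v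

open Classical in
/-- The weight of those edges of `F` that have both ends in `S`. -/
noncomputable def weightOn (F : V → V → ℕ) (S : Set V) : ℝ :=
  ∑ u with u ∈ S, ∑ v with v ∈ S, (F u v : ℝ) * G.weight u v

/-- A tour: a connected Eulerian digraph `(V, F)` with `F` a multisubset of the edge set. -/
def IsTour (F : V → V → ℕ) : Prop :=
  G.IsEulerian F ∧ (underlying F).Connected

/-- The nonempty classes `V_i = {v | c v = i}`, `i < k`, partition the vertices into at least two
classes, each of which induces a strongly connected graph. (For `k = 1` no edge leaves the only
class, so that Local-Connectivity ATSP has no solution.) -/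
structure IsLCPartition {k : ℕ} (c : V → Fin k) : Prop where
  two_le : 2 ≤ k
  surjective : Function.Surjective c
  strong : ∀ i, StronglyConnectedOn G.graph {v | c v = i}

/-- `F` is a solution of Local-Connectivity ATSP for the partition `c`, and
`w(C) ≤ α lb(C)` for each connected component `C` of `(V, F)`. -/
structure IsLightSolution (x : V → V → ℝ) (α : ℝ) {k : ℕ} (c : V → Fin k) (F : V → V → ℕ) :
    Prop where
  eulerian : G.IsEulerian F
  crossing : ∀ i, 1 ≤ outCut F (Finset.univ.filter fun v => c v = i)
  light : ∀ C : (underlying F).ConnectedComponent,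
    G.weightOn F C.supp ≤ α * G.lbOn x C.supp

end Instance

end Graphs

/-! ### The machine model

A real RAM with a structured programming language. The memory consists of two-dimensional arrays of
natural numbers and of real numbers, named by natural numbers and initially `0`. Numbers are added,
subtracted and compared at unit cost; real numbers are also multiplied and divided. There is no
rounding and no conversion of real numbers to natural numbers, and the constants are rational. -/

section Machine

/-- `nat a i j` and `real a i j` are the entries `(i, j)` of the arrays with name `a`. -/
structure Store where
  nat : ℕ → ℕ → ℕ → ℕ
  real : ℕ → ℕ → ℕ → ℝ

/-- Expressions for natural numbers; `sub` is truncated. -/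
inductive NExp where
  | const (k : ℕ)
  | get (a : ℕ) (i j : NExp)
  | add (e₁ e₂ : NExp)
  | sub (e₁ e₂ : NExp)

/-- Expressions for real numbers; division by zero gives `0`. -/
inductive RExp where
  | const (q : ℚ)
  | get (a : ℕ) (i j : NExp)
  | ofNat (e : NExp)
  | add (e₁ e₂ : RExp)
  | sub (e₁ e₂ : RExp)
  | mul (e₁ e₂ : RExp)
  | div (e₁ e₂ : RExp)

/-- Tests. -/
inductive BExp where
  | natLe (e₁ e₂ : NExp)
  | realLe (e₁ e₂ : RExp)
  | not (b : BExp)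
  | and (b₁ b₂ : BExp)

/-- Programs. `call` runs a subroutine, which is a parameter of the semantics. -/
inductive Prog where
  | skip
  | setNat (a : ℕ) (i j : NExp) (e : NExp)
  | setReal (a : ℕ) (i j : NExp) (e : RExp)
  | seq (p q : Prog)
  | ite (b : BExp) (p q : Prog)
  | loop (b : BExp) (p : Prog)
  | call

namespace NExp

def eval (s : Store) : NExp → ℕ
  | const k => k
  | get a i j => s.nat a (i.eval s) (j.eval s)
  | add e₁ e₂ => e₁.eval s + e₂.eval s
  | sub e₁ e₂ => e₁.eval s - e₂.eval s

/-- The number of operations in the evaluation of an expression. -/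
def cost : NExp → ℕ
  | const _ => 1
  | get _ i j => i.cost + j.cost + 1
  | add e₁ e₂ => e₁.cost + e₂.cost + 1
  | sub e₁ e₂ => e₁.cost + e₂.cost + 1

end NExp

namespace RExp

noncomputable def eval (s : Store) : RExp → ℝ
  | const q => q
  | get a i j => s.real a (i.eval s) (j.eval s)
  | ofNat e => (e.eval s : ℝ)
  | add e₁ e₂ => e₁.eval s + e₂.eval s
  | sub e₁ e₂ => e₁.eval s - e₂.eval s
  | mul e₁ e₂ => e₁.eval s * e₂.eval s
  | div e₁ e₂ => e₁.eval s / e₂.eval s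

def cost : RExp → ℕ
  | const _ => 1
  | get _ i j => i.cost + j.cost + 1
  | ofNat e => e.cost + 1
  | add e₁ e₂ => e₁.cost + e₂.cost + 1
  | sub e₁ e₂ => e₁.cost + e₂.cost + 1
  | mul e₁ e₂ => e₁.cost + e₂.cost + 1
  | div e₁ e₂ => e₁.cost + e₂.cost + 1

end RExp

namespace BExp

def Holds (s : Store) : BExp → Prop
  | natLe e₁ e₂ => e₁.eval s ≤ e₂.eval s
  | realLe e₁ e₂ => e₁.eval s ≤ e₂.eval s
  | not b => ¬ b.Holds s
  | and b₁ b₂ => b₁.Holds s ∧ b₂.Holds s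

def cost : BExp → ℕ
  | natLe e₁ e₂ => e₁.cost + e₂.cost + 1
  | realLe e₁ e₂ => e₁.cost + e₂.cost + 1
  | not b => b.cost + 1
  | and b₁ b₂ => b₁.cost + b₂.cost + 1

end BExp

namespace Store

def setNat (s : Store) (a i j m : ℕ) : Store where
  nat := fun a' i' j' => if a' = a ∧ i' = i ∧ j' = j then m else s.nat a' i' j'
  real := s.real

def setReal (s : Store) (a i j : ℕ) (r : ℝ) : Store where
  nat := s.nat
  real := fun a' i' j' => if a' = a ∧ i' = i ∧ j' = j then r else s.real a' i' j'

/-- The initial memory of a subroutine: it sees the arrays `0, 1, 2, 3` of natural numbers and the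
arrays `0, 1` of real numbers of the caller, and all its other memory is `0`. -/
def arguments (s : Store) : Store where
  nat := fun a => if a ≤ 3 then s.nat a else 0
  real := fun a => if a ≤ 1 then s.real a else 0

/-- On return from a subroutine that ended with memory `r`, the caller's array `4` of natural
numbers is the one of the subroutine; the rest of the caller's memory is unchanged. -/
def afterCall (s r : Store) : Store where
  nat := fun a => if a = 4 then r.nat 4 else s.nat a
  real := s.real

end Store

/-- `Exec O p s t s'`: the program `p`, started with memory `s`, halts after `t` steps with memory
`s'`. Here `O s t s'` says that the subroutine, started with memory `s`, halts after `t` steps with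
memory `s'`; the steps of the subroutine are counted. -/
inductive Exec (O : Store → ℕ → Store → Prop) : Prog → Store → ℕ → Store → Prop where
  | skip (s : Store) : Exec O .skip s 1 s
  | setNat (s : Store) (a : ℕ) (i j e : NExp) :
      Exec O (.setNat a i j e) s (i.cost + j.cost + e.cost + 1)
        (s.setNat a (i.eval s) (j.eval s) (e.eval s))
  | setReal (s : Store) (a : ℕ) (i j : NExp) (e : RExp) :
      Exec O (.setReal a i j e) s (i.cost + j.cost + e.cost + 1)
        (s.setReal a (i.eval s) (j.eval s) (e.eval s))
  | seq {p q : Prog} {s s' s'' : Store} {t t' : ℕ} :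
      Exec O p s t s' → Exec O q s' t' s'' → Exec O (.seq p q) s (t + t') s''
  | ite_true {b : BExp} {p q : Prog} {s s' : Store} {t : ℕ} :
      b.Holds s → Exec O p s t s' → Exec O (.ite b p q) s (b.cost + t + 1) s'
  | ite_false {b : BExp} {p q : Prog} {s s' : Store} {t : ℕ} :
      ¬ b.Holds s → Exec O q s t s' → Exec O (.ite b p q) s (b.cost + t + 1) s'
  | loop_true {b : BExp} {p : Prog} {s s' s'' : Store} {t t' : ℕ} :
      b.Holds s → Exec O p s t s' → Exec O (.loop b p) s' t' s'' →
        Exec O (.loop b p) s (b.cost + t + t' + 1) s''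
  | loop_false {b : BExp} {p : Prog} {s : Store} :
      ¬ b.Holds s → Exec O (.loop b p) s (b.cost + 1) s
  | call {s r : Store} {t : ℕ} :
      O s.arguments t r → Exec O .call s (t + 1) (s.afterCall r)

/-- Runs of a program without subroutines (a program that reaches `call` never halts). -/
def Prog.Run (A : Prog) : Store → ℕ → Store → Prop :=
  Exec (fun _ _ _ => False) A

/-- Runs of the program `P` with the program `A` as its subroutine. -/
def Prog.RunWith (P A : Prog) : Store → ℕ → Store → Prop :=
  Exec A.Run P

end Machine

section Encoding

variable {n : ℕ}

/-- A number as an array. -/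
def scalar {M : Type*} [Zero M] (m : M) : ℕ → ℕ → M :=
  fun i j => if i = 0 ∧ j = 0 then m else 0

/-- A square matrix as an array. -/
def matrix {M : Type*} [Zero M] (f : Fin n → Fin n → M) : ℕ → ℕ → M :=
  fun i j => if h : i < n ∧ j < n then f ⟨i, h.1⟩ ⟨j, h.2⟩ else 0

/-- A vector as an array. -/
def vector {M : Type*} [Zero M] (f : Fin n → M) : ℕ → ℕ → M :=
  fun i j => if h : i < n ∧ j = 0 then f ⟨i, h.1⟩ else 0

namespace Instance

variable (G : Instance (Fin n))

open Classical in
/-- The adjacency matrix of the graph. -/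
noncomputable def adj (u v : Fin n) : ℕ := if G.graph.Adj u v then 1 else 0

/-- The input of an algorithm for Local-Connectivity ATSP: the number of vertices, the graph, the
number of classes, the class of each vertex, the edge weights, and the solution of the Held-Karp
relaxation that defines `lb`. -/
noncomputable def lcInput (x : Fin n → Fin n → ℝ) {k : ℕ} (c : Fin n → Fin k) : Store where
  nat
    | 0 => scalar n
    | 1 => matrix G.adj
    | 2 => scalar k
    | 3 => vector fun v => (c v : ℕ)
    | _ => 0
  real
    | 0 => matrix G.weight
    | 1 => matrix x
    | _ => 0

/-- The input of an algorithm for ATSP: the number of vertices, the graph, the edge weights, the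
solution of the Held-Karp relaxation that defines `lb`, and the numbers `α` and `ε`. -/
noncomputable def atspInput (x : Fin n → Fin n → ℝ) (α ε : ℝ) : Store where
  nat
    | 0 => scalar n
    | 1 => matrix G.adj
    | _ => 0
  real
    | 0 => matrix G.weight
    | 1 => matrix x
    | 2 => scalar α
    | 3 => scalar ε
    | _ => 0

end Instance

/-- The output of an algorithm: the multiset of edges with the multiplicities in the array `4`. -/
def Store.output (s : Store) (n : ℕ) : Fin n → Fin n → ℕ :=
  fun u v => s.nat 4 u v

/-- The algorithm `A` for Local-Connectivity ATSP is `α`-light on `G`, where `lb` is defined by the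
solution `x` of the Held-Karp relaxation. -/
def Prog.IsLightOn (A : Prog) (G : Instance (Fin n)) (x : Fin n → Fin n → ℝ) (α : ℝ) : Prop :=
  ∀ (k : ℕ) (c : Fin n → Fin k), G.IsLCPartition c →
    ∃ t s, A.Run (G.lcInput x c) t s ∧ G.IsLightSolution x α c (s.output n)

/-- `T` bounds the running time of the algorithm `A` for Local-Connectivity ATSP on `G`. -/
def Prog.RunningTimeLE (A : Prog) (G : Instance (Fin n)) (x : Fin n → Fin n → ℝ) (T : ℕ) : Prop :=
  ∀ (k : ℕ) (c : Fin n → Fin k), G.IsLCPartition c →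
    ∀ t s, A.Run (G.lcInput x c) t s → t ≤ T

end Encoding

end ATSP

/-! The tour grows out of an Eulerian multigraph `H` with light components, `w(C) ≤ β lb(C)`. A good
`H` is chosen, and then its components are merged; if merging meets an obstacle, `H` can be
improved.

Merging. `E` starts as `H`. While `(V, E)` is disconnected, its components are strongly connected
because `E` is Eulerian, so they form an instance of Local-Connectivity ATSP. Let `F` be a light
solution. Each component of `F` that meets several classes is charged to the most valuable component
`j` of `H` that it meets, where the value `m j` is essentially `lb`. Assume (`IsCheap`) that the
components charged to `j` weigh at most `γ m j` together and at most `κ m j` each. They are added to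
`E`. Then closed walks are added that join a component to one of at least the same top value (the
largest `m j` inside), the weight being at most `κ` times the top value of the former. Every
component holds credit `κ` times its top value. The less valuable of two joined components pays for
the walk and the other one keeps its credit, so all walks together are paid by the initial credit
(`WalkState.step`).

When no such walk is left, only the component of least top value is kept and the other additions are
discarded. No edge leaving the kept component then lies on a closed walk of weight at most `κ m j`,
for any `j` inside. A later component charged to such a `j` weighs at most `κ m j` and would have to
leave the kept component, which would give such a walk. Hence each `j` is charged at most once
(`MergeState.commit`), and the tour weighs at most `w(H) + (κ + γ) ∑ m j`.

Choosing `H`. If `IsCheap` fails, the components of `H` met by the offending components of `F` are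
removed and the latter are inserted, possibly together with some of the removed ones (`replaced`).
Lightness is preserved and the potential `∑ lb(C)^(p+1)` over the components increases. For the
existence of a tour, `H` maximizes the potential for a large `p`. This gives `β = 2α`, `κ = α`, `γ =
2α`, in total `5α` (`exists_tour_five`).

The algorithm uses `p = 1` and `β = κ = γ = 3α`, in total `9α`. To make the sum of squares grow,
some of the met components have to be retained: an interval of labels whose components contain at
least a third of the `lb` of the met components other than `j` (`exists_good_interval`). Intervals
can be found by trying all pairs of ends. Values are raised to at least `δ = ε lb(V) / (6n)`. Each
replacement then gains at least `δ²`, so at most `36 n² / ε²` of them occur, and the tour becomes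
heavier by at most `6 α n δ = ε α lb(V)`.

The program is written in a language `Cmd` whose loops run `n` times, so that its effect is a
function `den` and its running time is bounded by a polynomial in `n` (`Cmd.exec`). The only
unbounded loop is the one around the subroutine; its rounds are counted by `roundsLeft`. Cheap
closed walks are found by a Bellman-Ford table (`IsDistTable`). -/

set_option linter.unusedSectionVars false

namespace ATSP

/-! ### Component labels and balanced multigraphs -/

section Labelings

variable {V : Type*}

/-- The fibres of `l` are the vertex sets of the connected components of `(V, F)`. -/
def IsLabeling (F : V → V → ℕ) (l : V → ℕ) : Prop :=
  ∀ u v, l u = l v ↔ (underlying F).Reachable u v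

theorem reachable_of_edge {F : V → V → ℕ} {u v : V} (h : F u v ≠ 0) :
    (underlying F).Reachable u v := by
  by_cases huv : u = v
  · rw [huv]
  · exact SimpleGraph.Adj.reachable (by
      rw [underlying, SimpleGraph.fromRel_adj]; exact ⟨huv, Or.inl h⟩)

theorem eq_of_reachable {α : Type*} {F : V → V → ℕ} {φ : V → α}
    (h : ∀ u v, F u v ≠ 0 → φ u = φ v) {u v : V} (huv : (underlying F).Reachable u v) :
    φ u = φ v := by
  rw [SimpleGraph.reachable_iff_reflTransGen] at huv
  induction huv with
  | refl => rfl
  | tail _ hbc ih =>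
    rw [underlying, SimpleGraph.fromRel_adj] at hbc
    rcases hbc.2 with h' | h'
    · exact ih.trans (h _ _ h')
    · exact ih.trans (h _ _ h').symm

theorem reachable_mono {F F' : V → V → ℕ} (h : ∀ u v, F u v ≠ 0 → (underlying F').Reachable u v)
    {u v : V} (huv : (underlying F).Reachable u v) : (underlying F').Reachable u v := by
  rw [SimpleGraph.reachable_iff_reflTransGen] at huv
  induction huv with
  | refl => rfl
  | tail _ hbc ih =>
    rw [underlying, SimpleGraph.fromRel_adj] at hbc
    rcases hbc.2 with h' | h'
    · exact ih.trans (h _ _ h')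
    · exact ih.trans (h _ _ h').symm

theorem reachable_mono_le {F F' : V → V → ℕ} (h : ∀ u v, F u v ≤ F' u v)
    {u v : V} (huv : (underlying F).Reachable u v) : (underlying F').Reachable u v :=
  reachable_mono (fun u v huv => reachable_of_edge (by have := h u v; omega)) huv

/-- A path that starts in `P` cannot leave it, so all its edges survive in `F'`. This serves for
multigraphs pieced together from different ones on unions of components. -/
theorem reachable_restrict {F F' : V → V → ℕ} {P : V → Prop}
    (hP : ∀ a b, F a b ≠ 0 → (P a ↔ P b)) (hF : ∀ a b, P a → F a b ≠ 0 → F' a b ≠ 0) {u v : V}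
    (hu : P u) (huv : (underlying F).Reachable u v) : (underlying F').Reachable u v := by
  rw [SimpleGraph.reachable_iff_reflTransGen] at huv ⊢
  induction huv using Relation.ReflTransGen.head_induction_on with
  | refl => exact Relation.ReflTransGen.refl
  | @head a c hac _ ih =>
    rw [underlying, SimpleGraph.fromRel_adj] at hac
    have hc : P c := by
      rcases hac.2 with h | h
      · exact (hP a c h).1 hu
      · exact (hP c a h).2 hu
    refine Relation.ReflTransGen.head ?_ (ih hc)
    rw [underlying, SimpleGraph.fromRel_adj]
    exact ⟨hac.1, hac.2.imp (hF a c hu) (hF c a hc)⟩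

theorem IsLabeling.edge {F : V → V → ℕ} {l : V → ℕ} (hl : IsLabeling F l) {u v : V}
    (h : F u v ≠ 0) : l u = l v := (hl u v).2 (reachable_of_edge h)

theorem IsLabeling.mono {F F' : V → V → ℕ} {l l' : V → ℕ} (hl : IsLabeling F l)
    (hl' : IsLabeling F' l') (h : ∀ u v, F u v ≤ F' u v) {u v : V} (huv : l u = l v) :
    l' u = l' v := (hl' u v).2 (reachable_mono_le h ((hl u v).1 huv))

/-- A labeling of the components is determined up to renaming by two properties. -/
theorem IsLabeling.eq_iff {α : Type*} {F : V → V → ℕ} {l : V → ℕ} (hl : IsLabeling F l)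
    {φ : V → α} (hedge : ∀ u v, F u v ≠ 0 → φ u = φ v)
    (hconn : ∀ u v, φ u = φ v → (underlying F).Reachable u v) (u v : V) :
    l u = l v ↔ φ u = φ v :=
  ⟨fun h => eq_of_reachable hedge ((hl u v).1 h), fun h => (hl u v).2 (hconn u v h)⟩

theorem exists_isLabeling [Fintype V] (F : V → V → ℕ) : ∃ l, IsLabeling F l := by
  classical
  refine ⟨fun v => (Fintype.equivFin V (Quot.out ((underlying F).connectedComponentMk v)) : ℕ),
    fun u v => ?_⟩
  rw [Fin.val_inj, (Fintype.equivFin V).apply_eq_iff_eq, ← SimpleGraph.ConnectedComponent.eq]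
  constructor
  · intro h
    have := congrArg (underlying F).connectedComponentMk h
    have e : ∀ C : (underlying F).ConnectedComponent,
        (underlying F).connectedComponentMk (Quot.out C) = C := fun C => Quot.out_eq C
    rwa [e, e] at this
  · intro h; rw [h]

variable [Fintype V] [DecidableEq V]

/-- In- and out-degrees agree. -/
def Balanced (F : V → V → ℕ) : Prop := ∀ v, ∑ z, F v z = ∑ z, F z v

theorem balanced_iff (F : V → V → ℕ) :
    (∀ v, outCut F {v} = inCut F {v}) ↔ Balanced F := by
  refine forall_congr' fun v => ?_
  have h1 := Finset.sum_add_sum_compl ({v} : Finset V) (fun z => F v z)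
  have h2 := Finset.sum_add_sum_compl ({v} : Finset V) (fun z => F z v)
  simp only [Finset.sum_singleton] at h1 h2
  simp only [outCut, inCut, Finset.sum_singleton]
  omega

theorem Balanced.add {F F' : V → V → ℕ} (h : Balanced F) (h' : Balanced F') :
    Balanced (fun u v => F u v + F' u v) := fun v => by
  simp only [Finset.sum_add_distrib, h v, h' v]

theorem Balanced.restrict {F : V → V → ℕ} (h : Balanced F) (p : V → Prop) [DecidablePred p]
    (hp : ∀ u v, F u v ≠ 0 → (p u ↔ p v)) : Balanced (fun u v => if p u then F u v else 0) := by
  intro v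
  have e : ∀ z, (if p z then F z v else 0) = if p v then F z v else 0 := fun z => by
    by_cases hz : F z v = 0
    · simp [hz]
    · simp [hp z v hz]
  simp only [e]
  by_cases hv : p v
  · simpa [hv] using h v
  · simp [hv]

/-- Summed over `R`, out-degrees equal in-degrees, and the edges inside `R` cancel. So a set that no
edge leaves is entered by none. -/
theorem Balanced.closed {F : V → V → ℕ} (h : Balanced F) (R : Finset V)
    (hR : ∀ a b, a ∈ R → F a b ≠ 0 → b ∈ R) : ∀ a b, b ∈ R → F a b ≠ 0 → a ∈ R := by
  intro a b hb hab
  by_contra ha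
  have h1 : ∑ v ∈ R, ∑ z, F v z = ∑ v ∈ R, ∑ z ∈ R, F v z := by
    refine Finset.sum_congr rfl fun v hv => (Finset.sum_subset (Finset.subset_univ R) ?_).symm
    intro z _ hz
    by_contra h0
    exact hz (hR v z hv h0)
  have h2 : ∑ v ∈ R, ∑ z, F v z = ∑ v ∈ R, ∑ z, F z v := Finset.sum_congr rfl fun v _ => h v
  have h3 : ∑ v ∈ R, ∑ z, F z v = ∑ v ∈ R, ∑ z ∈ R, F z v + ∑ v ∈ R, ∑ z ∈ Rᶜ, F z v := by
    rw [← Finset.sum_add_distrib]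
    exact Finset.sum_congr rfl fun v _ => (Finset.sum_add_sum_compl R _).symm
  have h4 : ∑ v ∈ R, ∑ z ∈ R, F z v = ∑ v ∈ R, ∑ z ∈ R, F v z := Finset.sum_comm
  have h5 : ∑ v ∈ R, ∑ z ∈ Rᶜ, F z v = 0 := by omega
  rw [Finset.sum_eq_zero_iff] at h5
  have h6 := h5 b hb
  rw [Finset.sum_eq_zero_iff] at h6
  exact hab (h6 a (Finset.mem_compl.2 ha))

/-- The set reached from `u` by directed paths is left by no edge, hence entered by none, hence a
union of undirected components. -/
theorem Balanced.reflTransGen {F : V → V → ℕ} (h : Balanced F) {u v : V}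
    (huv : (underlying F).Reachable u v) :
    Relation.ReflTransGen (fun a b => F a b ≠ 0) u v := by
  classical
  set R := Finset.univ.filter fun z => Relation.ReflTransGen (fun a b => F a b ≠ 0) u z with hR
  have hout : ∀ a b, a ∈ R → F a b ≠ 0 → b ∈ R := by
    intro a b ha hab
    simp only [hR, Finset.mem_filter, Finset.mem_univ, true_and] at ha ⊢
    exact ha.tail hab
  have hin := h.closed R hout
  have := eq_of_reachable (φ := fun z => z ∈ R)
    (fun a b hab => propext ⟨fun ha => hout a b ha hab, fun hb => hin a b hb hab⟩) huv
  have hu : u ∈ R := by simp [hR, Relation.ReflTransGen.refl]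
  have hv : v ∈ R := by simpa [hu] using this
  simpa [hR] using hv

/-- A connected balanced multigraph that is not contained in `S` but meets it has an edge leaving
`S`. -/
theorem Balanced.exists_edge_leaving {F : V → V → ℕ} (h : Balanced F) {t v : V}
    (htv : (underlying F).Reachable t v) (S : Set V) (ht : t ∈ S) (hv : v ∉ S) :
    ∃ a b, a ∈ S ∧ b ∉ S ∧ F a b ≠ 0 ∧ (underlying F).Reachable t a := by
  have := h.reflTransGen htv
  induction this with
  | refl => exact absurd ht hv
  | @tail b c hb hbc ih =>
    by_cases hbS : b ∈ S
    · refine ⟨b, c, hbS, hv, hbc, ?_⟩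
      exact htv.trans (reachable_of_edge hbc).symm
    · exact ih (htv.trans (reachable_of_edge hbc).symm) hbS

end Labelings

/-! ### Sums over classes of a labeling -/

section Classes

variable {V : Type*} [Fintype V]

/-- A union of classes inherits an inequality that is valid on each class. With `q` equal to a
multiple of `lb` minus the row weights, this carries lightness from components to unions of
components. -/
theorem sum_nonneg_of_classes {g : V → ℕ} {q : V → ℝ}
    (hq : ∀ t, 0 ≤ ∑ v with g v = g t, q v) (p : V → Prop) [DecidablePred p]
    (hp : ∀ u v, g u = g v → (p u ↔ p v)) : 0 ≤ ∑ v with p v, q v := by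
  classical
  rw [← Finset.sum_fiberwise_of_maps_to (t := Finset.univ.image g) (g := g)
    (fun v _ => Finset.mem_image_of_mem g (Finset.mem_univ v))]
  refine Finset.sum_nonneg fun c hc => ?_
  obtain ⟨t, -, rfl⟩ := Finset.mem_image.1 hc
  by_cases ht : p t
  · refine (hq t).trans_eq (Finset.sum_congr ?_ fun _ _ => rfl)
    ext v
    simp only [Finset.mem_filter, Finset.mem_univ, true_and]
    exact ⟨fun h => ⟨(hp _ _ h).2 ht, h⟩, fun h => h.2⟩
  · refine (Finset.sum_eq_zero fun v hv => ?_).ge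
    simp only [Finset.mem_filter, Finset.mem_univ, true_and] at hv
    exact absurd ((hp _ _ hv.2).1 hv.1) ht

theorem sum_class_le {g : V → ℕ} {q : V → ℝ}
    (hq : ∀ t, 0 ≤ ∑ v with g v = g t, q v) (p : V → Prop) [DecidablePred p]
    (hp : ∀ u v, g u = g v → (p u ↔ p v)) (t : V) (ht : p t) :
    ∑ v with g v = g t, q v ≤ ∑ v with p v, q v := by
  have h := sum_nonneg_of_classes hq (fun v => p v ∧ g v ≠ g t)
    (fun u v huv => by rw [hp u v huv, huv])
  have h2 : ∑ v with p v, q v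
      = ∑ v with g v = g t, q v + ∑ v with (p v ∧ g v ≠ g t), q v := by
    simp only [Finset.sum_filter, ← Finset.sum_add_distrib]
    refine Finset.sum_congr rfl fun v _ => ?_
    by_cases h1 : g v = g t
    · simp [h1, (hp v t h1).2 ht]
    · simp [h1]
  linarith

theorem sum_two_classes_le {g : V → ℕ} {q : V → ℝ}
    (hq : ∀ t, 0 ≤ ∑ v with g v = g t, q v) (p : V → Prop) [DecidablePred p]
    (hp : ∀ u v, g u = g v → (p u ↔ p v)) (t s : V) (ht : p t) (hs : p s) (hst : g s ≠ g t) :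
    ∑ v with g v = g t, q v + ∑ v with g v = g s, q v ≤ ∑ v with p v, q v := by
  have h := sum_class_le hq (fun v => p v ∧ g v ≠ g t)
    (fun u v huv => by rw [hp u v huv, huv]) s ⟨hs, hst⟩
  have h2 : ∑ v with p v, q v
      = ∑ v with g v = g t, q v + ∑ v with (p v ∧ g v ≠ g t), q v := by
    simp only [Finset.sum_filter, ← Finset.sum_add_distrib]
    refine Finset.sum_congr rfl fun v _ => ?_
    by_cases h1 : g v = g t
    · simp [h1, (hp v t h1).2 ht]
    · simp [h1]
  linarith

/-- The labels of `g'` are images of those of `g`, and the label of `a` is no longer needed as `b`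
has the same image. The number of labels measures the progress of the walk search and of the
merging. -/
theorem card_image_lt_of_merge {g g' : V → ℕ} (h : ∀ u v, g u = g v → g' u = g' v) {a b : V}
    (hab : g a ≠ g b) (hab' : g' a = g' b) :
    (Finset.univ.image g').card < (Finset.univ.image g).card := by
  classical
  have hex : ∀ c, ∃ d, ∀ v, g v = c → g' v = d := by
    intro c
    by_cases hc : ∃ v, g v = c
    · obtain ⟨v, hv⟩ := hc
      exact ⟨g' v, fun w hw => h w v (hw.trans hv.symm)⟩
    · exact ⟨0, fun v hv => absurd ⟨v, hv⟩ hc⟩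
  choose k hk using hex
  have : Finset.univ.image g' = ((Finset.univ.image g).erase (g a)).image k := by
    ext d
    simp only [Finset.mem_image, Finset.mem_univ, true_and, Finset.mem_erase]
    constructor
    · rintro ⟨v, rfl⟩
      by_cases hv : g v = g a
      · exact ⟨g b, ⟨hab.symm, b, rfl⟩, by rw [← hk _ b rfl, h v a hv, hab']⟩
      · exact ⟨g v, ⟨hv, v, rfl⟩, (hk _ v rfl).symm⟩
    · rintro ⟨c, ⟨-, v, rfl⟩, rfl⟩
      exact ⟨v, hk _ v rfl⟩
  rw [this]
  refine Finset.card_image_le.trans_lt (Finset.card_erase_lt_of_mem ?_)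
  exact Finset.mem_image_of_mem g (Finset.mem_univ a)

end Classes

end ATSP

namespace ATSP

/-! ### Cheap closed walks through an edge -/

section Walks

variable {V : Type*} [Fintype V] [DecidableEq V] (G : Instance V)

theorem Instance.weight_nonneg' (u v : V) : 0 ≤ G.weight u v := by
  by_cases h : G.graph.Adj u v
  · exact G.weight_nonneg u v h
  · exact (G.weight_eq_zero u v h).ge

/-- The weight of the edges of `F` that leave the vertex `u`. -/
noncomputable def Instance.rowW (F : V → V → ℕ) (u : V) : ℝ := ∑ v, (F u v : ℝ) * G.weight u v

theorem Instance.rowW_nonneg (F : V → V → ℕ) (u : V) : 0 ≤ G.rowW F u :=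
  Finset.sum_nonneg fun v _ => mul_nonneg (Nat.cast_nonneg _) (G.weight_nonneg' u v)

theorem Instance.rowW_add (F F' : V → V → ℕ) (u : V) :
    G.rowW (fun u v => F u v + F' u v) u = G.rowW F u + G.rowW F' u := by
  simp only [Instance.rowW, Nat.cast_add, add_mul, Finset.sum_add_distrib]

theorem Instance.rowW_eq_zero {F : V → V → ℕ} {u : V} (h : ∀ v, F u v = 0) : G.rowW F u = 0 := by
  simp [Instance.rowW, h]

theorem Instance.weight_le_rowW {F : V → V → ℕ} {u v : V} (h : F u v ≠ 0) :
    G.weight u v ≤ G.rowW F u := by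
  have h1 : (F u v : ℝ) * G.weight u v ≤ G.rowW F u :=
    Finset.single_le_sum (f := fun v => (F u v : ℝ) * G.weight u v)
      (fun v _ => mul_nonneg (Nat.cast_nonneg _) (G.weight_nonneg' u v)) (Finset.mem_univ v)
  have h2 : (1 : ℝ) ≤ F u v := by exact_mod_cast Nat.one_le_iff_ne_zero.2 h
  nlinarith [G.weight_nonneg' u v]

/-- `WalkTo G a k u r`: there is a walk with `k` edges and weight `r` from `u` to `a`. -/
inductive WalkTo (a : V) : ℕ → V → ℝ → Prop where
  | nil : WalkTo a 0 a 0
  | cons {k : ℕ} {u v : V} {r : ℝ} : G.graph.Adj u v → WalkTo a k v r →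
      WalkTo a (k + 1) u (G.weight u v + r)

/-- The edge `(a, b)` lies on a closed walk of weight at most `θ`. -/
def Linked (a b : V) (θ : ℝ) : Prop :=
  G.graph.Adj a b ∧ ∃ k ≤ Fintype.card V, ∃ r, WalkTo G a k b r ∧ G.weight a b + r ≤ θ

variable {G}

theorem Linked.mono {a b : V} {θ θ' : ℝ} (h : Linked G a b θ) (hθ : θ ≤ θ') : Linked G a b θ' := by
  obtain ⟨h1, k, hk, r, hr, hle⟩ := h
  exact ⟨h1, k, hk, r, hr, hle.trans hθ⟩

/-- In an Eulerian component a directed path leads from `b` back to `a`. It uses at most one edge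
out of each vertex, which that vertex pays from its row; the row of `a` pays for `(a, b)`. -/
theorem linked_of_balanced {F : V → V → ℕ} (hF : G.IsEulerian F) {f : V → ℕ}
    (hf : IsLabeling F f) {a b : V} (hab : F a b ≠ 0) :
    Linked G a b (∑ u with f u = f a, G.rowW F u) := by
  classical
  have hbal := (balanced_iff F).1 hF.balanced
  -- Sets grown backwards from `a`. Walks to `a` are paid by the rows of the vertices other than
  -- `a`, and the bound on `k` keeps them short enough for `Linked`. A largest such set is closed
  -- under predecessors in `F`, so it contains `b`.
  set Good : Finset V → Prop := fun S => a ∈ S ∧ (∀ u ∈ S, f u = f a) ∧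
    ∀ u ∈ S, ∃ k r, k + 1 ≤ S.card ∧ WalkTo G a k u r ∧ r ≤ ∑ u ∈ S.erase a, G.rowW F u with hGood
  have hne : (Finset.univ.filter Good).Nonempty := by
    refine ⟨{a}, ?_⟩
    simp only [Finset.mem_filter, Finset.mem_univ, true_and, hGood, Finset.mem_singleton,
      Finset.card_singleton, forall_eq]
    exact ⟨0, 0, le_rfl, WalkTo.nil, by simp⟩
  obtain ⟨S, hS, hmax⟩ := Finset.exists_max_image _ Finset.card hne
  simp only [Finset.mem_filter, Finset.mem_univ, true_and] at hS hmax
  have hclosed : ∀ u v, F u v ≠ 0 → v ∈ S → u ∈ S := by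
    intro u v huv hv
    by_contra hu
    have hua : u ≠ a := fun h => hu (h ▸ hS.1)
    have hcard := Finset.card_insert_of_notMem hu
    have her : (insert u S).erase a = insert u (S.erase a) := Finset.erase_insert_of_ne hua
    have hsum : ∑ z ∈ (insert u S).erase a, G.rowW F z
        = G.rowW F u + ∑ z ∈ S.erase a, G.rowW F z := by
      rw [her, Finset.sum_insert (fun h => hu (Finset.mem_of_mem_erase h))]
    have hgood : Good (insert u S) := by
      refine ⟨Finset.mem_insert_of_mem hS.1, ?_, ?_⟩
      · intro z hz
        rcases Finset.mem_insert.1 hz with rfl | hz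
        · rw [hf.edge huv, hS.2.1 v hv]
        · exact hS.2.1 z hz
      · intro z hz
        rcases Finset.mem_insert.1 hz with rfl | hz
        · obtain ⟨k, r, hk, hw, hr⟩ := hS.2.2 v hv
          refine ⟨k + 1, _, by omega, WalkTo.cons (hF.subset _ _ huv) hw, ?_⟩
          rw [hsum]
          linarith [G.weight_le_rowW huv]
        · obtain ⟨k, r, hk, hw, hr⟩ := hS.2.2 z hz
          refine ⟨k, r, by omega, hw, ?_⟩
          rw [hsum]
          linarith [G.rowW_nonneg F u]
    have := hmax _ hgood
    omega
  have hb : b ∈ S := by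
    have := hbal.reflTransGen (reachable_of_edge hab).symm
    refine Relation.ReflTransGen.head_induction_on this hS.1 ?_
    intro u v huv _ hv
    exact hclosed u v huv hv
  obtain ⟨k, r, hk, hw, hr⟩ := hS.2.2 b hb
  refine ⟨hF.subset _ _ hab, k, ?_, r, hw, ?_⟩
  · have := Finset.card_le_univ S
    omega
  · have h1 : ∑ z ∈ S, G.rowW F z ≤ ∑ u with f u = f a, G.rowW F u := by
      refine Finset.sum_le_sum_of_subset_of_nonneg ?_ fun u _ _ => G.rowW_nonneg F u
      intro z hz
      simpa using hS.2.1 z hz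
    have h2 := Finset.add_sum_erase S (G.rowW F) hS.1
    linarith [G.weight_le_rowW hab]

/-- `Z` with one more copy of the edge `(a, b)`. -/
def addEdge (Z : V → V → ℕ) (a b : V) : V → V → ℕ :=
  fun u v => Z u v + if u = a ∧ v = b then 1 else 0

variable (G) in
/-- `Trail G a b v Z r`: the multiset `Z` consists of the edges of a walk from `a` to `v` with first
edge `(a, b)` and weight `r`. -/
inductive Trail (a b : V) : V → (V → V → ℕ) → ℝ → Prop where
  | start : G.graph.Adj a b → Trail a b b (addEdge 0 a b) (G.weight a b)
  | step {v u : V} {Z : V → V → ℕ} {r : ℝ} : Trail a b v Z r → G.graph.Adj v u →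
      Trail a b u (addEdge Z v u) (r + G.weight v u)

theorem sum_rowW_addEdge (Z : V → V → ℕ) (a b : V) :
    ∑ u, G.rowW (addEdge Z a b) u = ∑ u, G.rowW Z u + G.weight a b := by
  simp only [Instance.rowW, addEdge, Nat.cast_add, add_mul, Finset.sum_add_distrib]
  simp [ite_and]

theorem le_addEdge (Z : V → V → ℕ) (a b u v : V) : Z u v ≤ addEdge Z a b u v :=
  Nat.le_add_right _ _

theorem Trail.sum_rowW {a b v : V} {Z : V → V → ℕ} {r : ℝ} (h : Trail G a b v Z r) :
    ∑ u, G.rowW Z u = r := by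
  induction h with
  | start _ => rw [sum_rowW_addEdge]; simp [Instance.rowW]
  | step _ _ ih => rw [sum_rowW_addEdge, ih]

theorem Trail.subset {a b v : V} {Z : V → V → ℕ} {r : ℝ} (h : Trail G a b v Z r) (u z : V)
    (hz : Z u z ≠ 0) : G.graph.Adj u z := by
  induction h with
  | start h =>
    by_cases h' : u = a ∧ z = b
    · rw [h'.1, h'.2]; exact h
    · simp [addEdge, h'] at hz
  | @step v' u' Z' r' _ h ih =>
    by_cases h' : u = v' ∧ z = u'
    · rw [h'.1, h'.2]; exact h
    · exact ih (by simpa [addEdge, h'] using hz)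

theorem Trail.first {a b v : V} {Z : V → V → ℕ} {r : ℝ} (h : Trail G a b v Z r) : Z a b ≠ 0 := by
  induction h with
  | start _ => simp [addEdge]
  | step _ _ ih => simp only [addEdge]; omega

theorem Trail.reachable {a b v : V} {Z : V → V → ℕ} {r : ℝ} (h : Trail G a b v Z r) :
    (underlying Z).Reachable a v ∧ ∀ u z, Z u z ≠ 0 → (underlying Z).Reachable a u := by
  induction h with
  | start _ =>
    refine ⟨reachable_of_edge (by simp [addEdge]), fun u z hz => ?_⟩
    by_cases h' : u = a ∧ z = b
    · rw [h'.1]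
    · simp [addEdge, h'] at hz
  | @step v' u' Z' r' _ _ ih =>
    have h1 : (underlying (addEdge Z' v' u')).Reachable a v' :=
      reachable_mono_le (le_addEdge _ _ _) ih.1
    refine ⟨h1.trans (reachable_of_edge (by simp [addEdge])), fun u z hz => ?_⟩
    by_cases h' : u = v' ∧ z = u'
    · rw [h'.1]; exact h1
    · exact reachable_mono_le (le_addEdge _ _ _) (ih.2 u z (by simpa [addEdge, h'] using hz))

/-- Each visit enters and leaves once; only the first and the last vertex are off by one, which
cancels for a closed walk. -/
theorem Trail.balance {a b v : V} {Z : V → V → ℕ} {r : ℝ} (h : Trail G a b v Z r) (p : V) :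
    ∑ z, Z p z + (if p = v then 1 else 0) = ∑ z, Z z p + (if p = a then 1 else 0) := by
  have key : ∀ (Z : V → V → ℕ) (c d : V), ∑ z, addEdge Z c d p z
      = ∑ z, Z p z + (if p = c then 1 else 0) ∧ ∑ z, addEdge Z c d z p
      = ∑ z, Z z p + (if p = d then 1 else 0) := by
    intro Z c d
    simp [addEdge, Finset.sum_add_distrib, ite_and, eq_comm]
  induction h with
  | start _ => rw [(key _ _ _).1, (key _ _ _).2]; simp; omega
  | step _ _ ih => rw [(key _ _ _).1, (key _ _ _).2]; omega

theorem Trail.balanced {a b : V} {Z : V → V → ℕ} {r : ℝ} (h : Trail G a b a Z r) :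
    Balanced Z := fun p => by
  have := h.balance p
  omega

theorem Trail.extend {a b v : V} {Z : V → V → ℕ} {r : ℝ} (h : Trail G a b v Z r) {k : ℕ} {r' : ℝ}
    (hw : WalkTo G a k v r') : ∃ Z', Trail G a b a Z' (r + r') := by
  induction hw generalizing Z r with
  | nil => exact ⟨Z, by simpa using h⟩
  | cons hadj _ ih =>
    obtain ⟨Z', hZ'⟩ := ih (h.step hadj)
    exact ⟨Z', by rwa [add_assoc] at hZ'⟩

theorem Linked.exists_trail {a b : V} {θ : ℝ} (h : Linked G a b θ) :
    ∃ Z r, Trail G a b a Z r ∧ r ≤ θ := by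
  obtain ⟨h1, k, -, r, hr, hle⟩ := h
  obtain ⟨Z, hZ⟩ := (Trail.start h1).extend hr
  exact ⟨Z, _, hZ, hle⟩

end Walks

end ATSP

namespace ATSP

/-! ### One merging step and its credits -/

section Merging

variable {V : Type*} [Fintype V] [DecidableEq V] {G : Instance V}

theorem Instance.IsEulerian.bal {F : V → V → ℕ} (h : G.IsEulerian F) : Balanced F :=
  (balanced_iff F).1 h.balanced

variable (G)

/-- The state of the search for cheap closed walks: `W` consists of `E`, of `C` and of closed walks,
the labels `g` describe the components of `(V, W)`, and each component has enough credit. -/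
structure WalkState (E C : V → V → ℕ) (ψ μ : V → ℝ) (κ : ℝ) (W : V → V → ℕ) (g : V → ℕ) :
    Prop where
  eulerian : G.IsEulerian W
  labeling : IsLabeling W g
  le : ∀ u v, E u v + C u v ≤ W u v
  credit : ∀ t, κ * μ t ≤
    ∑ v with g v = g t, (ψ v + G.rowW C v + G.rowW E v - G.rowW W v)

variable {G}
variable {E C W : V → V → ℕ} {L g g' : V → ℕ} {ψ μ : V → ℝ} {κ : ℝ}

/-- The edges of `C` are not paid from credits, as the term `G.rowW C` gives them back. Adding them
only unites classes of `L`, each with nonnegative credit. -/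
theorem WalkState.init (hE : G.IsEulerian E) (hC : G.IsEulerian C) (hL : IsLabeling E L)
    (hg : IsLabeling (fun u v => E u v + C u v) g) (hκ : 0 ≤ κ) (hμ : ∀ v, 0 ≤ μ v)
    (hψ : ∀ t, κ * μ t ≤ ∑ v with L v = L t, ψ v) :
    WalkState G E C ψ μ κ (fun u v => E u v + C u v) g where
  eulerian := ⟨fun u v h => by
      by_cases h' : E u v = 0
      · exact hC.subset u v (by omega)
      · exact hE.subset u v h', (balanced_iff _).2 (hE.bal.add hC.bal)⟩
  labeling := hg
  le := fun _ _ => le_rfl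
  credit := fun t => by
    refine (hψ t).trans ?_
    have h0 : ∀ t, 0 ≤ ∑ v with L v = L t, ψ v := fun t =>
      (mul_nonneg hκ (hμ t)).trans (hψ t)
    have hLg : ∀ u v, L u = L v → g u = g v := fun u v huv =>
      hL.mono hg (fun _ _ => Nat.le_add_right _ _) huv
    refine (sum_class_le h0 (fun v => g v = g t) (fun u v huv => by rw [hLg u v huv]) t rfl).trans
      (le_of_eq (Finset.sum_congr rfl fun v _ => ?_))
    rw [Instance.rowW_add]; ring

/-- The component of `a` spends its credit `κ μ(ta)` on the walk. The component of `b` is at least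
as valuable, and its untouched credit covers the vertices of both. Further components met by the
walk contribute their credits as well. -/
theorem WalkState.step (h : WalkState G E C ψ μ κ W g) (hκ : 0 ≤ κ) (hμ : ∀ v, 0 ≤ μ v)
    {a b ta tb : V} (hab : g a ≠ g b) (hta : g ta = g a) (htb : g tb = g b)
    (hmax : ∀ v, g v = g a → μ v ≤ μ ta) (hle : μ ta ≤ μ tb) {Z : V → V → ℕ} {r : ℝ}
    (hZ : Trail G a b a Z r) (hr : r ≤ κ * μ ta) (hg' : IsLabeling (fun u v => W u v + Z u v) g') :
    WalkState G E C ψ μ κ (fun u v => W u v + Z u v) g' ∧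
      (Finset.univ.image g').card < (Finset.univ.image g).card := by
  have hgg : ∀ u v, g u = g v → g' u = g' v := fun u v huv =>
    h.labeling.mono hg' (fun _ _ => Nat.le_add_right _ _) huv
  have hab' : g' a = g' b := hg'.edge (by have := hZ.first; omega)
  refine ⟨⟨⟨fun u v huv => ?_, (balanced_iff _).2 (h.eulerian.bal.add hZ.balanced)⟩, hg',
    fun u v => (h.le u v).trans (Nat.le_add_right _ _), fun t => ?_⟩,
    card_image_lt_of_merge hgg hab hab'⟩
  · by_cases h' : W u v = 0
    · exact hZ.subset u v (by omega)
    · exact h.eulerian.subset u v h'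
  set q : V → ℝ := fun v => ψ v + G.rowW C v + G.rowW E v - G.rowW W v with hq
  have hcred : ∀ t, κ * μ t ≤ ∑ v with g v = g t, q v := h.credit
  have h0 : ∀ t, 0 ≤ ∑ v with g v = g t, q v := fun t => (mul_nonneg hκ (hμ t)).trans (hcred t)
  have hsplit : ∑ v with g' v = g' t, (ψ v + G.rowW C v + G.rowW E v -
      G.rowW (fun u v => W u v + Z u v) v)
      = ∑ v with g' v = g' t, q v - ∑ v with g' v = g' t, G.rowW Z v := by
    rw [← Finset.sum_sub_distrib]
    refine Finset.sum_congr rfl fun v _ => ?_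
    rw [Instance.rowW_add]; simp only [hq]; ring
  rw [hsplit]
  have hcl : ∀ u v, g u = g v → (g' u = g' t ↔ g' v = g' t) := fun u v huv => by rw [hgg u v huv]
  by_cases hta' : g' t = g' a
  · have hz : ∑ v with g' v = g' t, G.rowW Z v ≤ κ * μ ta := by
      refine le_trans ?_ (hZ.sum_rowW.le.trans hr)
      exact Finset.sum_le_sum_of_subset_of_nonneg (Finset.filter_subset _ _)
        fun u _ _ => G.rowW_nonneg Z u
    -- For `t` in the component of `a`, the credit of `tb` remains and suffices since `μ t ≤ μ ta ≤
    -- μ tb`. Otherwise the component of `t` itself still holds enough.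
    by_cases htg : g t = g a
    · have h1 := sum_two_classes_le h0 (fun v => g' v = g' t) hcl ta tb
        ((hgg _ _ hta).trans hta'.symm) ((hgg _ _ htb).trans (hab'.symm.trans hta'.symm))
        (by rw [hta, htb]; exact hab.symm)
      have h2 := mul_le_mul_of_nonneg_left (hmax t htg) hκ
      have h3 := mul_le_mul_of_nonneg_left hle hκ
      linarith [hcred ta, hcred tb]
    · have h1 := sum_two_classes_le h0 (fun v => g' v = g' t) hcl ta t
        ((hgg _ _ hta).trans hta'.symm) rfl (by rw [hta]; exact htg)
      linarith [hcred ta, hcred t]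
  -- All edges of the walk lie in the component of `a`, so this one pays nothing.
  · have hz : ∑ v with g' v = g' t, G.rowW Z v = 0 := by
      refine Finset.sum_eq_zero fun v hv => Instance.rowW_eq_zero G fun z => ?_
      by_contra hvz
      simp only [Finset.mem_filter, Finset.mem_univ, true_and] at hv
      have h1 := reachable_mono_le (F' := fun u v => W u v + Z u v)
        (fun _ _ => Nat.le_add_left _ _) (hZ.reachable.2 v z hvz)
      exact hta' (hv.symm.trans ((hg' _ _).2 h1).symm)
    rw [hz, sub_zero]
    exact (hcred t).trans (sum_class_le h0 (fun v => g' v = g' t) hcl t rfl)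

variable (G)

/-- The invariant of the merging procedure. The components of `(V, H)` have the labels `h`, the
value of the component with label `j` is `m j`; `E` is the current Eulerian multigraph and `L`
labels its components. -/
structure MergeState (h : V → ℕ) (m : ℕ → ℝ) (κ γ base : ℝ) (E : V → V → ℕ) (L : V → ℕ) :
    Prop where
  eulerian : G.IsEulerian E
  labeling : IsLabeling E L
  coarser : ∀ u v, h u = h v → L u = L v
  credit : ∃ (ψ : V → ℝ) (Ch : Finset ℕ),
    Ch ⊆ Finset.univ.image h ∧
    (∀ t, κ * m (h t) ≤ ∑ v with L v = L t, ψ v) ∧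
    ∑ v, ψ v + G.totalWeight E ≤ base + γ * ∑ j ∈ Ch, m j ∧
    ∀ j ∈ Ch, ∃ S : Set V, (∀ v, h v = j → v ∈ S) ∧ (∀ u ∈ S, ∀ v ∈ S, L u = L v) ∧
      ∀ a ∈ S, ∀ b ∉ S, ¬ Linked G a b (κ * m j)

/-- The component of `v` in `(V, F)` meets two classes of `L`. -/
def Crossing (F : V → V → ℕ) (f L : V → ℕ) (v : V) : Prop :=
  ∃ a b, f a = f v ∧ F a b ≠ 0 ∧ L a ≠ L b

/-- A solution `F` of Local-Connectivity ATSP for the classes of `L`; its components are labeled by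
`f`, the crossing ones are marked by `cr`, and the one with label `c` is charged to the component
`ind c` of `(V, H)`. -/
structure IsCheap (h L : V → ℕ) (m : ℕ → ℝ) (κ γ : ℝ) (F : V → V → ℕ) (f : V → ℕ) (cr : V → Bool)
    (ind : ℕ → ℕ) : Prop where
  eulerian : G.IsEulerian F
  labeling : IsLabeling F f
  leaves : ∀ v, ∃ a b, L a = L v ∧ L b ≠ L v ∧ F a b ≠ 0
  crossing : ∀ v, cr v = true ↔ Crossing F f L v
  touch : ∀ v, cr v = true → ∃ t, f t = f v ∧ h t = ind (f v)
  comp_le : ∀ v, cr v = true → ∑ u with f u = f v, G.rowW F u ≤ κ * m (ind (f v))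
  sum_le : ∀ j, ∑ u with (cr u = true ∧ ind (f u) = j), G.rowW F u ≤ γ * m j

variable {G}

/-- The edges of `F` in the marked components. -/
def markedPart (F : V → V → ℕ) (cr : V → Bool) : V → V → ℕ :=
  fun u v => if cr u = true then F u v else 0

theorem IsCheap.crossing_congr {h L f : V → ℕ} {m : ℕ → ℝ} {γ : ℝ} {F : V → V → ℕ}
    {cr : V → Bool} {ind : ℕ → ℕ} (hF : IsCheap G h L m κ γ F f cr ind) {u v : V}
    (huv : f u = f v) : cr u = true ↔ cr v = true := by
  rw [hF.crossing, hF.crossing, Crossing, Crossing, huv]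

theorem IsCheap.eulerian_marked {h L f : V → ℕ} {m : ℕ → ℝ} {γ : ℝ} {F : V → V → ℕ}
    {cr : V → Bool} {ind : ℕ → ℕ} (hF : IsCheap G h L m κ γ F f cr ind) :
    G.IsEulerian (markedPart F cr) where
  subset u v huv := hF.eulerian.subset u v fun h0 => huv (by simp [markedPart, h0])
  balanced := (balanced_iff _).2 (hF.eulerian.bal.restrict (fun u => cr u = true)
    fun u v huv => hF.crossing_congr (hF.labeling.edge huv))

/-- The edges of `W` that leave the component of `s`, and the edges of `E` that leave the other
vertices. -/
def commit (E W : V → V → ℕ) (g : V → ℕ) (s : V) : V → V → ℕ :=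
  fun u v => if g u = g s then W u v else E u v

/-- Every index in `Ch` has been charged and is protected by a set `S` inside one class that no
cheap closed walk leaves. This excludes a second charge, so new charges go to new indices and `γ m
j` is paid once per index. The new indices are protected by the component of `s`, because the search
for walks has ended there (`hterm`) and they have value at most `M`. -/
theorem MergeState.commit {h L f : V → ℕ} {m : ℕ → ℝ} {γ base : ℝ} {F : V → V → ℕ}
    {cr : V → Bool} {ind : ℕ → ℕ} (hF : IsCheap G h L m κ γ F f cr ind) (hκ : 0 ≤ κ)
    (hE : G.IsEulerian E) (hL : IsLabeling E L) (hhL : ∀ u v, h u = h v → L u = L v)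
    {ψ : V → ℝ} {Ch : Finset ℕ} (hCh : Ch ⊆ Finset.univ.image h)
    (hcred : ∀ t, κ * m (h t) ≤ ∑ v with L v = L t, ψ v)
    (hbase : ∑ v, ψ v + G.totalWeight E ≤ base + γ * ∑ j ∈ Ch, m j)
    (hclosed : ∀ j ∈ Ch, ∃ S : Set V, (∀ v, h v = j → v ∈ S) ∧ (∀ u ∈ S, ∀ v ∈ S, L u = L v) ∧
      ∀ a ∈ S, ∀ b ∉ S, ¬ Linked G a b (κ * m j))
    (hW : WalkState G E (markedPart F cr) ψ (fun v => m (h v)) κ W g) {s : V} {M : ℝ}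
    (hM : ∀ v, g v = g s → m (h v) ≤ M)
    (hterm : ∀ a b, g a = g s → g b ≠ g s → ¬ Linked G a b (κ * M))
    {L' : V → ℕ} (hL' : IsLabeling (commit E W g s) L') :
    MergeState G h m κ γ base (commit E W g s) L' ∧
      (Finset.univ.image L').card < (Finset.univ.image L).card := by
  classical
  have hEW : ∀ u v, E u v ≤ W u v := fun u v => (Nat.le_add_right _ _).trans (hW.le u v)
  have hLg : ∀ u v, L u = L v → g u = g v := fun u v huv => hL.mono hW.labeling hEW huv
  have hCg : ∀ u v, cr u = true → F u v ≠ 0 → g u = g v := fun u v hu huv =>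
    hW.labeling.edge (by
      have := hW.le u v
      simp only [markedPart, hu, if_true] at this
      omega)
  have hfg : ∀ u v, f u = f v → cr v = true → g u = g v := by
    intro u v huv hv
    have key := reachable_restrict (F' := W) (P := fun z => cr z = true)
      (fun a b hab => hF.crossing_congr (hF.labeling.edge hab))
      (fun a b ha hab => by
        have := hW.le a b
        simp only [markedPart, ha, if_true] at this
        omega) ((hF.crossing_congr huv).2 hv) ((hF.labeling u v).1 huv)
    exact (hW.labeling u v).2 key
  have hedge : ∀ u v, ATSP.commit E W g s u v ≠ 0 → g u = g v := by
    intro u v huv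
    unfold ATSP.commit at huv
    split_ifs at huv with h1
    · exact hW.labeling.edge huv
    · exact hLg _ _ (hL.edge huv)
  -- The component of `s` in `W` is a single class, encoded by `none`; elsewhere the classes of `L`
  -- remain.
  have hL'iff := hL'.eq_iff (φ := fun v => if g v = g s then none else some (L v))
    (fun u v huv => by
      have hguv := hedge u v huv
      by_cases h1 : g u = g s
      · simp [h1, ← hguv]
      · have h2 : g v ≠ g s := by rwa [← hguv]
        simp only [h1, h2, if_false]
        unfold ATSP.commit at huv
        simp only [h1, if_false] at huv
        rw [hL.edge huv])
    (fun u v huv => by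
      by_cases h1 : g u = g s
      · have h2 : g v = g s := by
          by_contra h2
          simp [h1, h2] at huv
        exact reachable_restrict (P := fun z => g z = g s)
          (fun a b hab => by rw [hW.labeling.edge hab])
          (fun a b ha hab => by simpa [ATSP.commit, ha] using hab) h1
          ((hW.labeling u v).1 (h1.trans h2.symm))
      · have h2 : g v ≠ g s := by
          intro h2
          simp [h1, h2] at huv
        simp only [h1, h2, if_false, Option.some.injEq] at huv
        exact reachable_restrict (P := fun z => ¬ g z = g s)
          (fun a b hab => by rw [hLg _ _ (hL.edge hab)])
          (fun a b ha hab => by simpa [ATSP.commit, ha] using hab) h1 ((hL u v).1 huv))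
  have hLL' : ∀ u v, L u = L v → L' u = L' v := by
    intro u v huv
    rw [hL'iff, huv, hLg u v huv]
  have hinS : ∀ u v, g u = g s → g v = g s → L' u = L' v := by
    intro u v hu hv
    rw [hL'iff]; simp [hu, hv]
  -- the committed component consists of several classes
  obtain ⟨a₀, b₀, ha₀, hb₀, hab₀⟩ := hF.leaves s
  have hcr₀ : cr a₀ = true := (hF.crossing a₀).2 ⟨a₀, b₀, rfl, hab₀, by rw [ha₀]; exact hb₀.symm⟩
  have hga₀ : g a₀ = g s := hLg _ _ ha₀
  have hgb₀ : g b₀ = g s := (hCg a₀ b₀ hcr₀ hab₀).symm.trans hga₀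
  refine ⟨⟨⟨?_, (balanced_iff _).2 ?_⟩, hL', fun u v huv => hLL' u v (hhL u v huv), ?_⟩,
    card_image_lt_of_merge hLL' (a := a₀) (b := b₀) (by rw [ha₀]; exact hb₀.symm)
      (hinS _ _ hga₀ hgb₀)⟩
  · intro u v huv
    unfold ATSP.commit at huv
    split_ifs at huv with h1
    · exact hW.eulerian.subset u v huv
    · exact hE.subset u v huv
  · have h1 := hW.eulerian.bal.restrict (fun u => g u = g s)
      fun u v huv => by rw [hW.labeling.edge huv]
    have h2 := hE.bal.restrict (fun u => ¬ g u = g s)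
      fun u v huv => by rw [hLg _ _ (hL.edge huv)]
    intro v
    have h3 := (h1.add h2) v
    have e : ∀ u z, ATSP.commit E W g s u z
        = (if g u = g s then W u z else 0) + if ¬ g u = g s then E u z else 0 := by
      intro u z
      unfold ATSP.commit
      split_ifs <;> simp
    simpa only [e] using h3
  -- credits
  set C := markedPart F cr with hC
  set New : Finset ℕ := (Finset.univ.filter fun v => g v = g s ∧ cr v = true).image
    (fun v => ind (f v)) with hNew
  -- A component charged to an old index `j` meets `S` but, being crossing, is not contained in it.
  -- Some edge of it leaves `S`, and the component supplies a closed walk through this edge of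
  -- weight at most `κ m j`, against `hclosed`.
  have hdisj : Disjoint Ch New := by
    rw [Finset.disjoint_left]
    intro j hj hjN
    obtain ⟨v, hv, hvj⟩ := Finset.mem_image.1 hjN
    simp only [Finset.mem_filter, Finset.mem_univ, true_and] at hv
    obtain ⟨S, hS1, hS2, hS3⟩ := hclosed j hj
    obtain ⟨t, ht, htj⟩ := hF.touch v hv.2
    have htS : t ∈ S := hS1 t (htj.trans hvj)
    obtain ⟨a, b, hav, hab, hLab⟩ := (hF.crossing v).1 hv.2
    have hbv : f b = f v := (hF.labeling.edge hab).symm.trans hav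
    have hex : ∃ z, f z = f v ∧ z ∉ S := by
      by_cases haS : a ∈ S
      · exact ⟨b, hbv, fun hbS => hLab (hS2 a haS b hbS)⟩
      · exact ⟨a, hav, haS⟩
    obtain ⟨z, hz, hzS⟩ := hex
    obtain ⟨a', b', ha', hb', hab', hta'⟩ := hF.eulerian.bal.exists_edge_leaving
      ((hF.labeling t z).1 (ht.trans hz.symm)) S htS hzS
    refine hS3 a' ha' b' hb' ((linked_of_balanced hF.eulerian hF.labeling hab').mono ?_)
    have hfa' : f a' = f v := ((hF.labeling t a').2 hta').symm.trans ht
    rw [hfa', ← hvj]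
    exact hF.comp_le v hv.2
  have hcost : ∑ v with g v = g s, G.rowW C v ≤ γ * ∑ j ∈ New, m j := by
    have h1 : ∑ v with g v = g s, G.rowW C v
        = ∑ v with (g v = g s ∧ cr v = true), G.rowW F v := by
      simp only [Finset.sum_filter, ite_and]
      refine Finset.sum_congr rfl fun v _ => ?_
      by_cases h1 : g v = g s
      · by_cases h2 : cr v = true
        · simp [h1, h2, hC, markedPart, Instance.rowW]
        · simp [h1, h2, hC, markedPart, Instance.rowW]
      · simp [h1]
    rw [h1, ← Finset.sum_fiberwise_of_maps_to (t := New) (g := fun v => ind (f v))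
      (fun v hv => Finset.mem_image_of_mem _ hv), Finset.mul_sum]
    refine Finset.sum_le_sum fun j _ => le_trans ?_ (hF.sum_le j)
    refine Finset.sum_le_sum_of_subset_of_nonneg ?_ fun u _ _ => G.rowW_nonneg F u
    intro v hv
    simp only [Finset.mem_filter, Finset.mem_univ, true_and] at hv ⊢
    exact ⟨hv.1.2, hv.2⟩
  -- Inside the committed component the new credit is what the walks have left over; elsewhere
  -- nothing was kept and nothing is paid. The weight of `C` is covered by the charges in `New`.
  refine ⟨fun v => if g v = g s then ψ v + G.rowW C v + G.rowW E v - G.rowW W v else ψ v,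
    Ch ∪ New, ?_, ?_, ?_, ?_⟩
  · refine Finset.union_subset hCh fun j hj => ?_
    obtain ⟨v, hv, hvj⟩ := Finset.mem_image.1 hj
    simp only [Finset.mem_filter, Finset.mem_univ, true_and] at hv
    obtain ⟨t, -, htj⟩ := hF.touch v hv.2
    rw [← hvj, ← htj]
    exact Finset.mem_image_of_mem _ (Finset.mem_univ t)
  · intro t
    by_cases ht : g t = g s
    · refine (hW.credit t).trans (le_of_eq ?_)
      refine Finset.sum_congr ?_ fun v hv => ?_
      · ext v
        simp only [Finset.mem_filter, Finset.mem_univ, true_and]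
        rw [hL'iff, ht]
        by_cases hv : g v = g s <;> simp [hv]
      · have hv' : g v = g s := by
          simp only [Finset.mem_filter, Finset.mem_univ, true_and] at hv
          rw [hL'iff] at hv
          by_contra h1
          simp [h1, ht] at hv
        simp [hv']
    · refine (hcred t).trans (le_of_eq ?_)
      refine Finset.sum_congr ?_ fun v hv => ?_
      · ext v
        simp only [Finset.mem_filter, Finset.mem_univ, true_and]
        rw [hL'iff]
        by_cases hv : g v = g s
        · simp only [hv, ht, if_true, if_false, reduceCtorEq, iff_false]
          exact fun h1 => ht ((hLg _ _ h1).symm.trans hv)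
        · simp [hv, ht]
      · have hv' : ¬ g v = g s := by
          simp only [Finset.mem_filter, Finset.mem_univ, true_and] at hv
          rw [hL'iff] at hv
          intro h1
          simp [h1, ht] at hv
        simp [hv']
  · have e1 : G.totalWeight (ATSP.commit E W g s)
        = ∑ v, if g v = g s then G.rowW W v else G.rowW E v := by
      simp only [Instance.totalWeight]
      refine Finset.sum_congr rfl fun v _ => ?_
      by_cases hv : g v = g s <;> simp [ATSP.commit, hv, Instance.rowW]
    have e2 : G.totalWeight E = ∑ v, G.rowW E v := rfl
    have e3 : (∑ v, if g v = g s then ψ v + G.rowW C v + G.rowW E v - G.rowW W v else ψ v)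
        + (∑ v, if g v = g s then G.rowW W v else G.rowW E v)
        = (∑ v, ψ v + ∑ v, G.rowW E v) + ∑ v with g v = g s, G.rowW C v := by
      rw [Finset.sum_filter]
      simp only [← Finset.sum_add_distrib]
      refine Finset.sum_congr rfl fun v _ => ?_
      split_ifs <;> ring
    rw [e1, e3, ← e2, Finset.sum_union hdisj]
    linarith
  · intro j hj
    rcases Finset.mem_union.1 hj with hj | hj
    · obtain ⟨S, hS1, hS2, hS3⟩ := hclosed j hj
      exact ⟨S, hS1, fun u hu v hv => hLL' u v (hS2 u hu v hv), hS3⟩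
    · obtain ⟨v, hv, hvj⟩ := Finset.mem_image.1 hj
      simp only [Finset.mem_filter, Finset.mem_univ, true_and] at hv
      obtain ⟨t, ht, htj⟩ := hF.touch v hv.2
      have hgt : g t = g s := (hfg t v ht hv.2).trans hv.1
      -- The protecting set is the committed component. It contains the component `j` of `H`, so `m
      -- j ≤ M` and a walk that is cheap for `j` would be cheap for `M`.
      refine ⟨{z | g z = g s}, fun z hz => ?_, fun u hu z hz => hinS u z hu hz, ?_⟩
      · have h1 : h z = h t := by rw [hz, htj, hvj]
        exact (hLg _ _ (hhL _ _ h1)).trans hgt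
      · intro a ha b hb hlink
        refine hterm a b ha hb (hlink.mono (mul_le_mul_of_nonneg_left ?_ hκ))
        rw [← hvj, ← htj]
        exact hM t hgt

end Merging

end ATSP

namespace ATSP

/-! ### Termination of merging, and the use of Local-Connectivity solutions -/

section MergingExistence

variable {V : Type*} [Fintype V] [DecidableEq V] {G : Instance V}

theorem exists_top (g : V → ℕ) (μ : V → ℝ) (a : V) :
    ∃ t, g t = g a ∧ ∀ v, g v = g a → μ v ≤ μ t := by
  obtain ⟨t, ht, hmax⟩ := Finset.exists_max_image (Finset.univ.filter fun v => g v = g a) μ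
    ⟨a, by simp⟩
  simp only [Finset.mem_filter, Finset.mem_univ, true_and] at ht hmax
  exact ⟨t, ht, hmax⟩

/-- Each added walk reduces the number of components, so the search ends. -/
theorem WalkState.exists_terminal {E C W : V → V → ℕ} {g : V → ℕ} {ψ μ : V → ℝ} {κ : ℝ}
    (h : WalkState G E C ψ μ κ W g) (hκ : 0 ≤ κ) (hμ : ∀ v, 0 ≤ μ v) :
    ∃ W g, WalkState G E C ψ μ κ W g ∧ ∀ a b ta tb, g a ≠ g b → g ta = g a → g tb = g b →
      (∀ v, g v = g a → μ v ≤ μ ta) → μ ta ≤ μ tb → ¬ Linked G a b (κ * μ ta) := by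
  induction hN : (Finset.univ.image g).card using Nat.strong_induction_on generalizing W g with
  | _ N ih =>
    by_cases hterm : ∀ a b ta tb, g a ≠ g b → g ta = g a → g tb = g b →
      (∀ v, g v = g a → μ v ≤ μ ta) → μ ta ≤ μ tb → ¬ Linked G a b (κ * μ ta)
    · exact ⟨W, g, h, hterm⟩
    · push Not at hterm
      obtain ⟨a, b, ta, tb, hab, hta, htb, hmax, hle, hlink⟩ := hterm
      obtain ⟨Z, r, hZ, hr⟩ := hlink.exists_trail
      obtain ⟨g', hg'⟩ := exists_isLabeling (fun u v => W u v + Z u v)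
      obtain ⟨h1, h2⟩ := h.step hκ hμ hab hta htb hmax hle hZ hr hg'
      exact ih _ (hN ▸ h2) h1 rfl

theorem MergeState.exists_next [Nonempty V] {h L f : V → ℕ} {m : ℕ → ℝ} {κ γ base : ℝ}
    {E F : V → V → ℕ} {cr : V → Bool} {ind : ℕ → ℕ} (hE : MergeState G h m κ γ base E L)
    (hF : IsCheap G h L m κ γ F f cr ind) (hκ : 0 ≤ κ) (hm : ∀ j, 0 ≤ m j) :
    ∃ E' L', MergeState G h m κ γ base E' L' ∧
      (Finset.univ.image L').card < (Finset.univ.image L).card := by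
  obtain ⟨ψ, Ch, hCh, hcred, hbase, hclosed⟩ := hE.credit
  obtain ⟨g, hg⟩ := exists_isLabeling (fun u v => E u v + markedPart F cr u v)
  obtain ⟨W, g, hW, hterm⟩ := (WalkState.init hE.eulerian hF.eulerian_marked hE.labeling hg hκ
    (fun v => hm (h v)) hcred).exists_terminal hκ (fun v => hm (h v))
  choose top htop hmax using exists_top g (fun v => m (h v))
  -- The component with the least top value is committed: every other one has at least this top
  -- value, so the end of the search excludes cheap walks through all edges leaving it.
  obtain ⟨s, -, hs⟩ := Finset.exists_min_image Finset.univ (fun v => m (h (top v)))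
    Finset.univ_nonempty
  obtain ⟨L', hL'⟩ := exists_isLabeling (ATSP.commit E W g s)
  refine ⟨_, L', MergeState.commit hF hκ hE.eulerian hE.labeling hE.coarser hCh hcred hbase hclosed
    hW (s := s) (M := m (h (top s))) (hmax s) (fun a b ha hb => ?_) hL'⟩
  exact hterm a b (top s) (top b) (by rw [ha]; exact hb.symm) ((htop s).trans ha.symm) (htop b)
    (fun v hv => hmax s v (hv.trans ha)) (hs b (Finset.mem_univ b))

theorem MergeState.init {h L : V → ℕ} {m : ℕ → ℝ} {κ γ : ℝ} {H : V → V → ℕ} (hH : G.IsEulerian H)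
    (hh : IsLabeling H h) (hL : IsLabeling H L) {ψ : V → ℝ}
    (hψ : ∀ t, κ * m (h t) ≤ ∑ v with h v = h t, ψ v) :
    MergeState G h m κ γ (∑ v, ψ v + G.totalWeight H) H L :=
  ⟨hH, hL, fun u v huv => (hL u v).2 ((hh u v).1 huv), ψ, ∅, by simp, fun t => by
    refine (hψ t).trans (le_of_eq (Finset.sum_congr (Finset.filter_congr fun v _ => ?_) fun _ _ => rfl))
    rw [hh, hL], by simp, by simp⟩

theorem MergeState.isTour {h L : V → ℕ} {m : ℕ → ℝ} {κ γ base : ℝ} {E : V → V → ℕ}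
    (hE : MergeState G h m κ γ base E L) (hL : ∀ u v, L u = L v) : G.IsTour E := by
  have := G.nonempty
  exact ⟨hE.eulerian, ⟨fun u v => (hE.labeling u v).1 (hL u v)⟩⟩

/-- The remaining credits are nonnegative and can be dropped. The charged indices are distinct, so
their values add up to at most the sum over all components of `H`. -/
theorem MergeState.totalWeight_le {h L : V → ℕ} {m : ℕ → ℝ} {κ γ base : ℝ} {E : V → V → ℕ}
    (hE : MergeState G h m κ γ base E L) (hκ : 0 ≤ κ) (hγ : 0 ≤ γ) (hm : ∀ j, 0 ≤ m j) {b : V → ℝ}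
    (hmb : ∀ t, m (h t) ≤ ∑ v with h v = h t, b v) :
    G.totalWeight E ≤ base + γ * ∑ v, b v := by
  obtain ⟨ψ, Ch, hCh, hcred, hbase, -⟩ := hE.credit
  have h1 : 0 ≤ ∑ v, ψ v := by
    have := sum_nonneg_of_classes (g := L) (q := ψ)
      (fun t => (mul_nonneg hκ (hm _)).trans (hcred t)) (fun _ => True) (fun _ _ _ => Iff.rfl)
    simpa using this
  have h2 : ∑ j ∈ Ch, m j ≤ ∑ v, b v := by
    calc ∑ j ∈ Ch, m j ≤ ∑ j ∈ Finset.univ.image h, m j :=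
          Finset.sum_le_sum_of_subset_of_nonneg hCh fun j _ _ => hm j
      _ ≤ ∑ j ∈ Finset.univ.image h, ∑ v with h v = j, b v := by
          refine Finset.sum_le_sum fun j hj => ?_
          obtain ⟨t, -, rfl⟩ := Finset.mem_image.1 hj
          exact hmb t
      _ = ∑ v, b v := Finset.sum_fiberwise_of_maps_to
          (fun v _ => Finset.mem_image_of_mem h (Finset.mem_univ v)) b
  have h3 := mul_le_mul_of_nonneg_left h2 hγ
  linarith

/-- Components of an Eulerian multigraph are strongly connected by their own edges, which never
leave the class. -/
theorem isLCPartition_of_labeling {E : V → V → ℕ} {L : V → ℕ} (hE : G.IsEulerian E)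
    (hL : IsLabeling E L) {k : ℕ} {c : V → Fin k} (hk : 2 ≤ k) (hc : Function.Surjective c)
    (hcL : ∀ u v, c u = c v ↔ L u = L v) : G.IsLCPartition c where
  two_le := hk
  surjective := hc
  strong i u hu v hv := by
    have h1 := hE.bal.reflTransGen ((hL u v).1 ((hcL u v).1 (hu.trans hv.symm)))
    clear hv
    suffices h2 : ∀ w, Relation.ReflTransGen (fun a b => E a b ≠ 0) u w →
        Relation.ReflTransGen (fun a b => a ∈ {v | c v = i} ∧ b ∈ {v | c v = i} ∧ G.graph.Adj a b)
          u w ∧ c w = i from (h2 v h1).1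
    intro w hw
    induction hw with
    | refl => exact ⟨Relation.ReflTransGen.refl, hu⟩
    | @tail a b _ hab ih =>
      have hb : c b = i := ((hcL a b).2 (hL.edge hab)).symm.trans ih.2
      exact ⟨ih.1.tail ⟨ih.2, hb, hE.subset a b hab⟩, hb⟩

theorem IsLightSolution.comp_le {x : V → V → ℝ} {α : ℝ} {k : ℕ} {c : V → Fin k} {F : V → V → ℕ}
    (hF : G.IsLightSolution x α c F) {f : V → ℕ} (hf : IsLabeling F f) (t : V) :
    ∑ u with f u = f t, G.rowW F u ≤ α * ∑ u with f u = f t, G.lb x u := by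
  have h1 := hF.light ((underlying F).connectedComponentMk t)
  have hmem : ∀ u, u ∈ ((underlying F).connectedComponentMk t).supp ↔ f u = f t := fun u => by
    rw [SimpleGraph.ConnectedComponent.mem_supp_iff, SimpleGraph.ConnectedComponent.eq, hf]
  simp only [Instance.weightOn, Instance.lbOn, hmem] at h1
  convert h1 using 1
  refine Finset.sum_congr ?_ fun u hu => ?_
  · ext; simp
  · rw [Instance.rowW, Finset.sum_filter]
    refine Finset.sum_congr rfl fun v _ => ?_
    split_ifs with hv
    · rfl
    · have h0 : F u v = 0 := by
        by_contra h0
        simp only [Finset.mem_filter, Finset.mem_univ, true_and] at hu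
        exact hv ((hf.edge h0).symm.trans hu)
      simp [h0]

theorem IsLightSolution.leaves {x : V → V → ℝ} {α : ℝ} {k : ℕ} {c : V → Fin k} {F : V → V → ℕ}
    (hF : G.IsLightSolution x α c F) {L : V → ℕ} (hcL : ∀ u v, c u = c v ↔ L u = L v) (v : V) :
    ∃ a b, L a = L v ∧ L b ≠ L v ∧ F a b ≠ 0 := by
  have h1 := hF.crossing (c v)
  by_contra! h2
  have h3 : outCut F (Finset.univ.filter fun u => c u = c v) = 0 := by
    refine Finset.sum_eq_zero fun a ha => Finset.sum_eq_zero fun b hb => ?_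
    simp only [Finset.mem_filter, Finset.mem_univ, true_and, Finset.mem_compl] at ha hb
    exact h2 a b ((hcL a v).1 ha) fun h => hb ((hcL b v).2 h)
  omega

end MergingExistence

/-! ### Replacing components of `H` by components of `F` -/

section Replacement

variable {V : Type*} [Fintype V] [DecidableEq V] {G : Instance V}

/-- Keep the components of `H` with labels in `J` or outside `I`, and add the edges of `F` that
leave `Q`. -/
def replaced (H F : V → V → ℕ) (h : V → ℕ) (Q : V → Prop) (I J : ℕ → Prop) [DecidablePred Q]
    [DecidablePred I] [DecidablePred J] : V → V → ℕ :=
  fun u v => (if Q u then F u v else 0) + if J (h u) ∨ ¬ I (h u) then H u v else 0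

variable {H F : V → V → ℕ} {h f h' : V → ℕ} {Q : V → Prop} {I J : ℕ → Prop} [DecidablePred Q]
    [DecidablePred I] [DecidablePred J]

theorem eulerian_replaced (hH : G.IsEulerian H) (hh : IsLabeling H h) (hF : G.IsEulerian F)
    (hf : IsLabeling F f) (hQ : ∀ u v, f u = f v → (Q u ↔ Q v)) :
    G.IsEulerian (replaced H F h Q I J) where
  subset u v huv := by
    unfold replaced at huv
    by_cases h1 : F u v = 0
    · by_cases h2 : H u v = 0
      · simp [h1, h2] at huv
      · exact hH.subset u v h2
    · exact hF.subset u v h1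
  balanced := (balanced_iff _).2 <| (hF.bal.restrict Q fun u v huv => hQ u v (hf.edge huv)).add
    (hH.bal.restrict (fun u => J (h u) ∨ ¬ I (h u)) fun u v huv => by rw [hh.edge huv])

/-- The components after the replacement. -/
def replacedClass (h : V → ℕ) (Q : V → Prop) (I J : ℕ → Prop) [DecidablePred Q]
    [DecidablePred I] [DecidablePred J] (v : V) : Option (ℕ ⊕ V) :=
  if Q v ∨ J (h v) then none else if I (h v) then some (.inr v) else some (.inl (h v))

/-- `Q` and the retained components `J` form one component (`none`), vertices of removed components
outside it become isolated (`inr`), and the components outside `I` are untouched (`inl`). -/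
theorem replaced_labels (hh : IsLabeling H h)
    (hf : IsLabeling F f) (hQ : ∀ u v, f u = f v → (Q u ↔ Q v)) (hQI : ∀ v, Q v → I (h v))
    (hconn : ∀ u v, (Q u ∨ J (h u)) → (Q v ∨ J (h v)) →
      (underlying (replaced H F h Q I J)).Reachable u v)
    (hh' : IsLabeling (replaced H F h Q I J) h') (u v : V) :
    h' u = h' v ↔ replacedClass h Q I J u = replacedClass h Q I J v := by
  refine hh'.eq_iff (fun u v huv => ?_) (fun u v huv => ?_) u v
  · unfold replaced at huv
    by_cases h1 : Q u ∧ F u v ≠ 0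
    · have hv := (hQ u v (hf.edge h1.2)).1 h1.1
      simp [replacedClass, h1.1, hv]
    · have h2 : (J (h u) ∨ ¬ I (h u)) ∧ H u v ≠ 0 := by
        by_contra h2
        by_cases hq : Q u <;> by_cases hj : J (h u) ∨ ¬ I (h u) <;> simp_all
      have h3 := hh.edge h2.2
      rcases h2.1 with h4 | h4
      · simp [replacedClass, h4, ← h3]
      · have hu : ¬ Q u := fun hq => h4 (hQI u hq)
        have hv : ¬ Q v := fun hq => h4 (h3 ▸ hQI v hq)
        simp [replacedClass, hu, hv, h4, ← h3]
  · by_cases hu : Q u ∨ J (h u)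
    · have hv : Q v ∨ J (h v) := by
        by_contra hv
        simp only [replacedClass, hu, hv, if_true, if_false] at huv
        split_ifs at huv
      exact hconn u v hu hv
    · have hv : ¬ (Q v ∨ J (h v)) := by
        intro hv
        simp only [replacedClass, hu, hv, if_true, if_false] at huv
        split_ifs at huv
      simp only [replacedClass, hu, hv, if_false] at huv
      by_cases hIu : I (h u)
      · by_cases hIv : I (h v)
        · simp only [hIu, hIv, if_true, Option.some.injEq, Sum.inr.injEq] at huv
          rw [huv]
        · simp [hIu, hIv] at huv
      · by_cases hIv : I (h v)
        · simp [hIu, hIv] at huv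
        · simp only [hIu, hIv, if_false, Option.some.injEq, Sum.inl.injEq] at huv
          exact reachable_restrict (P := fun z => ¬ I (h z)) (fun a b hab => by rw [hh.edge hab])
            (fun a b ha hab => by simp [replaced, ha, hab]) hIu ((hh u v).1 huv)

/-- Every component of `F` in `Q` meets the retained component `j`, and every retained component
meets `Q`. -/
theorem connected_replaced (hh : IsLabeling H h) (hf : IsLabeling F f)
    (hQ : ∀ u v, f u = f v → (Q u ↔ Q v)) {j : ℕ} (hj : J j)
    (htouch : ∀ v, Q v → ∃ t, f t = f v ∧ h t = j) (hJ : ∀ l, J l → ∃ v, Q v ∧ h v = l) (u v : V)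
    (hu : Q u ∨ J (h u)) (hv : Q v ∨ J (h v)) :
    (underlying (replaced H F h Q I J)).Reachable u v := by
  have hFr : ∀ u v, Q u → f u = f v → (underlying (replaced H F h Q I J)).Reachable u v :=
    fun u v hu huv => reachable_restrict (P := Q) (fun a b hab => hQ a b (hf.edge hab))
      (fun a b ha hab => by simp [replaced, ha, hab]) hu ((hf u v).1 huv)
  have hHr : ∀ u v, J (h u) → h u = h v → (underlying (replaced H F h Q I J)).Reachable u v :=
    fun u v hu huv => reachable_restrict (P := fun u => J (h u))
      (fun a b hab => by rw [hh.edge hab])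
      (fun a b ha hab => by simp [replaced, ha, hab]) hu ((hh u v).1 huv)
  obtain ⟨t₀, -, ht₀⟩ := hJ j hj
  obtain ht₀ : h t₀ = j := ‹_›
  have hQr : ∀ v, Q v → (underlying (replaced H F h Q I J)).Reachable v t₀ := by
    intro v hv
    obtain ⟨t, ht, htj⟩ := htouch v hv
    exact (hFr v t hv ht.symm).trans (hHr t t₀ (htj ▸ hj) (htj.trans ht₀.symm))
  have key : ∀ v, (Q v ∨ J (h v)) → (underlying (replaced H F h Q I J)).Reachable v t₀ := by
    rintro v (hv | hv)
    · exact hQr v hv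
    · obtain ⟨w, hw, hwv⟩ := hJ _ hv
      exact (hHr v w hv hwv.symm).trans (hQr w hw)
  exact (key u hu).trans (key v hv).symm

theorem sum_class_replaced
    (hlab : ∀ u v, h' u = h' v ↔ replacedClass h Q I J u = replacedClass h Q I J v)
    (hQI : ∀ v, Q v → I (h v)) (hJI : ∀ l, J l → I l) (q : V → ℝ) (t : V) :
    ∑ v with h' v = h' t, q v = if Q t ∨ J (h t) then ∑ v with (Q v ∨ J (h v)), q v
      else if I (h t) then q t else ∑ v with h v = h t, q v := by
  split_ifs with h1 h2
  · refine Finset.sum_congr ?_ fun _ _ => rfl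
    ext v
    simp only [Finset.mem_filter, Finset.mem_univ, true_and, hlab]
    by_cases hv : Q v ∨ J (h v)
    · simp [replacedClass, h1, hv]
    · simp only [replacedClass, h1, hv, if_true, if_false, iff_false]
      split_ifs <;> simp
  · rw [← Finset.sum_singleton q t]
    refine Finset.sum_congr ?_ fun _ _ => rfl
    ext v
    simp only [Finset.mem_filter, Finset.mem_univ, true_and, hlab, Finset.mem_singleton]
    simp only [replacedClass, h1, h2, if_true, if_false]
    by_cases hv : Q v ∨ J (h v)
    · simp only [hv, if_true]
      refine ⟨fun h => (by cases h), fun h => absurd (h ▸ hv) h1⟩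
    · simp only [hv, if_false]
      split_ifs with h3
      · simp
      · simp only [Option.some.injEq, reduceCtorEq, false_iff]
        intro h4
        exact h3 (h4 ▸ h2)
  · refine Finset.sum_congr ?_ fun _ _ => rfl
    ext v
    simp only [Finset.mem_filter, Finset.mem_univ, true_and, hlab]
    simp only [replacedClass, h1, h2, if_false]
    by_cases hv : Q v ∨ J (h v)
    · simp only [hv, if_true]
      refine ⟨fun h => (by cases h), fun h3 => ?_⟩
      exact absurd (h3 ▸ hv.elim (hQI v) (hJI _)) h2
    · simp only [hv, if_false]
      split_ifs with h3
      · simp only [Option.some.injEq, reduceCtorEq, false_iff]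
        intro h4
        exact h2 (h4 ▸ h3)
      · simp

/-- Isolated vertices have no edges and untouched components are as before. The joined component
consists of an `A`-light and a `B`-light part that may overlap in vertices; `hle` says that the
overlap is affordable. -/
theorem light_replaced {A B : ℝ} {lb : V → ℝ} (hB : 0 ≤ B) (hlb : ∀ v, 0 ≤ lb v)
    (hlab : ∀ u v, h' u = h' v ↔ replacedClass h Q I J u = replacedClass h Q I J v)
    (hQ : ∀ u v, f u = f v → (Q u ↔ Q v)) (hQI : ∀ v, Q v → I (h v)) (hJI : ∀ l, J l → I l)
    (hH : ∀ t, ∑ u with h u = h t, G.rowW H u ≤ B * ∑ u with h u = h t, lb u)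
    (hF : ∀ t, ∑ u with f u = f t, G.rowW F u ≤ A * ∑ u with f u = f t, lb u)
    (hle : A * ∑ v with Q v, lb v + B * ∑ v with J (h v), lb v
      ≤ B * ∑ v with (Q v ∨ J (h v)), lb v) (t : V) :
    ∑ u with h' u = h' t, G.rowW (replaced H F h Q I J) u ≤ B * ∑ u with h' u = h' t, lb u := by
  rw [sum_class_replaced hlab hQI hJI, sum_class_replaced hlab hQI hJI]
  have hrow : ∀ u, G.rowW (replaced H F h Q I J) u
      = (if Q u then G.rowW F u else 0) + if J (h u) ∨ ¬ I (h u) then G.rowW H u else 0 := by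
    intro u
    unfold replaced
    rw [Instance.rowW_add]
    congr 1
    · split_ifs with h1 <;> simp [Instance.rowW, h1]
    · split_ifs with h1
      · simp [Instance.rowW, h1]
      · exact Instance.rowW_eq_zero G fun v => by simp [h1]
  split_ifs with h1 h2
  · have e1 : ∑ v with (Q v ∨ J (h v)), G.rowW (replaced H F h Q I J) v
        = ∑ v with Q v, G.rowW F v + ∑ v with J (h v), G.rowW H v := by
      simp only [Finset.sum_filter, ← Finset.sum_add_distrib, hrow]
      refine Finset.sum_congr rfl fun v _ => ?_
      by_cases h2 : Q v
      · have := hQI v h2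
        simp [h2, this]
      · by_cases h3 : J (h v) <;> simp [h2, h3]
    have e2 : ∑ v with Q v, G.rowW F v ≤ A * ∑ v with Q v, lb v := by
      have := sum_nonneg_of_classes (g := f) (q := fun v => A * lb v - G.rowW F v)
        (fun t => by
          rw [Finset.sum_sub_distrib, ← Finset.mul_sum]
          linarith [hF t]) Q hQ
      rw [Finset.sum_sub_distrib, ← Finset.mul_sum] at this
      linarith
    have e3 : ∑ v with J (h v), G.rowW H v ≤ B * ∑ v with J (h v), lb v := by
      have := sum_nonneg_of_classes (g := h) (q := fun v => B * lb v - G.rowW H v)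
        (fun t => by
          rw [Finset.sum_sub_distrib, ← Finset.mul_sum]
          linarith [hH t]) (fun v => J (h v)) (fun u v huv => by rw [huv])
      rw [Finset.sum_sub_distrib, ← Finset.mul_sum] at this
      linarith
    linarith
  · have h3 : ¬ Q t := fun h => h1 (Or.inl h)
    have h4 : ¬ J (h t) := fun h => h1 (Or.inr h)
    rw [hrow]
    simp only [h3, h4, h2, not_true_eq_false, or_self, if_false, add_zero]
    exact mul_nonneg hB (hlb t)
  · refine le_trans (le_of_eq (Finset.sum_congr rfl fun v hv => ?_)) (hH t)
    simp only [Finset.mem_filter, Finset.mem_univ, true_and] at hv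
    have h3 : ¬ Q v := fun h => h2 (hv ▸ hQI v h)
    rw [hrow]
    simp [h3, hv, h2]

/-- The potential of a labeling. -/
noncomputable def potential (lb : V → ℝ) (p : ℕ) (h : V → ℕ) : ℝ :=
  ∑ v, lb v * (∑ u with h u = h v, lb u) ^ p

/-- The potential is the sum of `lb(C)^(p+1)` over the classes. The joined class contributes the
power of its value, at most the classes in `I` are lost, and the isolated vertices contribute
nonnegative amounts. -/
theorem potential_replaced {lb : V → ℝ} (hlb : ∀ v, 0 ≤ lb v) (p : ℕ)
    (hlab : ∀ u v, h' u = h' v ↔ replacedClass h Q I J u = replacedClass h Q I J v)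
    (hQI : ∀ v, Q v → I (h v)) (hJI : ∀ l, J l → I l) :
    potential lb p h + (∑ v with (Q v ∨ J (h v)), lb v) ^ (p + 1)
      ≤ potential lb p h' + ∑ v with I (h v), lb v * (∑ u with h u = h v, lb u) ^ p := by
  set U := ∑ v with (Q v ∨ J (h v)), lb v with hU
  have hU0 : 0 ≤ U := Finset.sum_nonneg fun v _ => hlb v
  have e : U ^ (p + 1) = ∑ v with (Q v ∨ J (h v)), lb v * U ^ p := by
    rw [← Finset.sum_mul, ← hU, pow_succ, mul_comm]
  rw [e]
  simp only [potential, Finset.sum_filter, ← Finset.sum_add_distrib]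
  refine Finset.sum_le_sum fun v _ => ?_
  have hs := sum_class_replaced hlab hQI hJI lb v
  simp only [Finset.sum_filter] at hs hU
  rw [hs]
  have hpos : 0 ≤ lb v * lb v ^ p := mul_nonneg (hlb v) (pow_nonneg (hlb v) p)
  by_cases h1 : Q v ∨ J (h v)
  · have h2 : I (h v) := h1.elim (hQI v) (hJI _)
    simp only [h1, h2, if_true, hU]
    linarith
  · by_cases h2 : I (h v)
    · simp only [h1, h2, if_true, if_false]
      linarith
    · simp only [h1, h2, if_false]
      linarith

end Replacement

end ATSP

namespace ATSP

/-! ### Reduction to a nonnegative factor -/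

section LowerBound

variable {V : Type*} [Fintype V] [DecidableEq V] {G : Instance V} {x : V → V → ℝ}

theorem lb_nonneg (hx : G.HKFeasible x) (v : V) : 0 ≤ G.lb x v := by
  unfold Instance.lb outCut
  exact Finset.sum_nonneg fun a _ => Finset.sum_nonneg fun b _ =>
    mul_nonneg (hx.nonneg a b) (G.weight_nonneg' a b)

theorem lbOn_univ : G.lbOn x Set.univ = ∑ v, G.lb x v := by
  simp [Instance.lbOn]

/-- A negative value of `α` is possible only if `lb` vanishes. -/
theorem exists_nonneg_factor (hx : G.HKFeasible x) {α : ℝ}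
    (hsol : ∀ (k : ℕ) (c : V → Fin k), G.IsLCPartition c → ∃ F, G.IsLightSolution x α c F) :
    ∃ α', 0 ≤ α' ∧ ∀ v, α * G.lb x v = α' * G.lb x v := by
  by_cases h0 : ∀ v, G.lb x v = 0
  · exact ⟨0, le_rfl, fun v => by simp [h0]⟩
  push Not at h0
  obtain ⟨v, hv⟩ := h0
  refine ⟨α, ?_, fun _ => rfl⟩
  have hcard : 2 ≤ Fintype.card V := by
    by_contra hlt
    have hsub : Subsingleton V := Fintype.card_le_one_iff_subsingleton.1 (by omega)
    refine hv ?_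
    have : ({v} : Finset V)ᶜ = ∅ := by
      ext z; simp [Subsingleton.elim z v]
    simp [Instance.lb, outCut, this]
  -- For the partition into singletons, the component of `v` has nonnegative weight at most `α`
  -- times a positive number.
  obtain ⟨F, hF⟩ := hsol (Fintype.card V) (Fintype.equivFin V) ⟨hcard, (Fintype.equivFin V).surjective,
    fun i u hu w hw => by
      have : u = w := (Fintype.equivFin V).injective (hu.trans hw.symm)
      rw [this]⟩
  obtain ⟨f, hf⟩ := exists_isLabeling F
  have h1 := IsLightSolution.comp_le hF hf v
  have h2 : 0 ≤ ∑ u with f u = f v, G.rowW F u := Finset.sum_nonneg fun u _ => G.rowW_nonneg F u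
  have h3 : G.lb x v ≤ ∑ u with f u = f v, G.lb x u :=
    Finset.single_le_sum (f := G.lb x) (fun u _ => lb_nonneg hx u) (by simp)
  have h4 : 0 < G.lb x v := lt_of_le_of_ne (lb_nonneg hx v) (Ne.symm hv)
  exact nonneg_of_mul_nonneg_left (h2.trans h1) (h4.trans_le h3)

end LowerBound

/-! ### A tour of weight at most `5 α lb(V)` -/

section Existence

variable {V : Type*} [Fintype V] [DecidableEq V] {G : Instance V}

/-- For `b < a` the ratio `(a / b)^p` exceeds every bound, and there are only finitely many subset
sums. With such a `p`, one larger component outweighs the loss of all smaller ones. -/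
theorem exists_exponent (lb : V → ℝ) (hlb : ∀ v, 0 ≤ lb v) (T : ℝ) :
    ∃ p : ℕ, ∀ A B : Finset V, ∑ v ∈ B, lb v < ∑ v ∈ A, lb v →
      T * (∑ v ∈ B, lb v) ^ p < (∑ v ∈ A, lb v) ^ (p + 1) := by
  have key : ∀ A B : Finset V, ∀ᶠ p : ℕ in Filter.atTop, ∑ v ∈ B, lb v < ∑ v ∈ A, lb v →
      T * (∑ v ∈ B, lb v) ^ p < (∑ v ∈ A, lb v) ^ (p + 1) := by
    intro A B
    by_cases hlt : ∑ v ∈ B, lb v < ∑ v ∈ A, lb v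
    · have hB : 0 ≤ ∑ v ∈ B, lb v := Finset.sum_nonneg fun v _ => hlb v
      generalize ∑ v ∈ B, lb v = b at *
      generalize ∑ v ∈ A, lb v = a at *
      have ha : 0 < a := hB.trans_lt hlt
      rcases hB.eq_or_lt with rfl | hb
      · filter_upwards [Filter.eventually_ge_atTop 1] with p hp _
        rw [zero_pow (by omega), mul_zero]
        positivity
      · have h1 : 1 < a / b := (one_lt_div hb).2 hlt
        filter_upwards [(tendsto_pow_atTop_atTop_of_one_lt h1).eventually_gt_atTop (T / a)] with p hp _
        rw [div_pow, div_lt_div_iff₀ ha (by positivity)] at hp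
        rw [pow_succ]
        exact hp
    · exact Filter.Eventually.of_forall fun p h => absurd h hlt
  have := Filter.eventually_all.2 fun A => Filter.eventually_all.2 (key A)
  exact this.exists

/-- A component structure of maximal potential. -/
theorem exists_max_potential (G : Instance V) (lb : V → ℝ) (hlb : ∀ v, 0 ≤ lb v) {B : ℝ}
    (hB : 0 ≤ B) (p : ℕ) :
    ∃ (H : V → V → ℕ) (h : V → ℕ), G.IsEulerian H ∧ IsLabeling H h ∧
      (∀ t, ∑ u with h u = h t, G.rowW H u ≤ B * ∑ u with h u = h t, lb u) ∧
      ∀ (H' : V → V → ℕ) (h' : V → ℕ), G.IsEulerian H' → IsLabeling H' h' →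
        (∀ t, ∑ u with h' u = h' t, G.rowW H' u ≤ B * ∑ u with h' u = h' t, lb u) →
        potential lb p h' ≤ potential lb p h := by
  set S : Set ℝ := {r | ∃ (H : V → V → ℕ) (h : V → ℕ), G.IsEulerian H ∧ IsLabeling H h ∧
      (∀ t, ∑ u with h u = h t, G.rowW H u ≤ B * ∑ u with h u = h t, lb u) ∧
      potential lb p h = r} with hS
  -- There may be infinitely many multigraphs `H`, but the potential depends only on the partition
  -- into components.
  have hfin : S.Finite := by
    refine (Set.finite_range fun r : V → V → Bool =>
      ∑ v, lb v * (∑ u with r u v = true, lb u) ^ p).subset ?_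
    rintro _ ⟨H, h, -, -, -, rfl⟩
    exact ⟨fun u v => decide (h u = h v), by simp [potential]⟩
  have hne : S.Nonempty := by
    obtain ⟨h, hh⟩ := exists_isLabeling (0 : V → V → ℕ)
    refine ⟨_, 0, h, ⟨fun u v h => absurd rfl h, fun v => by simp [outCut, inCut]⟩, hh,
      fun t => ?_, rfl⟩
    rw [Finset.sum_eq_zero fun u _ => Instance.rowW_eq_zero G fun v => rfl]
    exact mul_nonneg hB (Finset.sum_nonneg fun v _ => hlb v)
  obtain ⟨_, ⟨H, h, h1, h2, h3, rfl⟩, hmax⟩ := Set.exists_max_image S id hfin hne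
  exact ⟨H, h, h1, h2, h3, fun H' h' a b c => hmax _ ⟨H', h', a, b, c, rfl⟩⟩

/-- The class of the label of the most valuable vertex with label `c` under `f`. -/
theorem exists_index (f h : V → ℕ) (val : ℕ → ℝ) : ∃ ind : ℕ → ℕ, ∀ v,
    (∃ t, f t = f v ∧ h t = ind (f v)) ∧ ∀ t, f t = f v → val (h t) ≤ val (ind (f v)) := by
  have : ∀ c, ∃ i, ∀ v, f v = c →
      (∃ t, f t = f v ∧ h t = i) ∧ ∀ t, f t = f v → val (h t) ≤ val i := by
    intro c
    by_cases hc : ∃ v, f v = c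
    · obtain ⟨v, rfl⟩ := hc
      obtain ⟨t, ht, hmax⟩ := exists_top f (fun v => val (h v)) v
      refine ⟨h t, fun w hw => ?_⟩
      rw [hw]
      exact ⟨⟨t, ht, rfl⟩, hmax⟩
    · exact ⟨0, fun v hv => absurd ⟨v, hv⟩ hc⟩
  choose ind hind using this
  exact ⟨ind, fun v => hind _ v rfl⟩

theorem exists_partition (L : V → ℕ) : ∃ (k : ℕ) (c : V → Fin k), Function.Surjective c ∧
    (∀ u v, c u = c v ↔ L u = L v) ∧ ∀ u v, L u ≠ L v → 2 ≤ k := by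
  set e := (Finset.univ.image L).equivFin
  refine ⟨_, fun v => e ⟨L v, Finset.mem_image_of_mem L (Finset.mem_univ v)⟩, fun i => ?_,
    fun u v => ?_, fun u v huv => ?_⟩
  · obtain ⟨y, hy⟩ := e.surjective i
    obtain ⟨v, -, hv⟩ := Finset.mem_image.1 y.2
    exact ⟨v, (congrArg e (Subtype.ext hv)).trans hy⟩
  · rw [e.apply_eq_iff_eq, Subtype.mk.injEq]
  · exact Finset.one_lt_card.2 ⟨L u, by simp, L v, by simp, huv⟩

/-- The five consists of `2α` for the weight of `H`, `α` for the initial credit that pays for the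
closed walks, and `2α` for the charges. -/
theorem exists_tour_five {x : V → V → ℝ} {α : ℝ} (hx : G.HKFeasible x)
    (hsol : ∀ (k : ℕ) (c : V → Fin k), G.IsLCPartition c → ∃ F, G.IsLightSolution x α c F) :
    ∃ F, G.IsTour F ∧ G.totalWeight F ≤ 5 * α * G.lbOn x Set.univ := by
  classical
  have hV : Nonempty V := G.nonempty
  obtain ⟨α', hα', hαα'⟩ := exists_nonneg_factor hx hsol
  set lb := G.lb x with hlbdef
  have hlb : ∀ v, 0 ≤ lb v := lb_nonneg hx
  obtain ⟨p, hp⟩ := exists_exponent lb hlb (∑ v, lb v)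
  obtain ⟨H, h, hH, hh, hlight, hmaxpot⟩ :=
    exists_max_potential G lb hlb (B := 2 * α') (by positivity) p
  set m : ℕ → ℝ := fun j => ∑ v with h v = j, lb v with hm
  have hm0 : ∀ j, 0 ≤ m j := fun j => Finset.sum_nonneg fun v _ => hlb v
  -- no replacement increases the potential
  have hno : ∀ (F : V → V → ℕ) (f : V → ℕ) (Q : V → Prop) (J : ℕ → Prop) [DecidablePred Q] [DecidablePred J]
      (j : ℕ),
      G.IsEulerian F → IsLabeling F f →
      (∀ t, ∑ u with f u = f t, G.rowW F u ≤ α' * ∑ u with f u = f t, lb u) →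
      (∀ u v, f u = f v → (Q u ↔ Q v)) → (∀ l, J l → ∃ v, Q v ∧ h v = l) →
      (∀ v, Q v → m (h v) ≤ m j) →
      (∀ u v, (Q u ∨ J (h u)) → (Q v ∨ J (h v)) →
        (underlying (replaced H F h Q (fun l => ∃ v, Q v ∧ h v = l) J)).Reachable u v) →
      α' * ∑ v with Q v, lb v + 2 * α' * ∑ v with J (h v), lb v
        ≤ 2 * α' * ∑ v with (Q v ∨ J (h v)), lb v →
      ∑ v with (Q v ∨ J (h v)), lb v ≤ m j := by
    intro F f Q J _ _ j hF hf hFl hQ hJ hQm hconn hle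
    by_contra hgt
    push Not at hgt
    obtain ⟨h', hh'⟩ := exists_isLabeling (replaced H F h Q (fun l => ∃ v, Q v ∧ h v = l) J)
    have hQI : ∀ v, Q v → ∃ w, Q w ∧ h w = h v := fun v hv => ⟨v, hv, rfl⟩
    have hlab := replaced_labels (I := fun l => ∃ v, Q v ∧ h v = l) hh hf hQ hQI hconn hh'
    have h1 := hmaxpot _ h' (eulerian_replaced hH hh hF hf hQ) hh'
      (light_replaced (by positivity) hlb hlab hQ hQI hJ hlight hFl hle)
    have h2 := potential_replaced hlb p hlab hQI hJ
    -- The removed components have value at most `m j`, so the loss is at most `lb(V) (m j)^p`. By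
    -- the choice of `p` this is less than the gain.
    have h3 := hp (Finset.univ.filter fun v => Q v ∨ J (h v)) (Finset.univ.filter fun v => h v = j)
      hgt
    have h4 : ∑ v with (∃ w, Q w ∧ h w = h v), lb v * (∑ u with h u = h v, lb u) ^ p
        ≤ (∑ v, lb v) * m j ^ p := by
      rw [Finset.sum_mul]
      refine le_trans (Finset.sum_le_sum (g := fun v => lb v * m j ^ p) fun v hv => ?_)
        (Finset.sum_le_sum_of_subset_of_nonneg (Finset.filter_subset _ _) fun v _ _ =>
          mul_nonneg (hlb v) (pow_nonneg (hm0 j) p))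
      simp only [Finset.mem_filter, Finset.mem_univ, true_and] at hv
      obtain ⟨w, hw, hwv⟩ := hv
      refine mul_le_mul_of_nonneg_left (pow_le_pow_left₀ (hm0 (h v)) ?_ p) (hlb v)
      have := hQm w hw
      rwa [hwv] at this
    have h5 : (∑ v with h v = j, lb v) = m j := rfl
    rw [h5] at h3
    linarith
  -- merging
  have hstep : ∀ N, ∀ E L, MergeState G h m α' (2 * α')
      (∑ v, α' * lb v + G.totalWeight H) E L → (Finset.univ.image L).card ≤ N →
      ∃ E L, MergeState G h m α' (2 * α') (∑ v, α' * lb v + G.totalWeight H) E L ∧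
        ∀ u v, L u = L v := by
    intro N
    induction N with
    | zero =>
      intro E L _ hcard
      have : (Finset.univ.image L).Nonempty := Finset.univ_nonempty.image L
      have := this.card_pos
      omega
    | succ N ih =>
      intro E L hE hcard
      by_cases hL : ∀ u v, L u = L v
      · exact ⟨E, L, hE, hL⟩
      push Not at hL
      obtain ⟨u₀, v₀, huv₀⟩ := hL
      obtain ⟨k, c, hc, hcL, hk⟩ := exists_partition L
      obtain ⟨F, hF⟩ := hsol k c (isLCPartition_of_labeling hE.eulerian hE.labeling
        (hk _ _ huv₀) hc hcL)
      obtain ⟨f, hf⟩ := exists_isLabeling F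
      have hFl : ∀ t, ∑ u with f u = f t, G.rowW F u ≤ α' * ∑ u with f u = f t, lb u := by
        intro t
        refine (IsLightSolution.comp_le hF hf t).trans (le_of_eq ?_)
        rw [Finset.mul_sum, Finset.mul_sum]
        exact Finset.sum_congr rfl fun v _ => hαα' v
      obtain ⟨ind, hind⟩ := exists_index f h m
      have hcheap : IsCheap G h L m α' (2 * α') F f (fun v => decide (Crossing F f L v)) ind := by
        refine ⟨hF.eulerian, hf, IsLightSolution.leaves hF hcL, fun v => by simp,
          fun v _ => (hind v).1, fun v _ => ?_, fun j => ?_⟩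
        · refine (hFl v).trans (mul_le_mul_of_nonneg_left ?_ hα')
          have hor : ∑ u with (f u = f v ∨ False), lb u = ∑ u with f u = f v, lb u := by
            simp only [Finset.sum_filter, or_false]
          -- With `J` empty, the components of `H` met by this component of `F` are replaced by it
          -- alone. It therefore cannot be more valuable than the best of them.
          have := hno F f (fun u => f u = f v) (fun _ => False) (ind (f v)) hF.eulerian hf hFl
            (fun a b hab => by rw [hab]) (fun l hl => hl.elim) (fun u hu => (hind v).2 u hu)
            (fun a b ha hb => ?_) (by
              have h1 : 0 ≤ ∑ u with f u = f v, lb u := Finset.sum_nonneg fun v _ => hlb v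
              rw [hor, Finset.sum_eq_zero (s := Finset.univ.filter fun _ => False) (by simp)]
              linarith [mul_nonneg hα' h1])
          · rwa [hor] at this
          · simp only [or_false] at ha hb
            exact reachable_restrict (P := fun u => f u = f v) (fun a b hab => by rw [hf.edge hab])
              (fun a b ha hab => by simp [replaced, ha, hab]) ha ((hf a b).1 (ha.trans hb.symm))
        · set Q : V → Prop := fun u => decide (Crossing F f L u) = true ∧ ind (f u) = j with hQdef
          have hQ : ∀ u v, f u = f v → (Q u ↔ Q v) := fun u v huv => by
            simp only [hQdef, decide_eq_true_eq]; rw [Crossing, Crossing, huv]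
          have hsum : ∑ u with Q u, G.rowW F u ≤ α' * ∑ u with Q u, lb u := by
            have := sum_nonneg_of_classes (g := f) (q := fun v => α' * lb v - G.rowW F v)
              (fun t => by
                rw [Finset.sum_sub_distrib, ← Finset.mul_sum]
                linarith [hFl t]) Q hQ
            rw [Finset.sum_sub_distrib, ← Finset.mul_sum] at this
            linarith
          refine hsum.trans ?_
          by_contra hgt
          push Not at hgt
          have hgt' : 2 * m j < ∑ u with Q u, lb u := by
            by_contra hle
            push Not at hle
            have := mul_le_mul_of_nonneg_left hle hα'
            linarith
          have hQne : ∃ v, Q v := by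
            by_contra hemp
            push Not at hemp
            rw [Finset.sum_filter, Finset.sum_eq_zero fun v _ => if_neg (hemp v)] at hgt'
            linarith [hm0 j]
          have htouch : ∀ v, Q v → ∃ t, f t = f v ∧ h t = j := fun v hv => by
            obtain ⟨t, ht, htj⟩ := (hind v).1
            exact ⟨t, ht, htj.trans hv.2⟩
          have hJ : ∀ l, l = j → ∃ v, Q v ∧ h v = l := by
            rintro l rfl
            obtain ⟨v, hv⟩ := hQne
            obtain ⟨t, ht, htj⟩ := htouch v hv
            exact ⟨t, (hQ t v ht).2 hv, htj⟩
          have hU : ∑ v with Q v, lb v ≤ ∑ v with (Q v ∨ h v = j), lb v :=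
            Finset.sum_le_sum_of_subset_of_nonneg
              (fun v hv => by
                simp only [Finset.mem_filter, Finset.mem_univ, true_and] at hv ⊢
                exact Or.inl hv) fun v _ _ => hlb v
          -- The component `j` is retained to connect everything charged to it. Its weight, at most
          -- `2α m j`, fits into the slack `α lb(Q)` between the `α`-light `F` and the required
          -- `2α`, since `lb(Q) > 2 m j`.
          have := hno F f Q (fun l => l = j) j hF.eulerian hf hFl hQ hJ
            (fun v hv => by rw [← hv.2]; exact (hind v).2 v rfl)
            (connected_replaced (J := fun l => l = j) hh hf hQ rfl htouch hJ) (by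
              have e : ∑ v with h v = j, lb v = m j := rfl
              simp only [e]
              have h1 := mul_le_mul_of_nonneg_left hgt'.le hα'
              have h2 := mul_le_mul_of_nonneg_left hU hα'
              linarith)
          linarith [hm0 j]
      obtain ⟨E', L', hE', hlt⟩ := hE.exists_next hcheap hα' hm0
      exact ih E' L' hE' (by omega)
  obtain ⟨E, L, hE, hL⟩ := hstep _ H h (MergeState.init hH hh hh fun t => by
    simp only [hm]; rw [Finset.mul_sum]) le_rfl
  refine ⟨E, hE.isTour hL, ?_⟩
  have h1 := hE.totalWeight_le hα' (by positivity) hm0 (b := lb) (fun t => le_rfl)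
  have h2 : G.totalWeight H ≤ 2 * α' * ∑ v, lb v := by
    have := sum_nonneg_of_classes (g := h) (q := fun v => 2 * α' * lb v - G.rowW H v)
      (fun t => by
        rw [Finset.sum_sub_distrib, ← Finset.mul_sum]
        linarith [hlight t]) (fun _ => True) (fun _ _ _ => Iff.rfl)
    rw [Finset.filter_true, Finset.sum_sub_distrib, ← Finset.mul_sum] at this
    have e : G.totalWeight H = ∑ v, G.rowW H v := rfl
    linarith
  have h3 : α * ∑ v, lb v = α' * ∑ v, lb v := by
    rw [Finset.mul_sum, Finset.mul_sum]
    exact Finset.sum_congr rfl fun v _ => hαα' v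
  rw [lbOn_univ, mul_assoc, h3]
  rw [← Finset.mul_sum] at h1
  linarith

end Existence

end ATSP

namespace ATSP

/-! ### Choosing the retained components -/

section Intervals

/-- If the items `c i` have size at most `K` and total size at most `2 * K`, then some interval of
size at most `K` has at least a third of the total profit. -/
theorem exists_interval {N : ℕ} (hN : 0 < N) {c b : ℕ → ℝ}
    (hb : ∀ i, 0 ≤ b i) {K : ℝ} (hcK : ∀ i < N, c i ≤ K)
    (htot : ∑ i ∈ Finset.range N, c i ≤ 2 * K) :
    ∃ p < N, ∃ q < N, ∑ i ∈ Finset.range N with (p ≤ i ∧ i ≤ q), c i ≤ K ∧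
      ∑ i ∈ Finset.range N, b i ≤ 3 * ∑ i ∈ Finset.range N with (p ≤ i ∧ i ≤ q), b i := by
  have hb0 : ∀ s : Finset ℕ, 0 ≤ ∑ i ∈ s, b i := fun s => Finset.sum_nonneg fun i _ => hb i
  by_cases hall : ∑ i ∈ Finset.range N, c i ≤ K
  · refine ⟨0, hN, N - 1, by omega, ?_⟩
    have e : (Finset.range N).filter (fun i => 0 ≤ i ∧ i ≤ N - 1) = Finset.range N := by
      refine Finset.filter_true_of_mem fun i hi => ?_
      rw [Finset.mem_range] at hi
      omega
    rw [e]
    exact ⟨hall, by linarith [hb0 (Finset.range N)]⟩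
  push Not at hall
  have hex : ∃ t, K < ∑ i ∈ Finset.range (t + 1), c i :=
    ⟨N - 1, by rwa [Nat.sub_add_cancel hN]⟩
  classical
  -- `t` is the first item at which the prefix exceeds `K`. The items before `t`, the item `t`, and
  -- the items after `t` all have size at most `K`, the last group because the total is at most `2 *
  -- K`. One of the three has a third of the profit.
  set t := Nat.find hex with ht
  have ht1 : K < ∑ i ∈ Finset.range (t + 1), c i := Nat.find_spec hex
  have htN : t < N := by
    have : t ≤ N - 1 := Nat.find_min' hex (by rwa [Nat.sub_add_cancel hN])
    omega
  have ht0 : 0 < t := by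
    by_contra h0
    have h1 : t = 0 := by omega
    rw [h1] at ht1
    have := hcK 0 hN
    simp at ht1
    linarith
  have ht2 : ∑ i ∈ Finset.range t, c i ≤ K := by
    have := Nat.find_min hex (m := t - 1) (by omega)
    rw [Nat.sub_add_cancel ht0] at this
    linarith
  have e1 : (Finset.range N).filter (fun i => 0 ≤ i ∧ i ≤ t - 1) = Finset.range t := by
    ext i; simp only [Finset.mem_filter, Finset.mem_range]; omega
  have e2 : (Finset.range N).filter (fun i => t ≤ i ∧ i ≤ t) = {t} := by
    ext i; simp only [Finset.mem_filter, Finset.mem_range, Finset.mem_singleton]; omega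
  have e3 : (Finset.range N).filter (fun i => t + 1 ≤ i ∧ i ≤ N - 1) = Finset.Ico (t + 1) N := by
    ext i; simp only [Finset.mem_filter, Finset.mem_range, Finset.mem_Ico]; omega
  have hsplit : ∀ a : ℕ → ℝ, ∑ i ∈ Finset.range N, a i
      = ∑ i ∈ Finset.range t, a i + a t + ∑ i ∈ Finset.Ico (t + 1) N, a i := fun a => by
    rw [← Finset.sum_range_succ, Finset.sum_range_add_sum_Ico _ (by omega)]
  by_cases h1 : ∑ i ∈ Finset.range N, b i ≤ 3 * ∑ i ∈ Finset.range t, b i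
  · exact ⟨0, hN, t - 1, by omega, by rw [e1]; exact ⟨ht2, h1⟩⟩
  by_cases h2 : ∑ i ∈ Finset.range N, b i ≤ 3 * b t
  · exact ⟨t, htN, t, htN, by rw [e2]; simpa using ⟨hcK t htN, h2⟩⟩
  push Not at h1 h2
  have h3 := hsplit b
  have h4 : ∑ i ∈ Finset.range N, b i ≤ 3 * ∑ i ∈ Finset.Ico (t + 1) N, b i := by linarith
  have h5 : t + 1 < N := by
    by_contra h5
    rw [Finset.Ico_eq_empty (by omega)] at h4
    simp only [Finset.sum_empty, mul_zero] at h4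
    linarith [hb0 (Finset.range t)]
  refine ⟨t + 1, h5, N - 1, by omega, ?_⟩
  rw [e3]
  refine ⟨?_, h4⟩
  have h6 := hsplit c
  rw [Finset.sum_range_succ] at ht1
  linarith

theorem sum_interval_labels {V : Type*} [Fintype V] {N : ℕ} {h : V → ℕ} (hN : ∀ v, h v < N)
    (a : V → ℝ) (P : ℕ → Prop) [DecidablePred P] :
    ∑ l ∈ Finset.range N with P l, ∑ v with h v = l, a v = ∑ v with P (h v), a v := by
  rw [← Finset.sum_fiberwise_of_maps_to (s := Finset.univ.filter fun v => P (h v))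
    (t := (Finset.range N).filter P) (g := h) (fun v hv => by
      simp only [Finset.mem_filter, Finset.mem_univ, true_and, Finset.mem_range] at hv ⊢
      exact ⟨hN v, hv⟩)]
  refine Finset.sum_congr rfl fun l hl => Finset.sum_congr ?_ fun _ _ => rfl
  simp only [Finset.mem_filter, Finset.mem_range] at hl
  ext v
  simp only [Finset.mem_filter, Finset.mem_univ, true_and]
  exact ⟨fun hv => ⟨hv ▸ hl.2, hv⟩, fun hv => hv.2⟩

/-- If the crossing components that are charged to `j` are too valuable, then a suitable interval of
the components of `(V, H)` that they meet can be joined to them. -/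
theorem exists_good_interval {V : Type*} [Fintype V] {N : ℕ} {h : V → ℕ} (hN : ∀ v, h v < N)
    {lb : V → ℝ} (hlb : ∀ v, 0 ≤ lb v) {Q : V → Prop} {I : ℕ → Prop} [DecidablePred Q]
    [DecidablePred I] (hI : ∀ l, I l ↔ ∃ v, Q v ∧ h v = l) {j : ℕ} (hj : I j) {m : ℝ}
    (hmax : ∀ v, Q v → ∑ u with h u = h v, lb u ≤ ∑ u with h u = j, lb u)
    (hm : ∑ u with h u = j, lb u ≤ m) (hgt : 3 * m < ∑ v with Q v, lb v) :
    ∃ p < N, ∃ q < N,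
      3 * ∑ v with (Q v ∧ (h v = j ∨ I (h v) ∧ p ≤ h v ∧ h v ≤ q)), lb v
        ≤ 2 * ∑ v with Q v, lb v ∧
      (∑ u with h u = j, lb u) * (∑ v with I (h v), lb v) + m * m
        ≤ (∑ v with (h v = j ∨ I (h v) ∧ p ≤ h v ∧ h v ≤ q), lb v + ∑ v with Q v, lb v
            - ∑ v with (Q v ∧ (h v = j ∨ I (h v) ∧ p ≤ h v ∧ h v ≤ q)), lb v)
          * (∑ v with (h v = j ∨ I (h v) ∧ p ≤ h v ∧ h v ≤ q), lb v + ∑ v with Q v, lb v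
            - ∑ v with (Q v ∧ (h v = j ∨ I (h v) ∧ p ≤ h v ∧ h v ≤ q)), lb v) := by
  set a := ∑ u with h u = j, lb u with ha
  set Lam := ∑ v with Q v, lb v with hLam
  have ha0 : 0 ≤ a := Finset.sum_nonneg fun v _ => hlb v
  obtain ⟨v₀, hv₀, hv₀j⟩ := (hI j).1 hj
  have hN0 : 0 < N := (Nat.zero_le _).trans_lt (hN v₀)
  -- The items are the labels other than `j`, which is retained in any case. The size of an item is
  -- its overlap with `Q`, its profit the `lb` of the whole component if it is met.
  set cv : V → ℝ := fun v => if Q v ∧ h v ≠ j then lb v else 0 with hcv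
  set bv : V → ℝ := fun v => if I (h v) ∧ h v ≠ j then lb v else 0 with hbv
  set cj := ∑ v with (Q v ∧ h v = j), lb v with hcj
  have hbv0 : ∀ v, 0 ≤ bv v := fun v => by simp only [hbv]; split_ifs <;> simp [hlb]
  have hcja : cj ≤ a := Finset.sum_le_sum_of_subset_of_nonneg
    (fun v hv => by
      simp only [Finset.mem_filter, Finset.mem_univ, true_and] at hv ⊢
      exact hv.2) fun v _ _ => hlb v
  have hcj0 : 0 ≤ cj := Finset.sum_nonneg fun v _ => hlb v
  have htotc : ∑ v, cv v + cj = Lam := by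
    simp only [hcv, hcj, hLam, Finset.sum_filter, ← Finset.sum_add_distrib]
    refine Finset.sum_congr rfl fun v _ => ?_
    by_cases h1 : Q v <;> by_cases h2 : h v = j <;> simp [h1, h2]
  have htotb : ∑ v, bv v + a = ∑ v with I (h v), lb v := by
    simp only [hbv, ha, Finset.sum_filter, ← Finset.sum_add_distrib]
    refine Finset.sum_congr rfl fun v _ => ?_
    by_cases h2 : h v = j
    · simp [h2, hj]
    · simp [h2]
  have hitem : ∀ l, ∑ v with h v = l, cv v ≤ a := by
    intro l
    by_cases hl : ∃ v, Q v ∧ h v = l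
    · obtain ⟨w, hw, rfl⟩ := hl
      refine le_trans (Finset.sum_le_sum fun v _ => ?_) (hmax w hw)
      simp only [hcv]; split_ifs <;> simp [hlb]
    · refine le_trans (Finset.sum_eq_zero fun v hv => ?_).le ha0
      simp only [Finset.mem_filter, Finset.mem_univ, true_and] at hv
      simp only [hcv]
      rw [if_neg]
      exact fun h1 => hl ⟨v, h1.1, hv⟩
  have hall : ∀ d : V → ℝ, ∑ l ∈ Finset.range N, ∑ v with h v = l, d v = ∑ v, d v := fun d => by
    have := sum_interval_labels hN d (fun _ => True)
    simpa using this
  obtain ⟨p, hp, q, hq, h1, h2⟩ := exists_interval hN0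
    (c := fun l => ∑ v with h v = l, cv v) (b := fun l => ∑ v with h v = l, bv v)
    -- Together with the overlap `cj` of `j`, at most two thirds of `Q` will be covered by retained
    -- components. Both size conditions follow from `cj ≤ a ≤ m < Lam / 3`.
    (K := 2 / 3 * Lam - cj)
    (fun l => Finset.sum_nonneg fun v _ => hbv0 v) (fun l _ => by linarith [hitem l])
    (by rw [hall]; linarith)
  rw [sum_interval_labels hN _ (fun l => p ≤ l ∧ l ≤ q)] at h1 h2
  rw [hall] at h2
  refine ⟨p, hp, q, hq, ?_⟩
  have hcov : ∑ v with (Q v ∧ (h v = j ∨ I (h v) ∧ p ≤ h v ∧ h v ≤ q)), lb v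
      = cj + ∑ v with (p ≤ h v ∧ h v ≤ q), cv v := by
    simp only [hcv, hcj, Finset.sum_filter, ← Finset.sum_add_distrib]
    refine Finset.sum_congr rfl fun v _ => ?_
    by_cases h1 : Q v
    · have hIv : I (h v) := (hI _).2 ⟨v, h1, rfl⟩
      by_cases h2 : h v = j
      · simp [h1, h2]
      · simp [h1, h2, hIv]
    · simp [h1]
  have hP : ∑ v with (h v = j ∨ I (h v) ∧ p ≤ h v ∧ h v ≤ q), lb v
      = a + ∑ v with (p ≤ h v ∧ h v ≤ q), bv v := by
    simp only [hbv, ha, Finset.sum_filter, ← Finset.sum_add_distrib]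
    refine Finset.sum_congr rfl fun v _ => ?_
    by_cases h2 : h v = j
    · simp [h2]
    · by_cases h1 : I (h v) <;> simp [h1, h2]
  rw [hcov, hP, ← htotb]
  set y := ∑ v with (p ≤ h v ∧ h v ≤ q), bv v
  have hy : 0 ≤ y := Finset.sum_nonneg fun v _ => hbv0 v
  -- The part of `Q` outside the retained components is at least a third of `Q`, hence at least `m ≥
  -- a`. The joined set has value `a + y + z`, and its square is at least `a² + 3ay + m²`, where
  -- `3y` bounds the total profit.
  set z := Lam - (cj + ∑ v with (p ≤ h v ∧ h v ≤ q), cv v) with hz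
  have hzm : m ≤ z := by linarith
  refine ⟨by linarith, ?_⟩
  have e : a + y + Lam - (cj + ∑ v with (p ≤ h v ∧ h v ≤ q), cv v) = a + y + z := by
    rw [hz]; ring
  rw [e]
  have h3 : a * (∑ v, bv v) ≤ a * (3 * y) := mul_le_mul_of_nonneg_left h2 ha0
  nlinarith [mul_nonneg ha0 hy, mul_le_mul hzm hzm (ha0.trans hm) ((ha0.trans hm).trans hzm),
    mul_le_mul_of_nonneg_left (hm.trans hzm) ha0, mul_le_mul_of_nonneg_left (hm.trans hzm) hy,
    sq_nonneg (a - y)]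

end Intervals

end ATSP

/-! ### A language of bounded loops -/

namespace ATSP

/-- Programs without `call` in which every loop runs once for each `x = 0, …, n - 1`, where `n` is
the number of vertices. -/
inductive Cmd where
  | skip
  | nset (a : ℕ) (i j e : NExp)
  | rset (a : ℕ) (i j : NExp) (e : RExp)
  | seq (c d : Cmd)
  | ite (b : BExp) (c d : Cmd)
  | each (x : ℕ) (c : Cmd)

infixr:60 ";;" => Cmd.seq

/-- The natural number in the array `x` of size one. -/
def NExp.var (x : ℕ) : NExp := .get x (.const 0) (.const 0)

/-- The real number in the array `x` of size one. -/
def RExp.var (x : ℕ) : RExp := .get x (.const 0) (.const 0)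

/-- The entry `i` of a vector. -/
def NExp.at (a : ℕ) (i : NExp) : NExp := .get a i (.const 0)

/-- The entry `i` of a vector of real numbers. -/
def RExp.at (a : ℕ) (i : NExp) : RExp := .get a i (.const 0)

def BExp.natEq (e₁ e₂ : NExp) : BExp := .and (.natLe e₁ e₂) (.natLe e₂ e₁)

def BExp.or (b₁ b₂ : BExp) : BExp := .not (.and (.not b₁) (.not b₂))

@[simp] theorem NExp.eval_const (s : Store) (k : ℕ) : (NExp.const k).eval s = k := rfl
@[simp] theorem NExp.eval_get (s : Store) (a : ℕ) (i j : NExp) :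
    (NExp.get a i j).eval s = s.nat a (i.eval s) (j.eval s) := rfl
@[simp] theorem NExp.eval_add (s : Store) (d e : NExp) :
    (NExp.add d e).eval s = d.eval s + e.eval s := rfl
@[simp] theorem NExp.eval_sub (s : Store) (d e : NExp) :
    (NExp.sub d e).eval s = d.eval s - e.eval s := rfl
@[simp] theorem NExp.eval_var (s : Store) (x : ℕ) : (NExp.var x).eval s = s.nat x 0 0 := rfl
@[simp] theorem NExp.eval_at (s : Store) (a : ℕ) (i : NExp) :
    (NExp.at a i).eval s = s.nat a (i.eval s) 0 := rfl
@[simp] theorem RExp.eval_const (s : Store) (q : ℚ) : (RExp.const q).eval s = q := rfl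
@[simp] theorem RExp.eval_get (s : Store) (a : ℕ) (i j : NExp) :
    (RExp.get a i j).eval s = s.real a (i.eval s) (j.eval s) := rfl
@[simp] theorem RExp.eval_ofNat (s : Store) (e : NExp) :
    (RExp.ofNat e).eval s = (e.eval s : ℝ) := rfl
@[simp] theorem RExp.eval_add (s : Store) (d e : RExp) :
    (RExp.add d e).eval s = d.eval s + e.eval s := rfl
@[simp] theorem RExp.eval_sub (s : Store) (d e : RExp) :
    (RExp.sub d e).eval s = d.eval s - e.eval s := rfl
@[simp] theorem RExp.eval_mul (s : Store) (d e : RExp) :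
    (RExp.mul d e).eval s = d.eval s * e.eval s := rfl
@[simp] theorem RExp.eval_div (s : Store) (d e : RExp) :
    (RExp.div d e).eval s = d.eval s / e.eval s := rfl
@[simp] theorem RExp.eval_var (s : Store) (x : ℕ) : (RExp.var x).eval s = s.real x 0 0 := rfl
@[simp] theorem RExp.eval_at (s : Store) (a : ℕ) (i : NExp) :
    (RExp.at a i).eval s = s.real a (i.eval s) 0 := rfl
@[simp] theorem BExp.holds_natLe (s : Store) (d e : NExp) :
    (BExp.natLe d e).Holds s ↔ d.eval s ≤ e.eval s := Iff.rfl
@[simp] theorem BExp.holds_realLe (s : Store) (d e : RExp) :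
    (BExp.realLe d e).Holds s ↔ d.eval s ≤ e.eval s := Iff.rfl
@[simp] theorem BExp.holds_not (s : Store) (b : BExp) :
    (BExp.not b).Holds s ↔ ¬ b.Holds s := Iff.rfl
@[simp] theorem BExp.holds_and (s : Store) (b₁ b₂ : BExp) :
    (BExp.and b₁ b₂).Holds s ↔ b₁.Holds s ∧ b₂.Holds s := Iff.rfl
@[simp] theorem BExp.holds_natEq (s : Store) (d e : NExp) :
    (BExp.natEq d e).Holds s ↔ d.eval s = e.eval s := by
  simp only [BExp.natEq, BExp.holds_and, BExp.holds_natLe]; omega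
@[simp] theorem BExp.holds_or (s : Store) (b₁ b₂ : BExp) :
    (BExp.or b₁ b₂).Holds s ↔ b₁.Holds s ∨ b₂.Holds s := by
  simp only [BExp.or, BExp.holds_and, BExp.holds_not]; tauto

namespace Store

@[simp] theorem setNat_nat_same (s : Store) (a i j m i' j' : ℕ) :
    (s.setNat a i j m).nat a i' j' = if i' = i ∧ j' = j then m else s.nat a i' j' := by
  simp [Store.setNat]

theorem setNat_nat_of_ne (s : Store) {a a' : ℕ} (i j m : ℕ) (h : a' ≠ a) :
    (s.setNat a i j m).nat a' = s.nat a' := by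
  funext i' j'; simp [Store.setNat, h]

@[simp] theorem setNat_real (s : Store) (a i j m : ℕ) : (s.setNat a i j m).real = s.real := rfl

@[simp] theorem setReal_real_same (s : Store) (a i j i' j' : ℕ) (r : ℝ) :
    (s.setReal a i j r).real a i' j' = if i' = i ∧ j' = j then r else s.real a i' j' := by
  simp [Store.setReal]

theorem setReal_real_of_ne (s : Store) {a a' : ℕ} (i j : ℕ) (r : ℝ) (h : a' ≠ a) :
    (s.setReal a i j r).real a' = s.real a' := by
  funext i' j'; simp [Store.setReal, h]

@[simp] theorem setReal_nat (s : Store) (a i j : ℕ) (r : ℝ) : (s.setReal a i j r).nat = s.nat := rfl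

end Store

namespace Cmd

/-- The program of the machine. -/
def compile : Cmd → Prog
  | skip => .skip
  | nset a i j e => .setNat a i j e
  | rset a i j e => .setReal a i j e
  | seq c d => .seq c.compile d.compile
  | ite b c d => .ite b c.compile d.compile
  | each x c => .seq (.setNat x (.const 0) (.const 0) (.const 0))
      (.loop (.natLe (.add (.var x) (.const 1)) (.var 0))
        (.seq c.compile (.setNat x (.const 0) (.const 0) (.add (.var x) (.const 1)))))

open Classical in
/-- The memory after the execution. -/
noncomputable def den : Cmd → Store → Store
  | skip, s => s
  | nset a i j e, s => s.setNat a (i.eval s) (j.eval s) (e.eval s)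
  | rset a i j e, s => s.setReal a (i.eval s) (j.eval s) (e.eval s)
  | seq c d, s => d.den (c.den s)
  | ite b c d, s => if b.Holds s then c.den s else d.den s
  | each x c, s => (fun s => (c.den s).setNat x 0 0 ((c.den s).nat x 0 0 + 1))^[s.nat 0 0 0]
      (s.setNat x 0 0 0)

/-- The arrays of natural numbers that may be changed. -/
def nw : Cmd → List ℕ
  | skip => []
  | nset a _ _ _ => [a]
  | rset _ _ _ _ => []
  | seq c d => c.nw ++ d.nw
  | ite _ c d => c.nw ++ d.nw
  | each x c => x :: c.nw

/-- The arrays of real numbers that may be changed. -/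
def rw : Cmd → List ℕ
  | skip => []
  | nset _ _ _ _ => []
  | rset a _ _ _ => [a]
  | seq c d => c.rw ++ d.rw
  | ite _ c d => c.rw ++ d.rw
  | each _ c => c.rw

/-- The number of vertices and the variable of a loop are not changed. -/
def wf : Cmd → Bool
  | skip => true
  | nset a _ _ _ => a != 0
  | rset _ _ _ _ => true
  | seq c d => c.wf && d.wf
  | ite _ c d => c.wf && d.wf
  | each x c => x != 0 && c.wf && !(c.nw.contains x)

/-- A bound on the number of steps. -/
def bound : Cmd → ℕ → ℕ
  | skip, _ => 1
  | nset _ i j e, _ => i.cost + j.cost + e.cost + 1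
  | rset _ i j e, _ => i.cost + j.cost + e.cost + 1
  | seq c d, n => c.bound n + d.bound n
  | ite b c d, n => b.cost + (c.bound n + d.bound n) + 1
  -- Setting the counter costs 4 and the last test 10; each pass costs 10 for the test and 8 for the
  -- increment, besides the body.
  | each _ c, n => 14 + n * (c.bound n + 18)

/-- Only the variable 0, which stands for `n`, occurs. The variables 1 and 2 are reserved for `1/ε`
and for the time of the subroutine. -/
noncomputable def boundPoly : Cmd → MvPolynomial (Fin 3) ℕ
  | skip => 1
  | nset _ i j e => MvPolynomial.C (i.cost + j.cost + e.cost + 1)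
  | rset _ i j e => MvPolynomial.C (i.cost + j.cost + e.cost + 1)
  | seq c d => c.boundPoly + d.boundPoly
  | ite b c d => MvPolynomial.C b.cost + (c.boundPoly + d.boundPoly) + 1
  | each _ c => MvPolynomial.C 14 + MvPolynomial.X 0 * (c.boundPoly + MvPolynomial.C 18)

theorem aeval_boundPoly (c : Cmd) (n : ℕ) (y z : ℝ) :
    MvPolynomial.aeval ![(n : ℝ), y, z] c.boundPoly = (c.bound n : ℝ) := by
  induction c with
  | skip => simp [boundPoly, bound]
  | nset a i j e => simp [boundPoly, bound]
  | rset a i j e => simp [boundPoly, bound]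
  | seq c d hc hd => simp [boundPoly, bound, hc, hd]
  | ite b c d hc hd => simp [boundPoly, bound, hc, hd]
  | each x c hc => simp [boundPoly, bound, hc]

end Cmd

/-- `s'` agrees with `s` on all arrays that are not listed. -/
def AgreeOff (N R : List ℕ) (s s' : Store) : Prop :=
  (∀ a ∉ N, s'.nat a = s.nat a) ∧ ∀ a ∉ R, s'.real a = s.real a

theorem AgreeOff.refl (N R : List ℕ) (s : Store) : AgreeOff N R s s :=
  ⟨fun _ _ => rfl, fun _ _ => rfl⟩

theorem AgreeOff.trans {N R : List ℕ} {s s' s'' : Store} (h : AgreeOff N R s s')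
    (h' : AgreeOff N R s' s'') : AgreeOff N R s s'' :=
  ⟨fun a ha => (h'.1 a ha).trans (h.1 a ha), fun a ha => (h'.2 a ha).trans (h.2 a ha)⟩

theorem AgreeOff.mono {N R N' R' : List ℕ} {s s' : Store} (h : AgreeOff N R s s')
    (hN : N ⊆ N') (hR : R ⊆ R') : AgreeOff N' R' s s' :=
  ⟨fun a ha => h.1 a fun h' => ha (hN h'), fun a ha => h.2 a fun h' => ha (hR h')⟩

theorem AgreeOff.setNat {N R : List ℕ} {s s' : Store} (h : AgreeOff N R s s') {a : ℕ} (ha : a ∈ N)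
    (i j m : ℕ) : AgreeOff N R s (s'.setNat a i j m) :=
  ⟨fun b hb => by
    rw [Store.setNat_nat_of_ne]
    · exact h.1 b hb
    · rintro rfl; exact hb ha, h.2⟩

namespace Cmd

theorem den_agree (c : Cmd) (s : Store) : AgreeOff c.nw c.rw s (c.den s) := by
  induction c generalizing s with
  | skip => exact AgreeOff.refl _ _ _
  | nset a i j e => exact (AgreeOff.refl _ _ _).setNat (by simp [nw]) _ _ _
  | rset a i j e =>
    refine ⟨fun _ _ => rfl, fun b hb => ?_⟩
    exact Store.setReal_real_of_ne _ _ _ _ (by simpa [rw] using hb)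
  | seq c d hc hd =>
    exact ((hc s).mono (by simp [nw]) (by simp [rw])).trans
      ((hd _).mono (by simp [nw]) (by simp [rw]))
  | ite b c d hc hd =>
    simp only [den]
    split_ifs
    · exact (hc s).mono (by simp [nw]) (by simp [rw])
    · exact (hd s).mono (by simp [nw]) (by simp [rw])
  | each x c hc =>
    simp only [den]
    generalize s.nat 0 0 0 = N
    induction N with
    | zero => exact (AgreeOff.refl _ _ _).setNat (by simp [nw]) _ _ _
    | succ N ih =>
      rw [Function.iterate_succ_apply']
      exact (ih.trans ((hc _).mono (by simp [nw]) (by simp [rw]))).setNat (by simp [nw]) _ _ _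

theorem den_nat (c : Cmd) (s : Store) {a : ℕ} (h : a ∉ c.nw) : (c.den s).nat a = s.nat a :=
  (c.den_agree s).1 a h

theorem den_real (c : Cmd) (s : Store) {a : ℕ} (h : a ∉ c.rw) : (c.den s).real a = s.real a :=
  (c.den_agree s).2 a h

@[simp] theorem den_skip (s : Store) : skip.den s = s := rfl
@[simp] theorem den_nset (a : ℕ) (i j e : NExp) (s : Store) :
    (nset a i j e).den s = s.setNat a (i.eval s) (j.eval s) (e.eval s) := rfl
@[simp] theorem den_rset (a : ℕ) (i j : NExp) (e : RExp) (s : Store) :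
    (rset a i j e).den s = s.setReal a (i.eval s) (j.eval s) (e.eval s) := rfl
@[simp] theorem den_seq (c d : Cmd) (s : Store) : (seq c d).den s = d.den (c.den s) := rfl
theorem den_ite_pos {b : BExp} (c d : Cmd) {s : Store} (h : b.Holds s) :
    (ite b c d).den s = c.den s := by simp [den, h]
theorem den_ite_neg {b : BExp} (c d : Cmd) {s : Store} (h : ¬ b.Holds s) :
    (ite b c d).den s = d.den s := by simp [den, h]

theorem zero_notMem_nw (c : Cmd) (h : c.wf = true) : 0 ∉ c.nw := by
  induction c with
  | skip => simp [nw]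
  | nset a i j e => rw [nw, List.mem_singleton]; rintro rfl; simp [wf] at h
  | rset a i j e => simp [nw]
  | seq c d hc hd =>
    simp only [wf, Bool.and_eq_true] at h
    simp [nw, hc h.1, hd h.2]
  | ite b c d hc hd =>
    simp only [wf, Bool.and_eq_true] at h
    simp [nw, hc h.1, hd h.2]
  | each x c hc =>
    simp only [wf, Bool.and_eq_true, bne_iff_ne, ne_eq] at h
    simp [nw, hc h.1.2, Ne.symm h.1.1]

/-- The invariant rule for loops. -/
theorem den_each {x : ℕ} {c : Cmd} (hwf : (each x c).wf = true) (s : Store)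
    (P : ℕ → Store → Prop) (h0 : P 0 (s.setNat x 0 0 0))
    (hstep : ∀ k s', k < s.nat 0 0 0 → s'.nat x 0 0 = k → AgreeOff (x :: c.nw) c.rw s s' →
      P k s' → P (k + 1) ((c.den s').setNat x 0 0 (k + 1))) :
    P (s.nat 0 0 0) ((each x c).den s) := by
  have hx : x ∉ c.nw := by
    simp only [wf, Bool.and_eq_true, Bool.not_eq_true', List.contains_eq_mem,
      decide_eq_false_iff_not] at hwf
    exact hwf.2
  have key : ∀ N ≤ s.nat 0 0 0, ∀ t, t = (fun s => (c.den s).setNat x 0 0 ((c.den s).nat x 0 0 + 1))^[N]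
      (s.setNat x 0 0 0) → P N t ∧ t.nat x 0 0 = N ∧ AgreeOff (x :: c.nw) c.rw s t := by
    intro N
    induction N with
    | zero =>
      rintro _ _ rfl
      exact ⟨h0, by simp, (AgreeOff.refl _ _ _).setNat (by simp) _ _ _⟩
    | succ N ih =>
      rintro hN _ rfl
      obtain ⟨h1, h2, h3⟩ := ih (by omega) _ rfl
      simp only [Function.iterate_succ_apply']
      have h4 := c.den_nat ((fun s => (c.den s).setNat x 0 0 ((c.den s).nat x 0 0 + 1))^[N]
        (s.setNat x 0 0 0)) hx
      rw [h4, h2]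
      exact ⟨hstep N _ (by omega) h2 h3 h1, by simp,
        (h3.trans ((c.den_agree _).mono (by simp) (by simp))).setNat (by simp) _ _ _⟩
  exact (key _ le_rfl _ rfl).1

/-- `wf` ensures that a loop body changes neither `n` nor the counter, so the loop of the machine
makes exactly `n` passes, as `den` does. -/
theorem exec (O : Store → ℕ → Store → Prop) (c : Cmd) (hwf : c.wf = true) (s : Store) :
    ∃ t, Exec O c.compile s t (c.den s) ∧ t ≤ c.bound (s.nat 0 0 0) := by
  induction c generalizing s with
  | skip => exact ⟨_, Exec.skip s, le_rfl⟩
  | nset a i j e => exact ⟨_, Exec.setNat s a i j e, le_rfl⟩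
  | rset a i j e => exact ⟨_, Exec.setReal s a i j e, le_rfl⟩
  | seq c d hc hd =>
    simp only [wf, Bool.and_eq_true] at hwf
    obtain ⟨t, ht, htb⟩ := hc hwf.1 s
    obtain ⟨t', ht', htb'⟩ := hd hwf.2 (c.den s)
    rw [c.den_nat s (c.zero_notMem_nw hwf.1)] at htb'
    exact ⟨_, Exec.seq ht ht', by simp only [bound]; omega⟩
  | ite b c d hc hd =>
    simp only [wf, Bool.and_eq_true] at hwf
    by_cases hb : b.Holds s
    · obtain ⟨t, ht, htb⟩ := hc hwf.1 s
      rw [den_ite_pos _ _ hb]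
      exact ⟨_, Exec.ite_true hb ht, by simp only [bound]; omega⟩
    · obtain ⟨t, ht, htb⟩ := hd hwf.2 s
      rw [den_ite_neg _ _ hb]
      exact ⟨_, Exec.ite_false hb ht, by simp only [bound]; omega⟩
  | each x c hc =>
    have hwf' := hwf
    simp only [wf, Bool.and_eq_true, Bool.not_eq_true', List.contains_eq_mem,
      decide_eq_false_iff_not, bne_iff_ne, ne_eq] at hwf
    have h0 := c.zero_notMem_nw hwf.1.2
    set step : Store → Store := fun s => (c.den s).setNat x 0 0 ((c.den s).nat x 0 0 + 1) with hstep
    set B := BExp.natLe (.add (.var x) (.const 1)) (.var 0) with hB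
    have hloop : ∀ N s, s.nat 0 0 0 = s.nat x 0 0 + N →
        ∃ t, Exec O (.loop B (.seq c.compile
          (.setNat x (.const 0) (.const 0) (.add (.var x) (.const 1))))) s t (step^[N] s) ∧
          t ≤ 10 + N * (c.bound (s.nat 0 0 0) + 18) := by
      intro N
      induction N with
      | zero =>
        intro s hs
        refine ⟨_, Exec.loop_false (by simp [hB, hs]), ?_⟩
        simp [hB, BExp.cost, NExp.cost, NExp.var]
      | succ N ih =>
        intro s hs
        obtain ⟨t, ht, htb⟩ := hc hwf.1.2 s
        have e1 : (step s).nat 0 = s.nat 0 := by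
          simp only [hstep]
          rw [Store.setNat_nat_of_ne _ _ _ _ (Ne.symm hwf.1.1), c.den_nat s h0]
        have e2 : (step s).nat x 0 0 = s.nat x 0 0 + 1 := by
          simp [hstep, c.den_nat s hwf.2]
        obtain ⟨t', ht', htb'⟩ := ih (step s) (by rw [e1, e2, hs]; omega)
        rw [e1] at htb'
        refine ⟨_, Exec.loop_true (by simp [hB, hs])
          (Exec.seq ht (Exec.setNat _ _ _ _ _)) ht', ?_⟩
        simp only [hB, BExp.cost, NExp.cost, NExp.var]
        rw [Nat.succ_mul]
        omega
    obtain ⟨t, ht, htb⟩ := hloop (s.nat 0 0 0) (s.setNat x 0 0 0) (by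
      rw [Store.setNat_nat_of_ne _ _ _ _ (Ne.symm hwf.1.1)]; simp)
    rw [Store.setNat_nat_of_ne _ _ _ _ (Ne.symm hwf.1.1)] at htb
    refine ⟨_, Exec.seq (Exec.setNat s x _ _ _) ht, ?_⟩
    simp only [bound, NExp.cost]
    omega

end Cmd

end ATSP

/-! ### Building blocks: marks, sums, maxima and exhaustive search -/

namespace ATSP

section Relabel

variable {V : Type*}

theorem isLabeling_congr {F F' : V → V → ℕ} (h : ∀ u v, F u v ≠ 0 ↔ F' u v ≠ 0) {l : V → ℕ}
    (hl : IsLabeling F l) : IsLabeling F' l := fun u v => (hl u v).trans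
  ⟨reachable_mono fun a b hab => reachable_of_edge ((h a b).1 hab),
    reachable_mono fun a b hab => reachable_of_edge ((h a b).2 hab)⟩

/-- One more edge unites the classes of its ends; giving one of them the label of the other is a
single union step. -/
theorem IsLabeling.merge {F F' : V → V → ℕ} {l : V → ℕ} (hl : IsLabeling F l) {u v : V}
    (h : ∀ a b, F' a b ≠ 0 ↔ F a b ≠ 0 ∨ (a = u ∧ b = v)) :
    IsLabeling F' (fun z => if l z = l v then l u else l z) := by
  have hF : ∀ a b, l a = l b → (underlying F').Reachable a b := fun a b hab =>
    reachable_mono (fun a b hab => reachable_of_edge ((h a b).2 (Or.inl hab))) ((hl a b).1 hab)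
  have huv : (underlying F').Reachable u v := reachable_of_edge ((h u v).2 (Or.inr ⟨rfl, rfl⟩))
  intro a b
  constructor
  · intro hab
    by_cases ha : l a = l v <;> by_cases hb : l b = l v <;> simp only [ha, hb, if_true, if_false] at hab
    · exact hF a b (ha.trans hb.symm)
    · exact (hF a v ha).trans (huv.symm.trans (hF u b hab))
    · exact (hF a u hab).trans (huv.trans (hF v b hb.symm))
    · exact hF a b hab
  · refine eq_of_reachable (φ := fun z => if l z = l v then l u else l z) fun a b hab => ?_
    rcases (h a b).1 hab with h1 | ⟨rfl, rfl⟩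
    · simp only [hl.edge h1]
    · by_cases h1 : l a = l b <;> simp [h1]

end Relabel

/-- The array `a` as a matrix. -/
def Store.mat (s : Store) (n a : ℕ) : Fin n → Fin n → ℕ := fun u v => s.nat a u v

/-- The array `a` as a vector. -/
def Store.vec (s : Store) (n a : ℕ) : Fin n → ℕ := fun v => s.nat a v 0

open Cmd

section Loops

variable {n : ℕ}

/-- A double loop that changes the array `dst` entry by entry. -/
theorem den_each_each {c : Cmd} {s : Store} (hn : s.nat 0 0 0 = n) {dst : ℕ}
    (hwf : (each 20 (each 21 c)).wf = true) (hd : dst ≠ 20 ∧ dst ≠ 21) (val : ℕ → ℕ → ℕ)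
    (h : ∀ u v, u < n → v < n → ∀ s', s'.nat 20 0 0 = u → s'.nat 21 0 0 = v →
      AgreeOff (20 :: 21 :: c.nw) c.rw s s' → s'.nat dst u v = s.nat dst u v →
      ∀ i j, (c.den s').nat dst i j = if i = u ∧ j = v then val u v else s'.nat dst i j) :
    ∀ u v, u < n → v < n → ((each 20 (each 21 c)).den s).nat dst u v = val u v := by
  have key := den_each hwf s (fun k s' => ∀ i j, s'.nat dst i j
    = if i < k ∧ j < n then val i j else s.nat dst i j) (by
      simp [Store.setNat_nat_of_ne _ _ _ _ hd.1]) (by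
      intro u s₁ hu hu₁ hs₁ hP
      have hn₁ : s₁.nat 0 0 0 = n := by
        rw [hs₁.1 0 (by
          have := (each 20 (each 21 c)).zero_notMem_nw hwf
          simpa [nw] using this), hn]
      have hwf' : (each 21 c).wf = true := by
        simp only [wf, Bool.and_eq_true] at hwf ⊢
        exact hwf.1.2
      have h20 : 20 ∉ (each 21 c).nw := by
        have h1 := hwf
        simp only [Cmd.wf, Bool.and_eq_true, Bool.not_eq_true', List.contains_eq_mem,
          decide_eq_false_iff_not] at h1
        exact h1.2
      have key₂ := den_each hwf' s₁ (fun k s' => ∀ i j, s'.nat dst i j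
        = if i < u ∧ j < n ∨ i = u ∧ j < k then val i j else s.nat dst i j) (by
          intro i j
          simp [Store.setNat_nat_of_ne _ _ _ _ hd.2, hP i j]) (by
          intro v s₂ hv hv₂ hs₂ hP₂ i j
          rw [Store.setNat_nat_of_ne _ _ _ _ hd.2]
          have hag : AgreeOff (20 :: 21 :: c.nw) c.rw s s₂ :=
            (hs₁.mono (by simp [nw]) (by simp [rw])).trans (hs₂.mono (by simp) (by simp))
          rw [h u v (hn ▸ hu) (hn₁ ▸ hv) s₂ (by
              rw [hs₂.1 20 (by simpa [nw] using h20), hu₁]) hv₂ hag (by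
              rw [hP₂, if_neg (by omega)]), hP₂]
          split_ifs <;> first | rfl | omega | skip
          · rename_i h1 h2
            obtain ⟨rfl, rfl⟩ := h1
            rfl)
      intro i j
      rw [Store.setNat_nat_of_ne _ _ _ _ hd.1, key₂ i j, hn₁]
      congr 1
      rw [eq_iff_iff]
      omega)
  intro u v hu hv
  rw [key u v, hn, if_pos ⟨hu, hv⟩]

/-- Set `dst` to `1` at the entries `key`, for all `u`, `v` with `cond`. -/
def markC (dst : ℕ) (cond : BExp) (key : NExp) : Cmd :=
  each 21 (nset dst (.var 21) (.const 0) (.const 0)) ;;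
  each 20 (each 21 (ite cond (nset dst key (.const 0) (.const 1)) skip))

/-- The test and the key are specified on all memories that agree with `s` outside the loop
variables and `dst`, as these are what the loops produce. The other building blocks have hypotheses
of the same form. -/
theorem den_markC {s : Store} (hn : s.nat 0 0 0 = n) {dst : ℕ} (hd : dst ≠ 0 ∧ dst ≠ 20 ∧ dst ≠ 21)
    {cond : BExp} {key : NExp} {C : Fin n → Fin n → Prop} {K : Fin n → Fin n → ℕ}
    (h : ∀ (u v : Fin n) (s' : Store), s'.nat 20 0 0 = (u : ℕ) → s'.nat 21 0 0 = (v : ℕ) →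
      AgreeOff [20, 21, dst] [] s s' → (cond.Holds s' ↔ C u v) ∧ key.eval s' = K u v) (l : Fin n) :
    1 ≤ ((markC dst cond key).den s).nat dst l 0 ↔ ∃ u v, C u v ∧ K u v = l := by
  unfold markC
  rw [den_seq]
  set s₀ := (each 21 (nset dst (.var 21) (.const 0) (.const 0))).den s with hs₀
  have hs₀a : AgreeOff [20, 21, dst] [] s s₀ := (den_agree _ s).mono (by simp [nw]) (by simp [rw])
  have hn₀ : s₀.nat 0 0 0 = n := by
    rw [hs₀a.1 0 (by simp [hd.1.symm]), hn]
  have hclear : ∀ v < n, s₀.nat dst v 0 = 0 := by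
    have := den_each (x := 21) (c := nset dst (.var 21) (.const 0) (.const 0))
      (by simp [wf, nw, hd, Ne.symm hd.2.2]) s
      (fun k s' => ∀ v < k, s'.nat dst v 0 = 0) (by simp) (by
        intro k s' hk hk' _ hP v hv
        simp only [den_nset, NExp.eval_var, NExp.eval_const, hk',
          Store.setNat_nat_of_ne _ _ _ _ hd.2.2, Store.setNat_nat_same, and_true]
        split_ifs with h1
        · rfl
        · exact hP v (by omega))
    rw [hn] at this
    exact this
  have hwf : (each 20 (each 21 (ite cond (nset dst key (.const 0) (.const 1)) skip))).wf = true := by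
    simp [wf, nw, hd, Ne.symm hd.2.1, Ne.symm hd.2.2]
  have hwf' : (each 21 (ite cond (nset dst key (.const 0) (.const 1)) skip)).wf = true := by
    simp [wf, nw, hd, Ne.symm hd.2.2]
  have main := den_each hwf s₀ (fun k s' => ∀ l : Fin n, 1 ≤ s'.nat dst l 0 ↔
      ∃ u v : Fin n, u < k ∧ C u v ∧ K u v = l) (by
      intro l
      simp [Store.setNat_nat_of_ne _ _ _ _ hd.2.1, hclear l l.2]) (by
      intro u s₁ hu hu₁ hs₁ hP
      rw [hn₀] at hu
      have hn₁ : s₁.nat 0 0 0 = n := by rw [hs₁.1 0 (by simp [nw, hd.1.symm]), hn₀]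
      have key₂ := den_each hwf' s₁ (fun k s' => ∀ l : Fin n, 1 ≤ s'.nat dst l 0 ↔
        ∃ u' v : Fin n, (u' < u ∨ u' = u ∧ (v : ℕ) < k) ∧ C u' v ∧ K u' v = l) (by
          intro l
          simp [Store.setNat_nat_of_ne _ _ _ _ hd.2.2, hP l]) (by
          intro v s₂ hv hv₂ hs₂ hP₂ l
          rw [hn₁] at hv
          rw [Store.setNat_nat_of_ne _ _ _ _ hd.2.2]
          have hag : AgreeOff [20, 21, dst] [] s s₂ :=
            (hs₀a.trans (hs₁.mono (by simp [nw]) (by simp [rw]))).trans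
              (hs₂.mono (by simp [nw]) (by simp [rw]))
          have hu₂ : s₂.nat 20 0 0 = u := by
            rw [hs₂.1 20 (by simp [nw, Ne.symm hd.2.1]), hu₁]
          obtain ⟨hC, hK⟩ := h ⟨u, hu⟩ ⟨v, hv⟩ s₂ hu₂ hv₂ hag
          have hsplit : (∃ u' v' : Fin n, ((u' : ℕ) < u ∨ (u' : ℕ) = u ∧ (v' : ℕ) < v + 1) ∧ C u' v' ∧
              K u' v' = l) ↔ (∃ u' v' : Fin n, ((u' : ℕ) < u ∨ (u' : ℕ) = u ∧ (v' : ℕ) < v) ∧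
                C u' v' ∧ K u' v' = l) ∨ (C ⟨u, hu⟩ ⟨v, hv⟩ ∧ K ⟨u, hu⟩ ⟨v, hv⟩ = l) := by
            constructor
            · rintro ⟨u', v', h1, h2⟩
              by_cases h3 : (u' : ℕ) = u ∧ (v' : ℕ) = v
              · right
                have e1 : u' = ⟨u, hu⟩ := Fin.ext h3.1
                have e2 : v' = ⟨v, hv⟩ := Fin.ext h3.2
                rw [← e1, ← e2]; exact h2
              · exact Or.inl ⟨u', v', by omega, h2⟩
            · rintro (⟨u', v', h1, h2⟩ | h2)
              · exact ⟨u', v', by omega, h2⟩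
              · exact ⟨⟨u, hu⟩, ⟨v, hv⟩, by simp, h2⟩
          rw [hsplit, ← hP₂ l]
          by_cases hCuv : C ⟨u, hu⟩ ⟨v, hv⟩
          · rw [den_ite_pos _ _ (hC.2 hCuv)]
            simp only [den_nset, hK, NExp.eval_const, Store.setNat_nat_same, and_true]
            by_cases hl : (l : ℕ) = K ⟨u, hu⟩ ⟨v, hv⟩
            · simp [hl, hCuv]
            · simp [hl, Ne.symm hl]
          · rw [den_ite_neg _ _ fun h => hCuv (hC.1 h)]
            simp [hCuv])
      intro l
      rw [Store.setNat_nat_of_ne _ _ _ _ hd.2.1, key₂ l, hn₁]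
      constructor
      · rintro ⟨u', v', h1, h2⟩
        exact ⟨u', v', by omega, h2⟩
      · rintro ⟨u', v', h1, h2⟩
        exact ⟨u', v', by have := v'.2; omega, h2⟩)
  rw [main l, hn₀]
  constructor
  · rintro ⟨u, v, -, h⟩; exact ⟨u, v, h⟩
  · rintro ⟨u, v, h⟩; exact ⟨u, v, u.2, h⟩

/-- For all `v` with `cond`, add `val` to the entry `key` of the array `a`, which is cleared
before. -/
def scatterC (a : ℕ) (cond : BExp) (key : NExp) (val : RExp) : Cmd :=
  each 21 (rset a (.var 21) (.const 0) (.const 0)) ;;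
  each 21 (ite cond (rset a key (.const 0) (.add (.at a key) val)) skip)

/-- With the constant key `0`, the entry `0` receives the sum over all vertices that pass the test.
-/
theorem den_scatterC {s : Store} (hn : s.nat 0 0 0 = n) {a : ℕ}
    {cond : BExp} {key : NExp} {val : RExp} {C : Fin n → Prop} [DecidablePred C] {K : Fin n → ℕ}
    {X : Fin n → ℝ}
    (h : ∀ (v : Fin n) (s' : Store), s'.nat 21 0 0 = (v : ℕ) → AgreeOff [21] [a] s s' →
      (cond.Holds s' ↔ C v) ∧ key.eval s' = K v ∧ val.eval s' = X v) (l : ℕ) (hl : l < n) :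
    ((scatterC a cond key val).den s).real a l 0 = ∑ v with (C v ∧ K v = l), X v := by
  unfold scatterC
  rw [den_seq]
  set s₀ := (each 21 (rset a (.var 21) (.const 0) (.const 0))).den s with hs₀
  have hs₀a : AgreeOff [21] [a] s s₀ := (den_agree _ s).mono (by simp [nw]) (by simp [rw])
  have hn₀ : s₀.nat 0 0 0 = n := by rw [hs₀a.1 0 (by simp), hn]
  have hclear : ∀ v < n, s₀.real a v 0 = 0 := by
    have := den_each (x := 21) (c := rset a (.var 21) (.const 0) (.const 0)) (by simp [wf, nw]) s
      (fun k s' => ∀ v < k, s'.real a v 0 = 0) (by simp) (by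
        intro k s' hk hk' _ hP v hv
        simp only [den_rset, NExp.eval_var, NExp.eval_const, hk', Store.setNat_real,
          Store.setReal_real_same, RExp.eval_const, and_true]
        split_ifs with h1
        · simp
        · exact hP v (by omega))
    rw [hn] at this
    exact this
  have main := den_each (x := 21) (c := ite cond (rset a key (.const 0) (.add (.at a key) val)) skip)
    (by simp [wf, nw]) s₀ (fun k s' => ∀ l < n, s'.real a l 0
      = ∑ v : Fin n, if (v : ℕ) < k ∧ C v ∧ K v = l then X v else 0) (by
      intro l hl
      simp [hclear l hl]) (by
      intro k s₁ hk hk₁ hs₁ hP l hl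
      rw [hn₀] at hk
      have hag : AgreeOff [21] [a] s s₁ := hs₀a.trans (hs₁.mono (by simp [nw]) (by simp [rw]))
      obtain ⟨hC, hK, hX⟩ := h ⟨k, hk⟩ s₁ hk₁ hag
      have hsplit : (∑ v : Fin n, if (v : ℕ) < k + 1 ∧ C v ∧ K v = l then X v else 0)
          = (∑ v : Fin n, if (v : ℕ) < k ∧ C v ∧ K v = l then X v else 0)
            + if C ⟨k, hk⟩ ∧ K ⟨k, hk⟩ = l then X ⟨k, hk⟩ else 0 := by
        have e : (if C ⟨k, hk⟩ ∧ K ⟨k, hk⟩ = l then X ⟨k, hk⟩ else 0)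
            = ∑ v : Fin n, if v = ⟨k, hk⟩ then (if C v ∧ K v = l then X v else 0) else 0 := by
          rw [Finset.sum_ite_eq' Finset.univ, if_pos (Finset.mem_univ _)]
        rw [e, ← Finset.sum_add_distrib]
        refine Finset.sum_congr rfl fun v _ => ?_
        by_cases h1 : v = ⟨k, hk⟩
        · subst h1; simp
        · have h2 : (v : ℕ) ≠ k := fun h2 => h1 (Fin.ext h2)
          have h3 : (v : ℕ) < k + 1 ↔ (v : ℕ) < k := by omega
          simp [h1, h3]
      rw [Store.setNat_real, hsplit, ← hP l hl]
      by_cases hCk : C ⟨k, hk⟩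
      · rw [den_ite_pos _ _ (hC.2 hCk)]
        simp only [den_rset, hK, NExp.eval_const, Store.setReal_real_same, and_true, RExp.eval_add,
          RExp.eval_at, hX, hCk, true_and]
        by_cases h1 : l = K ⟨k, hk⟩
        · simp [← h1]
        · simp [h1, Ne.symm h1]
      · rw [den_ite_neg _ _ fun h => hCk (hC.1 h)]
        simp [hCk])
  rw [main l hl, hn₀, Finset.sum_filter]
  exact Finset.sum_congr rfl fun v _ => by simp

/-- For each label in the array `key`, find a vertex with this label that maximizes `val`. -/
def argmaxC (key val dst : ℕ) : Cmd :=
  each 21 (nset dst (.at key (.var 21)) (.const 0) (.var 21)) ;;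
  each 21 (ite (.realLe (.at val (.var 21)) (.at val (.at dst (.at key (.var 21))))) skip
    (nset dst (.at key (.var 21)) (.const 0) (.var 21)))

/-- The first pass stores some vertex of each label in `dst`, so the second pass compares only
vertices with equal labels. -/
theorem den_argmaxC {s : Store} (hn : s.nat 0 0 0 = n) {key val dst : ℕ}
    (hd : dst ≠ 0 ∧ dst ≠ 21 ∧ dst ≠ key ∧ key ≠ 21) :
    ∃ top : Fin n → Fin n, ∀ v : Fin n, ((argmaxC key val dst).den s).nat dst (s.nat key v 0) 0 = top v ∧
      s.nat key (top v) 0 = s.nat key v 0 ∧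
      ∀ u : Fin n, s.nat key u 0 = s.nat key v 0 → s.real val u 0 ≤ s.real val (top v) 0 := by
  obtain ⟨hd0, hd21, hdk, hk21⟩ := hd
  suffices hex : ∀ v : Fin n, ∃ t : Fin n,
      ((argmaxC key val dst).den s).nat dst (s.nat key v 0) 0 = t ∧
      s.nat key t 0 = s.nat key v 0 ∧
      ∀ u : Fin n, s.nat key u 0 = s.nat key v 0 → s.real val u 0 ≤ s.real val t 0 by
    choose top htop using hex
    exact ⟨top, htop⟩
  unfold argmaxC
  rw [den_seq]
  set s₀ := (each 21 (nset dst (.at key (.var 21)) (.const 0) (.var 21))).den s with hs₀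
  have hs₀a : AgreeOff [21, dst] [] s s₀ := (den_agree _ s).mono (by simp [nw]) (by simp [rw])
  have hn₀ : s₀.nat 0 0 0 = n := by rw [hs₀a.1 0 (by simp [hd0.symm]), hn]
  have hkey₀ : s₀.nat key = s.nat key := hs₀a.1 key (by simp [hk21, hdk.symm])
  have hval₀ : s₀.real val = s.real val := hs₀a.2 val (by simp)
  have hinit : ∀ v < n, ∃ t < n, s₀.nat dst (s.nat key v 0) 0 = t ∧
      s.nat key t 0 = s.nat key v 0 := by
    have := den_each (x := 21) (c := nset dst (.at key (.var 21)) (.const 0) (.var 21))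
      (by simp [wf, nw, hd0, hd21.symm]) s
      (fun k s' => ∀ v < k, ∃ t < k, s'.nat dst (s.nat key v 0) 0 = t ∧
        s.nat key t 0 = s.nat key v 0) (by simp) (by
        intro k s' hk hk' hs' hP v hv
        have e : s'.nat key = s.nat key := hs'.1 key (by simp [nw, hk21, hdk.symm])
        simp only [den_nset, NExp.eval_at, NExp.eval_var, NExp.eval_const, hk', e,
          Store.setNat_nat_of_ne _ _ _ _ hd21, Store.setNat_nat_same, and_true]
        by_cases h1 : s.nat key v 0 = s.nat key k 0
        · exact ⟨k, by omega, by simp [h1], h1.symm⟩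
        · have hvk : v ≠ k := fun h => h1 (by rw [h])
          obtain ⟨t, ht, h2, h3⟩ := hP v (by omega)
          exact ⟨t, by omega, by simp [h1, h2], h3⟩)
    rw [hn] at this
    exact this
  have main := den_each (x := 21)
    (c := ite (.realLe (.at val (.var 21)) (.at val (.at dst (.at key (.var 21))))) skip
      (nset dst (.at key (.var 21)) (.const 0) (.var 21))) (by simp [wf, nw, hd0, hd21.symm]) s₀
    (fun k s' => ∀ v < n, ∃ t < n, s'.nat dst (s.nat key v 0) 0 = t ∧
      s.nat key t 0 = s.nat key v 0 ∧
      ∀ u < k, s.nat key u 0 = s.nat key v 0 → s.real val u 0 ≤ s.real val t 0) (by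
      intro v hv
      obtain ⟨t, ht, h1, h2⟩ := hinit v hv
      exact ⟨t, ht, by rw [Store.setNat_nat_of_ne _ _ _ _ hd21, h1], h2, by simp⟩) (by
      intro k s₁ hk hk₁ hs₁ hP v hv
      rw [hn₀] at hk
      have e1 : s₁.nat key = s.nat key := by
        rw [hs₁.1 key (by simp [nw, hk21, hdk.symm]), hkey₀]
      have e2 : s₁.real val = s.real val := by rw [hs₁.2 val (by simp [rw]), hval₀]
      rw [Store.setNat_nat_of_ne _ _ _ _ hd21]
      obtain ⟨t, ht, h1, h2, h3⟩ := hP v hv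
      by_cases hle : s.real val k 0 ≤ s.real val (s₁.nat dst (s.nat key k 0) 0) 0
      · rw [den_ite_pos _ _ (by simpa [e1, e2, hk₁] using hle)]
        refine ⟨t, ht, h1, h2, fun u hu huv => ?_⟩
        by_cases huk : u = k
        · subst huk
          rwa [huv, h1] at hle
        · exact h3 u (by omega) huv
      · rw [den_ite_neg _ _ (by simpa [e1, e2, hk₁] using hle)]
        simp only [den_nset, NExp.eval_at, NExp.eval_var, NExp.eval_const, hk₁, e1,
          Store.setNat_nat_same, and_true]
        by_cases hkv : s.nat key v 0 = s.nat key k 0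
        · refine ⟨k, hk, by simp [hkv], hkv.symm, fun u hu huv => ?_⟩
          by_cases huk : u = k
          · rw [huk]
          · rw [← hkv, h1] at hle
            exact (h3 u (by omega) huv).trans (le_of_not_ge hle)
        · refine ⟨t, ht, by simp [hkv, h1], h2, fun u hu huv => ?_⟩
          by_cases huk : u = k
          · exact absurd (huk ▸ huv).symm hkv
          · exact h3 u (by omega) huv)
  intro v
  rw [hn₀] at main
  obtain ⟨t, ht, h1, h2, h3⟩ := main v v.2
  exact ⟨⟨t, ht⟩, h1, h2, fun u hu => h3 u u.2 hu⟩

/-- Search for a pair `(a, b)` such that `cond` holds after `pre`. -/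
def findC (pre : Cmd) (cond : BExp) : Cmd :=
  nset 28 (.const 0) (.const 0) (.const 0) ;;
  each 26 (each 27 (pre ;; ite cond (nset 28 (.const 0) (.const 0) (.const 1) ;;
    nset 29 (.const 0) (.const 0) (.var 26) ;; nset 30 (.const 0) (.const 0) (.var 27)) skip))

/-- The search continues after a success, so the recorded pair is some pair with `P`, not
necessarily the first one. The arrays written by `pre` hold the data of the last pair tried. -/
theorem den_findC {s : Store} (hn : s.nat 0 0 0 = n) {pre : Cmd} {cond : BExp}
    (hwf : pre.wf = true) (hpre : ∀ x ∈ [26, 27, 28, 29, 30], x ∉ pre.nw) {P : Fin n → Fin n → Prop}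
    (h : ∀ (a b : Fin n) (s' : Store), s'.nat 26 0 0 = (a : ℕ) → s'.nat 27 0 0 = (b : ℕ) →
      AgreeOff (26 :: 27 :: 28 :: 29 :: 30 :: pre.nw) pre.rw s s' →
      (cond.Holds (pre.den s') ↔ P a b)) :
    (((findC pre cond).den s).nat 28 0 0 = 1 ∧ ∃ a b : Fin n, P a b ∧
      ((findC pre cond).den s).nat 29 0 0 = a ∧ ((findC pre cond).den s).nat 30 0 0 = b) ∨
    (((findC pre cond).den s).nat 28 0 0 = 0 ∧ ∀ a b, ¬ P a b) := by
  unfold findC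
  rw [den_seq]
  set s₀ := (nset 28 (.const 0) (.const 0) (.const 0)).den s with hs₀
  have hs₀a : AgreeOff (26 :: 27 :: 28 :: 29 :: 30 :: pre.nw) pre.rw s s₀ :=
    (den_agree _ s).mono (by simp [nw]) (by simp [rw])
  have h0 := pre.zero_notMem_nw hwf
  have hn₀ : s₀.nat 0 0 0 = n := by rw [hs₀a.1 0 (by simp [h0]), hn]
  set body := pre ;; ite cond (nset 28 (.const 0) (.const 0) (.const 1) ;;
    nset 29 (.const 0) (.const 0) (.var 26) ;; nset 30 (.const 0) (.const 0) (.var 27)) skip with hbody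
  have hbnw : body.nw = pre.nw ++ [28, 29, 30] := by simp [hbody, nw]
  have hbrw : body.rw = pre.rw := by simp [hbody, rw]
  have hwf' : (each 27 body).wf = true := by
    have := hpre 27 (by simp)
    simp [wf, hbody, nw, hwf, this]
  have hwf'' : (each 26 (each 27 body)).wf = true := by
    have h1 := hpre 26 (by simp)
    rw [wf, hwf']
    simp [nw, hbody, h1]
  set Q : (ℕ → ℕ → Prop) → Store → Prop := fun R s' =>
    (s'.nat 28 0 0 = 1 ∧ ∃ a b : Fin n, P a b ∧ s'.nat 29 0 0 = a ∧ s'.nat 30 0 0 = b) ∨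
    (s'.nat 28 0 0 = 0 ∧ ∀ a b : Fin n, R a b → ¬ P a b) with hQ
  have main := den_each hwf'' s₀ (fun k => Q fun a b => a < k) (by
      right
      refine ⟨by simp [hs₀, Store.setNat_nat_of_ne], fun a b h => absurd h (by simp)⟩) (by
      intro a s₁ ha ha₁ hs₁ hP
      rw [hn₀] at ha
      have hn₁ : s₁.nat 0 0 0 = n := by rw [hs₁.1 0 (by simp [nw, hbnw, h0]), hn₀]
      have key₂ := den_each hwf' s₁ (fun k => Q fun a' b => a' < a ∨ a' = a ∧ b < k) (by
          simpa [hQ, Store.setNat_nat_of_ne] using hP) (by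
          intro b s₂ hb hb₂ hs₂ hP₂
          rw [hn₁] at hb
          have hag : AgreeOff (26 :: 27 :: 28 :: 29 :: 30 :: pre.nw) pre.rw s s₂ := by
            refine (hs₀a.trans (hs₁.mono ?_ (by simp [rw, hbrw]))).trans (hs₂.mono ?_ (by simp [hbrw]))
            · intro x; simp only [nw, hbnw, List.mem_cons, List.mem_append]; tauto
            · intro x; simp only [hbnw, List.mem_cons, List.mem_append]; tauto
          have ha₂ : s₂.nat 26 0 0 = a := by
            rw [hs₂.1 26 (by have := hpre 26 (by simp); simp [hbnw, this]), ha₁]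
          have hcond := h ⟨a, ha⟩ ⟨b, hb⟩ s₂ ha₂ hb₂ hag
          have hp : ∀ x ∈ [26, 27, 28, 29, 30], (pre.den s₂).nat x = s₂.nat x := fun x hx =>
            pre.den_nat s₂ (hpre x hx)
          by_cases hab : P ⟨a, ha⟩ ⟨b, hb⟩
          · left
            rw [hbody, den_seq, den_ite_pos _ _ (hcond.2 hab)]
            refine ⟨by simp [Store.setNat_nat_of_ne], ⟨a, ha⟩, ⟨b, hb⟩, hab, ?_, ?_⟩
            · simp [Store.setNat_nat_of_ne, hp, ha₂]
            · simp [Store.setNat_nat_of_ne, hp, hb₂]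
          · rw [hbody, den_seq, den_ite_neg _ _ fun hc => hab (hcond.1 hc)]
            simp only [hQ, den_skip]
            rw [Store.setNat_nat_of_ne _ _ _ _ (by decide), Store.setNat_nat_of_ne _ _ _ _ (by decide),
              Store.setNat_nat_of_ne _ _ _ _ (by decide), hp 28 (by simp), hp 29 (by simp),
              hp 30 (by simp)]
            rcases hP₂ with hP₂ | ⟨h1, h2⟩
            · exact Or.inl hP₂
            · refine Or.inr ⟨h1, fun a' b' hR hPab => ?_⟩
              by_cases h3 : (a' : ℕ) = a ∧ (b' : ℕ) = b
              · have e1 : a' = ⟨a, ha⟩ := Fin.ext h3.1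
                have e2 : b' = ⟨b, hb⟩ := Fin.ext h3.2
                exact hab (e1 ▸ e2 ▸ hPab)
              · exact h2 a' b' (by omega) hPab)
      simp only [hQ] at key₂ ⊢
      rw [Store.setNat_nat_of_ne _ _ _ _ (by decide), Store.setNat_nat_of_ne _ _ _ _ (by decide),
        Store.setNat_nat_of_ne _ _ _ _ (by decide)]
      rcases key₂ with h1 | ⟨h1, h2⟩
      · exact Or.inl h1
      · exact Or.inr ⟨h1, fun a' b' hR => h2 a' b' (by have := b'.2; omega)⟩)
  rcases main with h1 | ⟨h1, h2⟩
  · exact Or.inl h1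
  · exact Or.inr ⟨h1, fun a b => h2 a b (by rw [hn₀]; exact a.2)⟩

end Loops

end ATSP

/-! ### Computing components and numbered partitions -/

namespace ATSP

open Cmd

variable {n : ℕ}

/-- The invariant rule for two nested loops. -/
theorem den_each_pair {x y : ℕ} {c : Cmd} {s : Store} (hn : s.nat 0 0 0 = n)
    (hwf : (each x (each y c)).wf = true) (P : ℕ → ℕ → Store → Prop)
    (hP : ∀ u v s' m, P u v s' → P u v (s'.setNat x 0 0 m) ∧ P u v (s'.setNat y 0 0 m))
    (h0 : P 0 0 s) (hnext : ∀ u s', P u n s' → P (u + 1) 0 s')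
    (hstep : ∀ u v s', u < n → v < n → s'.nat x 0 0 = u → s'.nat y 0 0 = v →
      AgreeOff (x :: y :: c.nw) c.rw s s' → P u v s' → P u (v + 1) (c.den s')) :
    P n 0 ((each x (each y c)).den s) := by
  have hwf' : (each y c).wf = true := by
    simp only [wf, Bool.and_eq_true] at hwf ⊢
    exact hwf.1.2
  have hx : x ∉ (each y c).nw := by
    have h1 := hwf
    simp only [Cmd.wf, Bool.and_eq_true, Bool.not_eq_true', List.contains_eq_mem,
      decide_eq_false_iff_not] at h1
    exact h1.2
  have h00 := (each x (each y c)).zero_notMem_nw hwf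
  have main := den_each hwf s (fun k s' => P k 0 s') (hP _ _ _ _ h0).1 (by
    intro u s₁ hu hu₁ hs₁ hP₁
    have hn₁ : s₁.nat 0 0 0 = n := by rw [hs₁.1 0 (by simpa [nw] using h00), hn]
    refine (hP _ _ _ _ (hnext u _ ?_)).1
    rw [← hn₁]
    refine den_each hwf' s₁ (fun k s' => P u k s') (hP _ _ _ _ hP₁).2 ?_
    intro v s₂ hv hv₂ hs₂ hP₂
    refine (hP _ _ _ _ (hstep u v s₂ (hn ▸ hu) (hn₁ ▸ hv) ?_ hv₂ ?_ hP₂)).2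
    · rw [hs₂.1 x (by simpa [nw] using hx), hu₁]
    · exact (hs₁.mono (by simp [nw]) (by simp [rw])).trans (hs₂.mono (by simp) (by simp)))
  rw [hn] at main
  exact main

/-- Label the components of the multigraph in the array `src`. -/
def compC (src dst : ℕ) : Cmd :=
  each 21 (nset dst (.var 21) (.const 0) (.var 21)) ;;
  each 20 (each 21 (ite (.natLe (.const 1) (.get src (.var 20) (.var 21)))
    (nset 23 (.const 0) (.const 0) (.at dst (.var 20)) ;;
      nset 24 (.const 0) (.const 0) (.at dst (.var 21)) ;;
      each 22 (ite (.natEq (.at dst (.var 22)) (.var 24))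
        (nset dst (.var 22) (.const 0) (.var 23)) skip)) skip))

/-- The two labels are read from the arrays 23 and 24, because the loop overwrites the entries of
`dst` from which they were copied. -/
theorem den_relabel {s : Store} (hn : s.nat 0 0 0 = n) {dst : ℕ}
    (hd : dst ∉ [0, 20, 21, 22, 23, 24]) (z : ℕ) (hz : z < n) :
    ((each 22 (ite (.natEq (.at dst (.var 22)) (.var 24))
      (nset dst (.var 22) (.const 0) (.var 23)) skip)).den s).nat dst z 0
      = if s.nat dst z 0 = s.nat 24 0 0 then s.nat 23 0 0 else s.nat dst z 0 := by
  simp only [List.mem_cons, List.not_mem_nil, or_false, not_or] at hd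
  obtain ⟨hd0, hd20, hd21, hd22, hd23, hd24⟩ := hd
  have main := den_each (x := 22) (c := ite (.natEq (.at dst (.var 22)) (.var 24))
      (nset dst (.var 22) (.const 0) (.var 23)) skip)
    (by simp [wf, nw, hd0, Ne.symm hd22]) s (fun k s' => ∀ z, s'.nat dst z 0
      = if z < k ∧ s.nat dst z 0 = s.nat 24 0 0 then s.nat 23 0 0 else s.nat dst z 0)
    (by simp [Store.setNat_nat_of_ne _ _ _ _ hd22]) (by
      intro k s₁ hk hk₁ hs₁ hP z
      rw [Store.setNat_nat_of_ne _ _ _ _ hd22]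
      have e1 : s₁.nat 24 = s.nat 24 := hs₁.1 24 (by simp [nw, Ne.symm hd24])
      have e2 : s₁.nat 23 = s.nat 23 := hs₁.1 23 (by simp [nw, Ne.symm hd23])
      have e3 : s₁.nat dst k 0 = s.nat dst k 0 := by rw [hP, if_neg (by omega)]
      by_cases hc : s.nat dst k 0 = s.nat 24 0 0
      · rw [den_ite_pos _ _ (by simpa [hk₁, e1, e3] using hc)]
        simp only [den_nset, NExp.eval_var, NExp.eval_const, hk₁, e2, Store.setNat_nat_same,
          and_true, hP]
        by_cases hzk : z = k
        · subst hzk; simp [hc]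
        · have : z < k + 1 ↔ z < k := by omega
          simp [hzk, this]
      · rw [den_ite_neg _ _ (by simpa [hk₁, e1, e3] using hc), den_skip, hP]
        by_cases hzk : z = k
        · subst hzk; simp [hc]
        · have : z < k + 1 ↔ z < k := by omega
          simp [this])
  rw [main z, hn]
  simp [hz]

/-- Invariant: `dst` labels the components of the multigraph of the edges read so far. All labels
are names of vertices, hence less than `n`. -/
theorem den_compC {s : Store} (hn : s.nat 0 0 0 = n) {src dst : ℕ}
    (hd : dst ∉ [0, 20, 21, 22, 23, 24]) (hs : src ∉ [dst, 20, 21, 22, 23, 24]) :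
    IsLabeling (s.mat n src) (((compC src dst).den s).vec n dst) ∧
      ∀ v, ((compC src dst).den s).vec n dst v < n := by
  have hd' := hd
  simp only [List.mem_cons, List.not_mem_nil, or_false, not_or] at hd hs
  obtain ⟨hd0, hd20, hd21, hd22, hd23, hd24⟩ := hd
  obtain ⟨hsd, hs20, hs21, hs22, hs23, hs24⟩ := hs
  unfold compC
  rw [den_seq]
  set s₀ := (each 21 (nset dst (.var 21) (.const 0) (.var 21))).den s with hs₀
  have hs₀a : AgreeOff [21, dst] [] s s₀ := (den_agree _ s).mono (by simp [nw]) (by simp [rw])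
  have hn₀ : s₀.nat 0 0 0 = n := by rw [hs₀a.1 0 (by simp [Ne.symm hd0]), hn]
  have hinit : ∀ v < n, s₀.nat dst v 0 = v := by
    have := den_each (x := 21) (c := nset dst (.var 21) (.const 0) (.var 21))
      (by simp [wf, nw, hd0, Ne.symm hd21]) s
      (fun k s' => ∀ v < k, s'.nat dst v 0 = v) (by simp) (by
        intro k s' hk hk' _ hP v hv
        simp only [den_nset, NExp.eval_var, NExp.eval_const, hk',
          Store.setNat_nat_of_ne _ _ _ _ hd21, Store.setNat_nat_same, and_true]
        split_ifs with h1
        · exact h1.symm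
        · exact hP v (by omega))
    rw [hn] at this
    exact this
  set F := s.mat n src with hF
  have main := den_each_pair (x := 20) (y := 21) hn₀
    (c := ite (.natLe (.const 1) (.get src (.var 20) (.var 21)))
    (nset 23 (.const 0) (.const 0) (.at dst (.var 20)) ;;
      nset 24 (.const 0) (.const 0) (.at dst (.var 21)) ;;
      each 22 (ite (.natEq (.at dst (.var 22)) (.var 24))
        (nset dst (.var 22) (.const 0) (.var 23)) skip)) skip)
    (by simp [wf, nw, hd0, Ne.symm hd20, Ne.symm hd21, Ne.symm hd22])
    (fun u v s' => IsLabeling (fun a b : Fin n => if (a : ℕ) < u ∨ (a : ℕ) = u ∧ (b : ℕ) < v then F a b else 0)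
      (s'.vec n dst) ∧ ∀ v, s'.vec n dst v < n)
    (fun u v s' m h => by
      have e1 : (s'.setNat 20 0 0 m).vec n dst = s'.vec n dst := by
        unfold Store.vec; rw [Store.setNat_nat_of_ne _ _ _ _ hd20]
      have e2 : (s'.setNat 21 0 0 m).vec n dst = s'.vec n dst := by
        unfold Store.vec; rw [Store.setNat_nat_of_ne _ _ _ _ hd21]
      rw [e1, e2]
      exact ⟨h, h⟩)
    ⟨fun a b => by
      simp only [Store.vec, hinit a a.2, hinit b b.2, Fin.val_inj]
      constructor
      · rintro rfl; rfl
      · exact eq_of_reachable (φ := id) (fun u v h => absurd (by simp) h),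
      fun v => by simp [Store.vec, hinit v v.2]⟩
    (fun u s' h => ⟨isLabeling_congr (fun a b => by
      have := b.2
      have e : ((a : ℕ) < u ∨ (a : ℕ) = u ∧ (b : ℕ) < n) ↔
        ((a : ℕ) < u + 1 ∨ (a : ℕ) = u + 1 ∧ (b : ℕ) < 0) := by omega
      rw [if_congr e rfl rfl]) h.1, h.2⟩)
    (by
      intro u v s' hu hv hu' hv' hs' hP
      have hsrc : s'.nat src = s.nat src := by
        rw [hs'.1 src (by simp [nw, hsd, hs20, hs21, hs22, hs23, hs24]),
          hs₀a.1 src (by simp [hsd, hs21])]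
      have hn' : s'.nat 0 0 0 = n := by rw [hs'.1 0 (by simp [nw, Ne.symm hd0]), hn₀]
      by_cases hc : 1 ≤ s.nat src u v
      · rw [den_ite_pos _ _ (by simpa [hsrc, hu', hv'] using hc)]
        simp only [den_seq]
        set s₁ := (nset 24 (.const 0) (.const 0) (.at dst (.var 21))).den
          ((nset 23 (.const 0) (.const 0) (.at dst (.var 20))).den s') with hs₁
        have e1 : s₁.nat dst = s'.nat dst := by
          simp [hs₁, Store.setNat_nat_of_ne _ _ _ _ hd23, Store.setNat_nat_of_ne _ _ _ _ hd24]
        have e2 : s₁.nat 23 0 0 = s'.nat dst u 0 := by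
          simp [hs₁, Store.setNat_nat_of_ne, hu']
        have e3 : s₁.nat 24 0 0 = s'.nat dst v 0 := by
          simp [hs₁, Store.setNat_nat_of_ne, hv', Store.setNat_nat_of_ne _ _ _ _ hd23]
        have e4 : s₁.nat 0 0 0 = n := by simp [hs₁, Store.setNat_nat_of_ne, hn']
        set s₂ := (each 22 (ite (.natEq (.at dst (.var 22)) (.var 24))
          (nset dst (.var 22) (.const 0) (.var 23)) skip)).den s₁ with hs₂
        have e5 : s₂.vec n dst = fun z => if s'.vec n dst z = s'.vec n dst ⟨v, hv⟩
            then s'.vec n dst ⟨u, hu⟩ else s'.vec n dst z := by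
          funext z
          simp only [Store.vec]
          rw [hs₂, den_relabel e4 hd' z z.2, e1, e2, e3]
          rfl
        rw [e5]
        constructor
        · refine hP.1.merge (u := ⟨u, hu⟩) (v := ⟨v, hv⟩) fun a b => ?_
          by_cases hab : a = ⟨u, hu⟩ ∧ b = ⟨v, hv⟩
          · obtain ⟨rfl, rfl⟩ := hab
            have : F ⟨u, hu⟩ ⟨v, hv⟩ ≠ 0 := by
              simp only [hF, Store.mat]; omega
            simp [this]
          · have e : ((a : ℕ) < u ∨ (a : ℕ) = u ∧ (b : ℕ) < v + 1) ↔
              ((a : ℕ) < u ∨ (a : ℕ) = u ∧ (b : ℕ) < v) := by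
              simp only [Fin.ext_iff] at hab
              omega
            rw [if_congr e rfl rfl]
            simp [hab]
        · intro z
          dsimp only
          split_ifs
          · exact hP.2 _
          · exact hP.2 _
      · rw [den_ite_neg _ _ (by simpa [hsrc, hu', hv'] using hc), den_skip]
        refine ⟨isLabeling_congr (fun a b => ?_) hP.1, hP.2⟩
        by_cases hab : a = ⟨u, hu⟩ ∧ b = ⟨v, hv⟩
        · obtain ⟨rfl, rfl⟩ := hab
          have : F ⟨u, hu⟩ ⟨v, hv⟩ = 0 := by
            simp only [hF, Store.mat]; omega
          simp [this]
        · have e : ((a : ℕ) < u ∨ (a : ℕ) = u ∧ (b : ℕ) < v + 1) ↔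
            ((a : ℕ) < u ∨ (a : ℕ) = u ∧ (b : ℕ) < v) := by
            simp only [Fin.ext_iff] at hab
            omega
          rw [if_congr e rfl rfl])
  refine ⟨isLabeling_congr (fun a b => ?_) main.1, main.2⟩
  have := a.2
  simp

/-- Number the classes of the labeling in the array `8`: the number of classes goes to the array
`2`, the class of each vertex to the array `3`. -/
def partitionC : Cmd :=
  markC 17 (.natLe (.const 0) (.const 0)) (.at 8 (.var 21)) ;;
  nset 2 (.const 0) (.const 0) (.const 0) ;;
  each 21 (ite (.natLe (.const 1) (.at 17 (.var 21)))
    (nset 17 (.var 21) (.const 0) (.var 2) ;;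
      nset 2 (.const 0) (.const 0) (.add (.var 2) (.const 1))) skip) ;;
  each 21 (nset 3 (.var 21) (.const 0) (.at 17 (.at 8 (.var 21))))

/-- A class is numbered by the count of used labels below its own. The entries outside the encoded
range must vanish, since the memory passed to the subroutine has to equal its input exactly. -/
theorem den_partitionC {s : Store} (hn : s.nat 0 0 0 = n)
    (hL : ∀ v, s.vec n 8 v < n) (h2 : ∀ i j, ¬ (i = 0 ∧ j = 0) → s.nat 2 i j = 0)
    (h3 : ∀ i j, ¬ (i < n ∧ j = 0) → s.nat 3 i j = 0) :
    ∃ (k : ℕ) (c : Fin n → Fin k), Function.Surjective c ∧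
      (∀ u v, c u = c v ↔ s.vec n 8 u = s.vec n 8 v) ∧
      (partitionC.den s).nat 2 = scalar k ∧
      (partitionC.den s).nat 3 = vector fun v => (c v : ℕ) := by
  classical
  unfold partitionC
  simp only [den_seq]
  set s₁ := (markC 17 (.natLe (.const 0) (.const 0)) (.at 8 (.var 21))).den s with hs₁
  have hs₁a : AgreeOff [20, 21, 17] [] s s₁ := (den_agree _ s).mono (by decide) (by decide)
  set p : ℕ → Prop := fun l => ∃ v : Fin n, s.vec n 8 v = l with hp
  have hmark : ∀ l < n, 1 ≤ s₁.nat 17 l 0 ↔ p l := by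
    intro l hl
    have := den_markC hn (dst := 17) (by decide) (cond := .natLe (.const 0) (.const 0))
      (key := .at 8 (.var 21)) (C := fun _ _ => True) (K := fun _ v => s.vec n 8 v) (by
        intro u v s' _ hv hs'
        simp [hv, hs'.1 8 (by decide), Store.vec]) ⟨l, hl⟩
    rw [← hs₁] at this
    rw [this]
    simp only [hp, true_and]
    exact ⟨fun ⟨_, v, h⟩ => ⟨v, h⟩, fun ⟨v, h⟩ => ⟨v, v, h⟩⟩
  set s₂ := (nset 2 (.const 0) (.const 0) (.const 0)).den s₁ with hs₂
  have hs₂a : AgreeOff [2] [] s₁ s₂ := (den_agree _ s₁).mono (by decide) (by decide)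
  have hn₂ : s₂.nat 0 0 0 = n := by rw [hs₂a.1 0 (by decide), hs₁a.1 0 (by decide), hn]
  have h2₂ : s₂.nat 2 = scalar 0 := by
    funext i j
    simp only [hs₂, den_nset, NExp.eval_const, Store.setNat_nat_same, scalar]
    split_ifs with h
    · rfl
    · rw [hs₁a.1 2 (by decide), h2 i j h]
  have key := den_each (x := 21) (c := ite (.natLe (.const 1) (.at 17 (.var 21)))
    (nset 17 (.var 21) (.const 0) (.var 2) ;;
      nset 2 (.const 0) (.const 0) (.add (.var 2) (.const 1))) skip) (by decide) s₂
    (fun k s' => s'.nat 2 = scalar (Nat.count p k) ∧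
      (∀ l < k, p l → s'.nat 17 l 0 = Nat.count p l) ∧
      ∀ l < n, k ≤ l → (1 ≤ s'.nat 17 l 0 ↔ p l)) (by
      refine ⟨by simp [Store.setNat_nat_of_ne, h2₂], by simp, fun l hl _ => ?_⟩
      rw [Store.setNat_nat_of_ne _ _ _ _ (by decide), hs₂a.1 17 (by decide), hmark l hl]) (by
      intro k s' hk hk' _ hP
      rw [hn₂] at hk
      obtain ⟨hP1, hP2, hP3⟩ := hP
      have h2' : s'.nat 2 0 0 = Nat.count p k := by rw [hP1]; simp [scalar]
      rw [Store.setNat_nat_of_ne _ _ _ _ (by decide), Store.setNat_nat_of_ne _ _ _ _ (by decide)]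
      by_cases hpk : p k
      · rw [den_ite_pos _ _ (by simpa [hk'] using (hP3 k hk le_rfl).2 hpk)]
        simp only [den_seq, den_nset, NExp.eval_var, NExp.eval_const, NExp.eval_add, hk', h2',
          Store.setNat_nat_same, Nat.count_succ, hpk, if_true,
          Store.setNat_nat_of_ne _ _ _ _ (show (2 : ℕ) ≠ 17 by decide),
          Store.setNat_nat_of_ne _ _ _ _ (show (17 : ℕ) ≠ 2 by decide), and_true]
        refine ⟨?_, fun l hl hpl => ?_, fun l hl hkl => ?_⟩
        · funext i j
          simp only [Store.setNat_nat_same, scalar]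
          split_ifs with h
          · rfl
          · rw [Store.setNat_nat_of_ne _ _ _ _ (by decide), hP1]; simp [scalar, h]
        · split_ifs with h
          · rw [h]
          · exact hP2 l (by omega) hpl
        · rw [if_neg (by omega)]
          exact hP3 l hl (by omega)
      · rw [den_ite_neg _ _ (by simpa [hk'] using fun h => hpk ((hP3 k hk le_rfl).1 h))]
        simp only [den_skip, Nat.count_succ, hpk, if_false, add_zero]
        refine ⟨hP1, fun l hl hpl => ?_, fun l hl hkl => hP3 l hl (by omega)⟩
        have : l ≠ k := fun h => hpk (h ▸ hpl)
        exact hP2 l (by omega) hpl)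
  rw [hn₂] at key
  set s₃ := (each 21 (ite (.natLe (.const 1) (.at 17 (.var 21)))
    (nset 17 (.var 21) (.const 0) (.var 2) ;;
      nset 2 (.const 0) (.const 0) (.add (.var 2) (.const 1))) skip)).den s₂ with hs₃
  obtain ⟨hk2, hk17, -⟩ := key
  have hs₃a : AgreeOff [2, 17, 21] [] s₂ s₃ := (den_agree _ s₂).mono (by decide) (by decide)
  have hn₃ : s₃.nat 0 0 0 = n := by rw [hs₃a.1 0 (by decide), hn₂]
  have h8₃ : s₃.nat 8 = s.nat 8 := by
    rw [hs₃a.1 8 (by decide), hs₂a.1 8 (by decide), hs₁a.1 8 (by decide)]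
  have h3₃ : s₃.nat 3 = s.nat 3 := by
    rw [hs₃a.1 3 (by decide), hs₂a.1 3 (by decide), hs₁a.1 3 (by decide)]
  have hlt : ∀ v : Fin n, Nat.count p (s.vec n 8 v) < Nat.count p n := fun v =>
    Nat.count_strict_mono ⟨v, rfl⟩ (hL v)
  refine ⟨Nat.count p n, fun v => ⟨Nat.count p (s.vec n 8 v), hlt v⟩, ?_, ?_, ?_, ?_⟩
  · intro i
    have hi : ∃ l < n, p l ∧ Nat.count p l = i := by
      have hfin : ∀ m, (i : ℕ) < Nat.count p m → ∃ l < m, p l ∧ Nat.count p l = i := by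
        intro m
        induction m with
        | zero => simp
        | succ m ih =>
          intro h
          rw [Nat.count_succ] at h
          by_cases h1 : (i : ℕ) < Nat.count p m
          · obtain ⟨l, hl, h2⟩ := ih h1
            exact ⟨l, by omega, h2⟩
          · have hpm : p m := by
              by_contra hpm
              simp [hpm] at h
              omega
            simp [hpm] at h
            exact ⟨m, by omega, hpm, by omega⟩
      exact hfin n i.2
    obtain ⟨l, -, ⟨v, hv⟩, hl⟩ := hi
    exact ⟨v, Fin.ext (by simp only; rw [hv, hl])⟩
  · intro u v
    rw [Fin.mk.injEq]
    exact ⟨fun h => Nat.count_injective ⟨u, rfl⟩ ⟨v, rfl⟩ h, fun h => by rw [h]⟩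
  · rw [den_nat _ _ (by decide), hk2]
  · have last := den_each (x := 21) (c := nset 3 (.var 21) (.const 0) (.at 17 (.at 8 (.var 21))))
      (by decide) s₃ (fun k s' => ∀ i j, s'.nat 3 i j
        = if i < k ∧ j = 0 then s₃.nat 17 (s.nat 8 i 0) 0 else s.nat 3 i j) (by
        simp [Store.setNat_nat_of_ne, h3₃]) (by
        intro k s' hk hk' hs' hP i j
        rw [Store.setNat_nat_of_ne _ _ _ _ (by decide)]
        simp only [den_nset, NExp.eval_var, NExp.eval_const, NExp.eval_at, hk',
          Store.setNat_nat_same, hs'.1 17 (by decide), hs'.1 8 (by decide), h8₃, hP]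
        by_cases hj : j = 0
        · by_cases hik : i = k
          · simp [hj, hik]
          · have : i < k + 1 ↔ i < k := by omega
            simp [hj, hik, this]
        · simp [hj])
    rw [hn₃] at last
    funext i j
    rw [last i j]
    simp only [vector]
    split_ifs with h
    · exact hk17 _ (hL ⟨i, h.1⟩) ⟨⟨i, h.1⟩, rfl⟩
    · exact h3 i j h

end ATSP

/-! ### Bellman-Ford tables for cheap closed walks -/

namespace ATSP

open Cmd

variable {n : ℕ}

section ShortestWalks

variable (G : Instance (Fin n))

/-- The entry for `v` in the row `k + 1` is computed correctly from the row `k`: `D k v` is a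
distance and `N k v` is the next vertex. -/
def RowOK (D : ℕ → ℕ → ℝ) (N : ℕ → ℕ → ℕ) (k : ℕ) (v : Fin n) : Prop :=
  (D (k + 1) v ≤ D k v ∧ ∀ u : Fin n, G.graph.Adj v u → D (k + 1) v ≤ G.weight v u + D k u) ∧
  ∃ u : Fin n, N (k + 1) v = u ∧
    ((u = v ∧ D (k + 1) v = D k v) ∨ (G.graph.Adj v u ∧ D (k + 1) v = G.weight v u + D k u))

/-- The distances to `a` that are at most `θ`. -/
structure IsDistTable (a : Fin n) (θ : ℝ) (D : ℕ → ℕ → ℝ) (N : ℕ → ℕ → ℕ) : Prop where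
  zero : ∀ v : Fin n, D 0 v = if v = a then 0 else θ + 1
  row : ∀ k < n, ∀ v, RowOK G D N k v

variable {G} {a : Fin n} {θ : ℝ} {D : ℕ → ℕ → ℝ} {N : ℕ → ℕ → ℕ}

/-- Each edge of the walk is relaxed in one row, and the rows are nonincreasing, so unused rows do
no harm. -/
theorem IsDistTable.le_of_walk (h : IsDistTable G a θ D N) {k : ℕ} {v : Fin n} {r : ℝ}
    (hw : WalkTo G a k v r) {K : ℕ} (hk : k ≤ K) (hK : K ≤ n) : D K v ≤ r := by
  induction hw generalizing K with
  | nil =>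
    clear hk
    induction K with
    | zero => rw [h.zero]; simp
    | succ K ih => exact ((h.row K (by omega) a).1.1).trans (ih (by omega))
  | @cons k u v r hadj _ ih =>
    obtain ⟨K, rfl⟩ : ∃ K', K = K' + 1 := ⟨K - 1, by omega⟩
    have h1 := (h.row K (by omega) u).1.2 v hadj
    have h2 := ih (K := K) (by omega) (by omega)
    linarith

/-- The value `θ + 1` plays the part of infinity: as weights are nonnegative, an entry that is at
most `θ` can only stem from the entry `0` at `a`. -/
theorem IsDistTable.exists_walk (h : IsDistTable G a θ D N) {k : ℕ} (hk : k ≤ n) {v : Fin n}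
    (hv : D k v ≤ θ) : ∃ k' ≤ k, ∃ r, WalkTo G a k' v r ∧ r ≤ D k v := by
  induction k generalizing v with
  | zero =>
    rw [h.zero] at hv ⊢
    by_cases hva : v = a
    · subst hva
      exact ⟨0, le_rfl, 0, WalkTo.nil, by simp⟩
    · simp only [hva, if_false] at hv
      linarith
  | succ k ih =>
    obtain ⟨u, -, ⟨rfl, hu⟩ | ⟨hadj, hu⟩⟩ := (h.row k (by omega) v).2
    · obtain ⟨k', hk', r, hr, hle⟩ := ih (by omega) (hu ▸ hv)
      exact ⟨k', by omega, r, hr, hu ▸ hle⟩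
    · have := G.weight_nonneg' v u
      obtain ⟨k', hk', r, hr, hle⟩ := ih (v := u) (by omega) (by linarith)
      exact ⟨k' + 1, by omega, _, WalkTo.cons hadj hr, by linarith⟩

theorem IsDistTable.linked_iff (h : IsDistTable G a θ D N) (b : Fin n) :
    Linked G a b θ ↔ G.graph.Adj a b ∧ G.weight a b + D n b ≤ θ := by
  constructor
  · rintro ⟨hadj, k, hk, r, hr, hle⟩
    rw [Fintype.card_fin] at hk
    have := h.le_of_walk hr hk le_rfl
    exact ⟨hadj, by linarith⟩
  · rintro ⟨hadj, hle⟩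
    have := G.weight_nonneg' a b
    obtain ⟨k, hk, r, hr, hle'⟩ := h.exists_walk le_rfl (v := b) (by linarith)
    exact ⟨hadj, k, by rwa [Fintype.card_fin], r, hr, by linarith⟩

end ShortestWalks

/-- Compute the entry of the distance table for the vertex `20` in the row after row `22`. -/
def distEntryC : Cmd :=
  rset 12 (.add (.var 22) (.const 1)) (.var 20) (.get 12 (.var 22) (.var 20)) ;;
  nset 14 (.add (.var 22) (.const 1)) (.var 20) (.var 20) ;;
  each 21 (ite (.and (.natLe (.const 1) (.get 1 (.var 20) (.var 21)))
      (.not (.realLe (.get 12 (.add (.var 22) (.const 1)) (.var 20))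
        (.add (.get 0 (.var 20) (.var 21)) (.get 12 (.var 22) (.var 21))))))
    (rset 12 (.add (.var 22) (.const 1)) (.var 20)
        (.add (.get 0 (.var 20) (.var 21)) (.get 12 (.var 22) (.var 21))) ;;
      nset 14 (.add (.var 22) (.const 1)) (.var 20) (.var 21)) skip)

/-- Compute the table of distances to the vertex `t`. -/
def distC (t : NExp) : Cmd :=
  each 21 (rset 12 (.const 0) (.var 21) (.add (.var 13) (.const 1))) ;;
  rset 12 (.const 0) t (.const 0) ;;
  each 22 (each 20 distEntryC)

/-- The arrays `1` of natural numbers and `0` of real numbers contain the graph and its weights. -/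
structure HasGraph (G : Instance (Fin n)) (s : Store) : Prop where
  size : s.nat 0 0 0 = n
  adj : ∀ u v : Fin n, 1 ≤ s.nat 1 u v ↔ G.graph.Adj u v
  weight : ∀ u v : Fin n, s.real 0 u v = G.weight u v

theorem HasGraph.congr {G : Instance (Fin n)} {s s' : Store} (h : HasGraph G s)
    (h0 : s'.nat 0 = s.nat 0) (h1 : s'.nat 1 = s.nat 1) (h2 : s'.real 0 = s.real 0) :
    HasGraph G s' :=
  ⟨by rw [h0, h.size], by rw [h1]; exact h.adj, by rw [h2]; exact h.weight⟩

theorem den_distEntryC {G : Instance (Fin n)} {s : Store} (hG : HasGraph G s) {k : ℕ} {v : Fin n}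
    (hk : s.nat 22 0 0 = k) (hv : s.nat 20 0 0 = v) :
    RowOK G ((distEntryC.den s).real 12) ((distEntryC.den s).nat 14) k v ∧
    ∀ i j : ℕ, ¬ (i = k + 1 ∧ j = (v : ℕ)) → (distEntryC.den s).real 12 i j = s.real 12 i j ∧
      (distEntryC.den s).nat 14 i j = s.nat 14 i j := by
  unfold distEntryC
  simp only [den_seq]
  set s₁ := (nset 14 (.add (.var 22) (.const 1)) (.var 20) (.var 20)).den
    ((rset 12 (.add (.var 22) (.const 1)) (.var 20) (.get 12 (.var 22) (.var 20))).den s) with hs₁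
  have hs₁a : AgreeOff [14] [12] s s₁ :=
    ((den_agree _ s).mono (by decide) (by decide)).trans ((den_agree _ _).mono (by decide) (by decide))
  have hG₁ : HasGraph G s₁ := hG.congr (hs₁a.1 0 (by decide)) (hs₁a.1 1 (by decide))
    (hs₁a.2 0 (by decide))
  have hk₁ : s₁.nat 22 0 0 = k := by rw [hs₁a.1 22 (by decide), hk]
  have hv₁ : s₁.nat 20 0 0 = v := by rw [hs₁a.1 20 (by decide), hv]
  have hD₁ : ∀ i j : ℕ, s₁.real 12 i j = if i = k + 1 ∧ j = (v : ℕ) then s.real 12 k v else s.real 12 i j := by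
    intro i j
    simp [hs₁, hk, hv]
  have hN₁ : ∀ i j : ℕ, s₁.nat 14 i j = if i = k + 1 ∧ j = (v : ℕ) then (v : ℕ) else s.nat 14 i j := by
    intro i j
    simp [hs₁, hk, hv]
  have main := den_each (x := 21) (c := ite (.and (.natLe (.const 1) (.get 1 (.var 20) (.var 21)))
      (.not (.realLe (.get 12 (.add (.var 22) (.const 1)) (.var 20))
        (.add (.get 0 (.var 20) (.var 21)) (.get 12 (.var 22) (.var 21))))))
    (rset 12 (.add (.var 22) (.const 1)) (.var 20)
        (.add (.get 0 (.var 20) (.var 21)) (.get 12 (.var 22) (.var 21))) ;;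
      nset 14 (.add (.var 22) (.const 1)) (.var 20) (.var 21)) skip) (by decide) s₁
    (fun m s' => (s'.real 12 (k + 1) v ≤ s.real 12 k v ∧
      ∀ u : Fin n, (u : ℕ) < m → G.graph.Adj v u →
        s'.real 12 (k + 1) v ≤ G.weight v u + s.real 12 k u) ∧
      (∃ u : Fin n, s'.nat 14 (k + 1) v = u ∧ ((u = v ∧ s'.real 12 (k + 1) v = s.real 12 k v) ∨
        (G.graph.Adj v u ∧ s'.real 12 (k + 1) v = G.weight v u + s.real 12 k u))) ∧
      ∀ i j : ℕ, ¬ (i = k + 1 ∧ j = (v : ℕ)) → s'.real 12 i j = s.real 12 i j ∧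
        s'.nat 14 i j = s.nat 14 i j)
    (by
      rw [Store.setNat_real, Store.setNat_nat_of_ne _ _ _ _ (by decide)]
      refine ⟨⟨by rw [hD₁]; simp, by simp⟩, ⟨v, by rw [hN₁]; simp, Or.inl ⟨rfl, by rw [hD₁]; simp⟩⟩,
        fun i j hij => ⟨by rw [hD₁, if_neg hij], by rw [hN₁, if_neg hij]⟩⟩)
    (by
      intro m s' hm hm' hs' ⟨⟨hle, hall⟩, hex, hoff⟩
      rw [hG₁.size] at hm
      have hk' : s'.nat 22 0 0 = k := by rw [hs'.1 22 (by decide), hk₁]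
      have hv' : s'.nat 20 0 0 = v := by rw [hs'.1 20 (by decide), hv₁]
      have hG' : HasGraph G s' := hG₁.congr (hs'.1 0 (by decide)) (hs'.1 1 (by decide))
        (hs'.2 0 (by decide))
      have hDk : ∀ u, s'.real 12 k u = s.real 12 k u := fun u => (hoff k u (by omega)).1
      have hw : s'.real 0 v m = G.weight v ⟨m, hm⟩ := hG'.weight v ⟨m, hm⟩
      have hadj : 1 ≤ s'.nat 1 v m ↔ G.graph.Adj v ⟨m, hm⟩ := hG'.adj v ⟨m, hm⟩
      rw [Store.setNat_real, Store.setNat_nat_of_ne _ _ _ _ (by decide)]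
      by_cases hc : G.graph.Adj v ⟨m, hm⟩ ∧
          ¬ s'.real 12 (k + 1) v ≤ G.weight v ⟨m, hm⟩ + s.real 12 k m
      · rw [den_ite_pos _ _ (by
          simp only [BExp.holds_and, BExp.holds_natLe, BExp.holds_not, BExp.holds_realLe,
            NExp.eval_const, NExp.eval_get, NExp.eval_var, NExp.eval_add, RExp.eval_get,
            RExp.eval_add, hk', hv', hm', hw, hDk, hadj]
          exact hc)]
        have hlt := not_le.1 hc.2
        simp only [den_seq, den_rset, den_nset, NExp.eval_add, NExp.eval_var, NExp.eval_const,
          RExp.eval_add, RExp.eval_get, hk', hv', hm', hw, hDk, Store.setReal_nat,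
          Store.setNat_real, Store.setReal_real_same, Store.setNat_nat_same]
        refine ⟨⟨by simp; linarith, fun u hu huadj => ?_⟩,
          ⟨⟨m, hm⟩, by simp, Or.inr ⟨hc.1, by simp⟩⟩, fun i j hij => ?_⟩
        · simp only [and_self, if_true]
          by_cases hum : (u : ℕ) = m
          · have : u = ⟨m, hm⟩ := Fin.ext hum
            rw [this]
          · have := hall u (by omega) huadj
            linarith
        · rw [if_neg hij, if_neg hij]
          exact hoff i j hij
      · rw [den_ite_neg _ _ (by
          simp only [BExp.holds_and, BExp.holds_natLe, BExp.holds_not, BExp.holds_realLe,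
            NExp.eval_const, NExp.eval_get, NExp.eval_var, NExp.eval_add, RExp.eval_get,
            RExp.eval_add, hk', hv', hm', hw, hDk, hadj]
          exact hc), den_skip]
        refine ⟨⟨hle, fun u hu huadj => ?_⟩, hex, hoff⟩
        by_cases hum : (u : ℕ) = m
        · have e : u = ⟨m, hm⟩ := Fin.ext hum
          by_contra h1
          rw [e] at h1 huadj
          exact hc ⟨huadj, h1⟩
        · exact hall u (by omega) huadj)
  obtain ⟨⟨h1, h2⟩, h3, h4⟩ := main
  rw [hG₁.size] at *
  have hDk := fun u : ℕ => (h4 k u (by omega)).1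
  refine ⟨⟨⟨by rw [hDk]; exact h1, fun u hu => by rw [hDk]; exact h2 u u.2 hu⟩, ?_⟩, h4⟩
  obtain ⟨u, hu, h5⟩ := h3
  exact ⟨u, hu, by simpa only [hDk] using h5⟩

theorem den_distC {G : Instance (Fin n)} {s : Store} (hG : HasGraph G s) {t : NExp} {a : Fin n}
    {θ : ℝ} (ht : ∀ s', AgreeOff [21] [12] s s' → t.eval s' = a) (hθ : s.real 13 0 0 = θ) :
    IsDistTable G a θ (((distC t).den s).real 12) (((distC t).den s).nat 14) := by
  unfold distC
  simp only [den_seq]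
  set s₁ := (each 21 (rset 12 (.const 0) (.var 21) (.add (.var 13) (.const 1)))).den s with hs₁
  have hs₁a : AgreeOff [21] [12] s s₁ := (den_agree _ s).mono (by decide) (by decide)
  have h1 : ∀ v < n, s₁.real 12 0 v = θ + 1 := by
    have := den_each (x := 21) (c := rset 12 (.const 0) (.var 21) (.add (.var 13) (.const 1)))
      (by decide) s (fun k s' => ∀ v < k, s'.real 12 0 v = θ + 1) (by simp) (by
        intro k s' hk hk' hs' hP v hv
        rw [Store.setNat_real]
        have e : s'.real 13 0 0 = θ := by rw [hs'.2 13 (by decide), hθ]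
        simp only [den_rset, NExp.eval_const, NExp.eval_var, hk', Store.setReal_real_same, true_and,
          RExp.eval_add, RExp.eval_var, e, RExp.eval_const]
        split_ifs with h
        · simp
        · exact hP v (by omega))
    rw [hG.size] at this
    exact this
  set s₂ := (rset 12 (.const 0) t (.const 0)).den s₁ with hs₂
  have hs₂a : AgreeOff [21] [12] s s₂ := hs₁a.trans ((den_agree _ _).mono (by simp [nw]) (by simp [rw]))
  have h2 : ∀ v : Fin n, s₂.real 12 0 v = if v = a then 0 else θ + 1 := by
    intro v
    simp only [hs₂, den_rset, NExp.eval_const, ht s₁ hs₁a, Store.setReal_real_same, true_and,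
      Fin.val_inj, RExp.eval_const, Rat.cast_zero, h1 v v.2]
  have hG₂ : HasGraph G s₂ := hG.congr (hs₂a.1 0 (by decide)) (hs₂a.1 1 (by decide))
    (hs₂a.2 0 (by decide))
  have main := den_each_pair (x := 22) (y := 20) (c := distEntryC) hG₂.size (by decide)
    (fun k m s' => (∀ v : Fin n, s'.real 12 0 v = if v = a then 0 else θ + 1) ∧
      ∀ k' ≤ k, ∀ v : Fin n, (k' < k ∨ (v : ℕ) < m) → RowOK G (s'.real 12) (s'.nat 14) k' v)
    (fun u v s' m h => by
      rw [Store.setNat_real, Store.setNat_real, Store.setNat_nat_of_ne _ _ _ _ (by decide),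
        Store.setNat_nat_of_ne _ _ _ _ (by decide)]
      exact ⟨h, h⟩)
    ⟨h2, fun k' hk' v h => by omega⟩
    (fun k s' h => ⟨h.1, fun k' hk' v h' => by
      by_cases hkk : k' < k
      · exact h.2 k' (by omega) v (Or.inl hkk)
      · exact h.2 k' (by omega) v (Or.inr v.2)⟩)
    (by
      intro k m s' hk hm hk' hm' hs' ⟨hP1, hP2⟩
      have hG' : HasGraph G s' := hG₂.congr (hs'.1 0 (by decide)) (hs'.1 1 (by decide))
        (hs'.2 0 (by decide))
      obtain ⟨h3, h4⟩ := den_distEntryC hG' (v := ⟨m, hm⟩) hk' hm'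
      refine ⟨fun v => by rw [(h4 0 v (by omega)).1, hP1], fun k' hk'' v h' => ?_⟩
      by_cases hnew : k' = k ∧ (v : ℕ) = m
      · obtain ⟨rfl, hvm⟩ := hnew
        have e : v = ⟨m, hm⟩ := Fin.ext hvm
        rw [e]; exact h3
      · have := hP2 k' (by omega) v (by omega)
        have e1 := h4 (k' + 1) v (by simp only; omega)
        have e2 : ∀ u : Fin n, (distEntryC.den s').real 12 k' u = s'.real 12 k' u := fun u =>
          (h4 k' u (by omega)).1
        unfold RowOK
        rw [e1.1, e1.2]
        simp only [e2]
        exact this)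
  exact ⟨main.1, fun k hk v => main.2 k hk.le v (Or.inl hk)⟩

/-- Add the closed walk through the edge from the vertex `29` to the vertex `30` that is described
by the distance table. -/
def traceC : Cmd :=
  nset 37 (.const 0) (.const 0) (.var 30) ;;
  nset 12 (.var 29) (.var 30) (.add (.get 12 (.var 29) (.var 30)) (.const 1)) ;;
  each 22 (nset 38 (.const 0) (.const 0) (.get 14 (.sub (.var 0) (.var 22)) (.var 37)) ;;
    ite (.natEq (.var 38) (.var 37)) skip
      (nset 12 (.var 37) (.var 38) (.add (.get 12 (.var 37) (.var 38)) (.const 1)) ;;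
        nset 37 (.const 0) (.const 0) (.var 38)))

/-- The table of next vertices is followed from row `n` down to row `0`. The weight spent plus the
remaining distance never exceeds `θ`. -/
theorem den_traceC {G : Instance (Fin n)} {s : Store} (hn : s.nat 0 0 0 = n) {a b : Fin n} {θ : ℝ}
    (ha : s.nat 29 0 0 = a) (hb : s.nat 30 0 0 = b)
    (hD : IsDistTable G a θ (s.real 12) (s.nat 14)) (hl : Linked G a b θ) :
    ∃ Z r, Trail G a b a Z r ∧ r ≤ θ ∧
      (traceC.den s).mat n 12 = fun u v => s.mat n 12 u v + Z u v := by
  have hab := (hD.linked_iff b).1 hl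
  unfold traceC
  simp only [den_seq]
  set s₁ := (nset 12 (.var 29) (.var 30) (.add (.get 12 (.var 29) (.var 30)) (.const 1))).den
    ((nset 37 (.const 0) (.const 0) (.var 30)).den s) with hs₁
  have hs₁a : AgreeOff [12, 37] [] s s₁ :=
    ((den_agree _ s).mono (by decide) (by decide)).trans ((den_agree _ _).mono (by decide) (by decide))
  have h37 : s₁.nat 37 0 0 = b := by simp [hs₁, Store.setNat_nat_of_ne, hb]
  have h12 : s₁.mat n 12 = fun u v => s.mat n 12 u v + addEdge 0 a b u v := by
    funext u v
    simp only [hs₁, Store.mat, den_nset, NExp.eval_var, NExp.eval_const, NExp.eval_add,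
      NExp.eval_get, Store.setNat_nat_of_ne _ _ _ _ (show (29 : ℕ) ≠ 37 by decide),
      Store.setNat_nat_of_ne _ _ _ _ (show (30 : ℕ) ≠ 37 by decide),
      Store.setNat_nat_of_ne _ _ _ _ (show (12 : ℕ) ≠ 37 by decide), ha, hb,
      Store.setNat_nat_same, Fin.val_inj, addEdge]
    split_ifs with h
    · rw [h.1, h.2]; simp
    · simp
  have hn₁ : s₁.nat 0 0 0 = n := by rw [hs₁a.1 0 (by decide), hn]
  have main := den_each (x := 22)
    (c := nset 38 (.const 0) (.const 0) (.get 14 (.sub (.var 0) (.var 22)) (.var 37)) ;;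
    ite (.natEq (.var 38) (.var 37)) skip
      (nset 12 (.var 37) (.var 38) (.add (.get 12 (.var 37) (.var 38)) (.const 1)) ;;
        nset 37 (.const 0) (.const 0) (.var 38))) (by decide) s₁
    (fun k s' => ∃ (v : Fin n) (Z : Fin n → Fin n → ℕ) (r : ℝ), s'.nat 37 0 0 = v ∧
      Trail G a b v Z r ∧ r + s.real 12 (n - k) v ≤ θ ∧
      s'.mat n 12 = fun u v => s.mat n 12 u v + Z u v)
    ⟨b, _, _, by rw [Store.setNat_nat_of_ne _ _ _ _ (by decide), h37], Trail.start hab.1,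
      by simpa using hab.2, by
        rw [← h12]; unfold Store.mat; rw [Store.setNat_nat_of_ne _ _ _ _ (by decide)]⟩
    (by
      rintro k s' hk hk' hs' ⟨v, Z, r, hv, hZ, hr, hM⟩
      rw [hn₁] at hk
      obtain ⟨m, hm⟩ : ∃ m, n - k = m + 1 := ⟨n - k - 1, by omega⟩
      have hm' : n - (k + 1) = m := by omega
      have hn' : s'.nat 0 0 0 = n := by rw [hs'.1 0 (by decide), hn₁]
      have h14 : s'.nat 14 = s.nat 14 := by rw [hs'.1 14 (by decide), hs₁a.1 14 (by decide)]
      obtain ⟨⟨hle, -⟩, u, hu, hcase⟩ := hD.row m (by omega) v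
      rw [den_seq]
      set s₂ := (nset 38 (.const 0) (.const 0) (.get 14 (.sub (.var 0) (.var 22)) (.var 37))).den s'
        with hs₂
      have e38 : s₂.nat 38 0 0 = u := by
        simp [hs₂, hn', hk', hv, h14, hm, hu]
      have e37 : s₂.nat 37 0 0 = v := by simp [hs₂, Store.setNat_nat_of_ne, hv]
      have e12 : s₂.nat 12 = s'.nat 12 := by simp [hs₂, Store.setNat_nat_of_ne]
      rw [hm, ] at hr
      rw [hm', Store.setNat_nat_of_ne _ _ _ _ (by decide)]
      by_cases huv : u = v
      · rw [den_ite_pos _ _ (by simp [e38, e37, huv]), den_skip]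
        -- An entry with next vertex `v` itself may come from a loop edge. The loop is skipped,
        -- which is harmless as its weight is nonnegative.
        have hle' : s.real 12 m v ≤ s.real 12 (m + 1) v := by
          rcases hcase with h | h
          · exact h.2.ge
          · have := G.weight_nonneg' v u
            rw [h.2, huv] at *
            linarith
        refine ⟨v, Z, r, e37, hZ, by linarith, ?_⟩
        rw [← hM]; unfold Store.mat
        rw [Store.setNat_nat_of_ne _ _ _ _ (by decide), e12]
      · rw [den_ite_neg _ _ (by simp [e38, e37, Fin.val_inj, huv])]
        have hadj : G.graph.Adj v u ∧ s.real 12 (m + 1) v = G.weight v u + s.real 12 m u := by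
          rcases hcase with h | h
          · exact absurd h.1 huv
          · exact h
        refine ⟨u, _, _, ?_, hZ.step hadj.1, by linarith, ?_⟩
        · simp [Store.setNat_nat_of_ne, e38]
        · have hM' : ∀ p q : Fin n, s'.nat 12 p q = s.mat n 12 p q + Z p q := fun p q =>
            congrFun (congrFun hM p) q
          funext p q
          simp only [Store.mat, den_seq, den_nset, NExp.eval_var, NExp.eval_const, NExp.eval_add,
            NExp.eval_get, Store.setNat_nat_of_ne _ _ _ _ (show (12 : ℕ) ≠ 37 by decide),
            Store.setNat_nat_of_ne _ _ _ _ (show (12 : ℕ) ≠ 22 by decide), e37, e38, e12,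
            Store.setNat_nat_same, Fin.val_inj, addEdge, hM']
          split_ifs with h
          · rw [h.1, h.2]; rfl
          · simp)
  rw [hn₁] at main
  obtain ⟨v, Z, r, -, hZ, hr, hM⟩ := main
  have hr0 : 0 ≤ r := by
    rw [← hZ.sum_rowW]
    exact Finset.sum_nonneg fun u _ => G.rowW_nonneg Z u
  -- In row `0` every vertex except `a` has distance `θ + 1`, so the walk has ended at `a`.
  rw [Nat.sub_self, hD.zero] at hr
  by_cases hva : v = a
  · subst hva
    exact ⟨Z, r, hZ, by simpa using hr, hM⟩
  · simp only [hva, if_false] at hr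
    linarith

end ATSP

/-! ### Charging crossing components -/

namespace ATSP

open Cmd

variable {n : ℕ}

/-- Label the components of the solution in the array `4`, mark the crossing ones, and charge each
of them to the most valuable component of the array `5` that it meets. -/
def chargeC : Cmd :=
  compC 4 9 ;;
  markC 10 (.and (.natLe (.const 1) (.get 4 (.var 20) (.var 21)))
    (.not (.natEq (.at 8 (.var 20)) (.at 8 (.var 21))))) (.at 9 (.var 20)) ;;
  scatterC 6 (.natLe (.const 0) (.const 0)) (.at 6 (.var 21)) (.at 4 (.var 21)) ;;
  each 21 (rset 7 (.var 21) (.const 0) (.at 6 (.at 6 (.var 21)))) ;;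
  argmaxC 9 7 11 ;;
  scatterC 8 (.natLe (.const 1) (.at 10 (.at 9 (.var 21)))) (.at 6 (.at 11 (.at 9 (.var 21))))
    (.at 4 (.var 21))

/-- The vertices in the components that are marked by `chargeC`. -/
def Store.crossed (s : Store) (n : ℕ) : Fin n → Bool :=
  fun v => decide (1 ≤ s.nat 10 (s.nat 9 v 0) 0)

theorem Store.crossed_iff (s : Store) {n : ℕ} (v : Fin n) :
    s.crossed n v = true ↔ 1 ≤ s.nat 10 (s.nat 9 v 0) 0 := by simp [Store.crossed]

/-- The result of `chargeC`. -/
structure IsCharged (lb : Fin n → ℝ) (h L : Fin n → ℕ) (F : Fin n → Fin n → ℕ)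
    (top : Fin n → Fin n) (s : Store) : Prop where
  labeling : IsLabeling F (s.vec n 9)
  crossing : ∀ v, s.crossed n v = true ↔ Crossing F (s.vec n 9) L v
  classValue : ∀ l < n, s.real 6 l 0 = ∑ u with h u = l, lb u
  value : ∀ v : Fin n, s.real 7 v 0 = ∑ u with h u = h v, lb u
  top_eq : ∀ v : Fin n, s.nat 11 (s.nat 9 v 0) 0 = top v
  top_label : ∀ v, s.nat 9 (top v) 0 = s.nat 9 v 0
  top_max : ∀ u v : Fin n, s.nat 9 u 0 = s.nat 9 v 0 → s.real 7 u 0 ≤ s.real 7 (top v) 0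
  charge : ∀ l < n, s.real 8 l 0
    = ∑ v with (s.crossed n v = true ∧ h (top v) = l), lb v

theorem IsCharged.congr {lb : Fin n → ℝ} {h L : Fin n → ℕ} {F : Fin n → Fin n → ℕ}
    {top : Fin n → Fin n} {s s' : Store} (hs : IsCharged lb h L F top s) {N R : List ℕ}
    (ha : AgreeOff N R s s') (hN : ∀ a ∈ [9, 10, 11], a ∉ N) (hR : ∀ a ∈ [6, 7, 8], a ∉ R) :
    IsCharged lb h L F top s' := by
  have e1 := ha.1 9 (hN 9 (by simp))
  have e2 := ha.1 10 (hN 10 (by simp))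
  have e3 := ha.1 11 (hN 11 (by simp))
  have e4 := ha.2 6 (hR 6 (by simp))
  have e5 := ha.2 7 (hR 7 (by simp))
  have e6 := ha.2 8 (hR 8 (by simp))
  have e7 : s'.vec n 9 = s.vec n 9 := by unfold Store.vec; rw [e1]
  have e8 : s'.crossed n = s.crossed n := by unfold Store.crossed; rw [e1, e2]
  obtain ⟨h1, h2, h3, h4, h5, h6, h7, h8⟩ := hs
  constructor <;> simp only [e8, e1, e3, e4, e5, e6, e7] <;> assumption

/-- Arrays of natural numbers: 4 is `F`, 5 is `H` with labels 6, 7 is `E` with labels 8, 9 labels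
the components of `F`, 10 marks the crossing ones, and 11 gives a vertex in the most valuable
component of `H` met. Arrays of reals: 4 is `lb`, 6 and 7 are the values of the components of `H` by
label and by vertex, and 8 is the `lb` of what is charged to each label. -/
theorem den_chargeC {s : Store} (hn : s.nat 0 0 0 = n) {lb : Fin n → ℝ}
    (hlb : ∀ v : Fin n, s.real 4 v 0 = lb v) (hh : ∀ v, s.vec n 6 v < n) :
    ∃ top, IsCharged lb (s.vec n 6) (s.vec n 8) (s.mat n 4) top (chargeC.den s) := by
  unfold chargeC
  simp only [den_seq]
  set s₁ := (compC 4 9).den s with hs₁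
  have a₁ : AgreeOff [20, 21, 22, 23, 24, 9] [] s s₁ := (den_agree _ _).mono (by decide) (by decide)
  obtain ⟨f1, f2⟩ : IsLabeling (s.mat n 4) (s₁.vec n 9) ∧ ∀ v, s₁.vec n 9 v < n :=
    den_compC hn (by decide) (by decide)
  have hn₁ : s₁.nat 0 0 0 = n := by rw [a₁.1 0 (by decide), hn]
  set s₂ := (markC 10 (.and (.natLe (.const 1) (.get 4 (.var 20) (.var 21)))
    (.not (.natEq (.at 8 (.var 20)) (.at 8 (.var 21))))) (.at 9 (.var 20))).den s₁ with hs₂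
  have a₂ : AgreeOff [20, 21, 10] [] s₁ s₂ := (den_agree _ _).mono (by decide) (by decide)
  have hmark : ∀ l : Fin n, 1 ≤ s₂.nat 10 l 0 ↔ ∃ u v : Fin n,
      (1 ≤ s.nat 4 u v ∧ ¬ s.nat 8 u 0 = s.nat 8 v 0) ∧ s₁.nat 9 u 0 = l := fun l =>
    den_markC hn₁ (by decide) (by
      intro u v s' hu hv ha
      simp [hu, hv, ha.1 4 (by decide), ha.1 8 (by decide), ha.1 9 (by decide),
        a₁.1 4 (by decide), a₁.1 8 (by decide)]) l
  have hn₂ : s₂.nat 0 0 0 = n := by rw [a₂.1 0 (by decide), hn₁]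
  set s₃ := (scatterC 6 (.natLe (.const 0) (.const 0)) (.at 6 (.var 21)) (.at 4 (.var 21))).den s₂
    with hs₃
  have a₃ : AgreeOff [21] [6] s₂ s₃ := (den_agree _ _).mono (by decide) (by decide)
  have hcv : ∀ l < n, s₃.real 6 l 0 = ∑ u with s.vec n 6 u = l, lb u := by
    intro l hl
    rw [hs₃, den_scatterC hn₂ (C := fun _ => True) (K := s.vec n 6) (X := lb) (by
      intro v s' hv ha
      simp [hv, ha.1 6 (by decide), ha.2 4 (by decide), a₁.1 6 (by decide), a₂.1 6 (by decide),
        a₁.2 4 (by decide), a₂.2 4 (by decide), hlb, Store.vec]) l hl]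
    simp
  have hn₃ : s₃.nat 0 0 0 = n := by rw [a₃.1 0 (by decide), hn₂]
  set s₄ := (each 21 (rset 7 (.var 21) (.const 0) (.at 6 (.at 6 (.var 21))))).den s₃ with hs₄
  have a₄ : AgreeOff [21] [7] s₃ s₄ := (den_agree _ _).mono (by decide) (by decide)
  have hval : ∀ v < n, s₄.real 7 v 0 = s₃.real 6 (s.nat 6 v 0) 0 := by
    have := den_each (x := 21) (c := rset 7 (.var 21) (.const 0) (.at 6 (.at 6 (.var 21))))
      (by decide) s₃ (fun k s' => ∀ v < k, s'.real 7 v 0 = s₃.real 6 (s.nat 6 v 0) 0) (by simp) (by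
        intro k s' hk hk' ha hP v hv
        simp only [den_rset, NExp.eval_var, NExp.eval_const, hk', Store.setNat_real,
          Store.setReal_real_same, RExp.eval_at, NExp.eval_at, and_true, ha.1 6 (by decide),
          ha.2 6 (by decide), a₃.1 6 (by decide), a₂.1 6 (by decide), a₁.1 6 (by decide)]
        split_ifs with h1
        · rw [h1]
        · exact hP v (by omega))
    rw [hn₃] at this
    exact this
  have hn₄ : s₄.nat 0 0 0 = n := by rw [a₄.1 0 (by decide), hn₃]
  set s₅ := (argmaxC 9 7 11).den s₄ with hs₅
  have a₅ : AgreeOff [21, 11] [] s₄ s₅ := (den_agree _ _).mono (by decide) (by decide)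
  obtain ⟨top, htop⟩ : ∃ top : Fin n → Fin n, ∀ v : Fin n, s₅.nat 11 (s₄.nat 9 v 0) 0 = top v ∧
      s₄.nat 9 (top v) 0 = s₄.nat 9 v 0 ∧
      ∀ u : Fin n, s₄.nat 9 u 0 = s₄.nat 9 v 0 → s₄.real 7 u 0 ≤ s₄.real 7 (top v) 0 :=
    den_argmaxC hn₄ (by decide)
  have hn₅ : s₅.nat 0 0 0 = n := by rw [a₅.1 0 (by decide), hn₄]
  have e9 : s₄.nat 9 = s₁.nat 9 := by
    rw [a₄.1 9 (by decide), a₃.1 9 (by decide), a₂.1 9 (by decide)]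
  have e9' : s₅.nat 9 = s₁.nat 9 := by rw [a₅.1 9 (by decide), e9]
  have e10 : s₅.nat 10 = s₂.nat 10 := by
    rw [a₅.1 10 (by decide), a₄.1 10 (by decide), a₃.1 10 (by decide)]
  have e6 : s₅.nat 6 = s.nat 6 := by
    rw [a₅.1 6 (by decide), a₄.1 6 (by decide), a₃.1 6 (by decide), a₂.1 6 (by decide),
      a₁.1 6 (by decide)]
  have e4 : s₅.real 4 = s.real 4 := by
    rw [a₅.2 4 (by decide), a₄.2 4 (by decide), a₃.2 4 (by decide), a₂.2 4 (by decide),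
      a₁.2 4 (by decide)]
  have er7 : s₅.real 7 = s₄.real 7 := a₅.2 7 (by decide)
  have er6 : s₅.real 6 = s₃.real 6 := by rw [a₅.2 6 (by decide), a₄.2 6 (by decide)]
  rw [e9] at htop
  have hch : ∀ l < n, ((scatterC 8 (.natLe (.const 1) (.at 10 (.at 9 (.var 21))))
      (.at 6 (.at 11 (.at 9 (.var 21)))) (.at 4 (.var 21))).den s₅).real 8 l 0
      = ∑ v with (s₅.crossed n v = true ∧ s.vec n 6 (top v) = l), lb v := by
    intro l hl
    exact den_scatterC hn₅ (C := fun v => s₅.crossed n v = true) (X := lb) (K := fun v => s.vec n 6 (top v)) (by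
      intro v s' hv ha
      simp [hv, ha.1 9 (by decide), ha.1 10 (by decide), ha.1 11 (by decide), ha.1 6 (by decide),
        ha.2 4 (by decide), e9', e10, e6, e4, (htop v).1, hlb, Store.vec,
        Store.crossed_iff]) l hl
  have a₆ := (den_agree (scatterC 8 (.natLe (.const 1) (.at 10 (.at 9 (.var 21))))
    (.at 6 (.at 11 (.at 9 (.var 21)))) (.at 4 (.var 21))) s₅).mono
      (N' := [21]) (R' := [8]) (by decide) (by decide)
  set s₆ := (scatterC 8 (.natLe (.const 1) (.at 10 (.at 9 (.var 21))))
    (.at 6 (.at 11 (.at 9 (.var 21)))) (.at 4 (.var 21))).den s₅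
  have ev : s₆.vec n 9 = s₁.vec n 9 := by unfold Store.vec; rw [a₆.1 9 (by decide), e9']
  have ec : s₆.crossed n = s₅.crossed n := by
    unfold Store.crossed; rw [a₆.1 9 (by decide), a₆.1 10 (by decide)]
  refine ⟨top, ?_⟩
  constructor <;> simp only [ev, ec, a₆.1 9 (by decide), a₆.1 11 (by decide),
    a₆.2 6 (by decide), a₆.2 7 (by decide), e9', er7, er6]
  · exact f1
  · intro v
    rw [Store.crossed_iff, e9', e10, hmark ⟨s₁.nat 9 v 0, f2 v⟩]
    simp only [Crossing, Store.mat, Store.vec]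
    constructor
    · rintro ⟨a, b, ⟨h1, h2⟩, h3⟩
      exact ⟨a, b, h3, by omega, h2⟩
    · rintro ⟨a, b, h3, h1, h2⟩
      exact ⟨a, b, ⟨by omega, h2⟩, h3⟩
  · exact hcv
  · intro v
    rw [hval v v.2]
    exact hcv _ (hh v)
  · exact fun v => (htop v).1
  · exact fun v => (htop v).2.1
  · exact fun u v => (htop v).2.2 u
  · exact hch

end ATSP

/-! ### Searching for cheap closed walks -/

namespace ATSP

open Cmd

variable {n : ℕ}

/-- Set `dst` to the maximum of `d` and `e`. -/
def maxC (dst : ℕ) (d e : RExp) : Cmd :=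
  ite (.realLe d e) (rset dst (.const 0) (.const 0) e) (rset dst (.const 0) (.const 0) d)

theorem den_maxC (dst : ℕ) (d e : RExp) (s : Store) :
    (maxC dst d e).den s = s.setReal dst 0 0 (max (d.eval s) (e.eval s)) := by
  unfold maxC
  by_cases h : d.eval s ≤ e.eval s
  · rw [den_ite_pos _ _ (by simpa using h), max_eq_right h]; rfl
  · rw [den_ite_neg _ _ (by simpa using h), max_eq_left (le_of_not_ge h)]; rfl

/-- Compute the threshold for the closed walks through the component of the vertex `t` and the
distances to `t`. -/
def thresholdC (t : NExp) : Cmd :=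
  maxC 14 (.at 7 (.at 16 (.at 13 t))) (.var 5) ;;
  rset 13 (.const 0) (.const 0) (.mul (.mul (.const 3) (.var 2)) (.var 14)) ;;
  distC t

theorem den_thresholdC {G : Instance (Fin n)} {s : Store} (hG : HasGraph G s) {y : ℕ}
    (hy : y ≠ 21) {a t : Fin n} {ℓ : ℝ} (ha : s.nat y 0 0 = a)
    (ht : s.nat 16 (s.nat 13 a 0) 0 = t) (hℓ : s.real 7 t 0 = ℓ) :
    ((thresholdC (.var y)).den s).real 13 0 0 = 3 * s.real 2 0 0 * max ℓ (s.real 5 0 0) ∧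
    IsDistTable G a (3 * s.real 2 0 0 * max ℓ (s.real 5 0 0))
      (((thresholdC (.var y)).den s).real 12) (((thresholdC (.var y)).den s).nat 14) := by
  unfold thresholdC
  simp only [den_seq]
  set s₂ := (rset 13 (.const 0) (.const 0) (.mul (.mul (.const 3) (.var 2)) (.var 14))).den
    ((maxC 14 (.at 7 (.at 16 (.at 13 (.var y)))) (.var 5)).den s) with hs₂
  have a₂ : AgreeOff [] [13, 14] s s₂ :=
    ((den_agree _ _).mono (by simp [maxC, nw]) (by simp [maxC, rw])).trans
      ((den_agree _ _).mono (by simp [nw]) (by simp [rw]))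
  have h13 : s₂.real 13 0 0 = 3 * s.real 2 0 0 * max ℓ (s.real 5 0 0) := by
    rw [hs₂, den_maxC]
    simp [ha, ht, hℓ, Store.setReal_real_of_ne]
  refine ⟨?_, ?_⟩
  · rw [den_real _ _ (by simp [distC, distEntryC, rw]), h13]
  · exact den_distC (hG.congr (a₂.1 0 (by decide)) (a₂.1 1 (by decide)) (a₂.2 0 (by decide)))
      (fun s' hs' => by
        rw [NExp.eval_var, hs'.1 y (by simpa using hy), a₂.1 y (by simp), ha]) h13

/-- No closed walk is cheap enough for the component it starts in. -/
def Stable (G : Instance (Fin n)) (g : Fin n → ℕ) (ℓ θ : Fin n → ℝ) : Prop :=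
  ∀ a b ta tb, g ta = g a → g tb = g b → (∀ v, g v = g a → ℓ v ≤ ℓ ta) →
    (∀ v, g v = g b → ℓ v ≤ ℓ tb) → g a ≠ g b → ℓ ta ≤ ℓ tb → ¬ Linked G a b (θ ta)

/-- Add a closed walk that is cheap enough, if there is one. -/
def walkC : Cmd :=
  argmaxC 13 7 16 ;;
  findC (thresholdC (.var 26)) (.and (.natLe (.const 1) (.get 1 (.var 26) (.var 27)))
    (.and (.not (.natEq (.at 13 (.var 26)) (.at 13 (.var 27))))
      (.and (.realLe (.at 7 (.at 16 (.at 13 (.var 26)))) (.at 7 (.at 16 (.at 13 (.var 27)))))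
        (.realLe (.add (.get 0 (.var 26) (.var 27)) (.get 12 (.var 0) (.var 27))) (.var 13))))) ;;
  ite (.natLe (.const 1) (.var 28)) (thresholdC (.var 29) ;; traceC ;; compC 12 13) skip

/-- The two alternatives make `n` passes sufficient: a pass that does not end in a stable state
merges classes. The clause that the state was unstable before shows that stability, once reached,
persists. -/
theorem den_walkC {G : Instance (Fin n)} {s : Store} (hG : HasGraph G s) {ℓ : Fin n → ℝ}
    (hℓ : ∀ v : Fin n, s.real 7 v 0 = ℓ v) {δ α κ : ℝ} (hδ : s.real 5 0 0 = δ)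
    (hα : s.real 2 0 0 = α) (hακ : ∀ v, 3 * α * max (ℓ v) δ = κ * max (ℓ v) δ) (hκ : 0 ≤ κ)
    (hℓ0 : ∀ v, 0 ≤ ℓ v) {E C : Fin n → Fin n → ℕ} {ψ : Fin n → ℝ}
    (hW : WalkState G E C ψ (fun v => max (ℓ v) δ) κ (s.mat n 12) (s.vec n 13)) :
    WalkState G E C ψ (fun v => max (ℓ v) δ) κ ((walkC.den s).mat n 12) ((walkC.den s).vec n 13) ∧
    (Stable G ((walkC.den s).vec n 13) ℓ (fun v => κ * max (ℓ v) δ) ∨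
      ¬ Stable G (s.vec n 13) ℓ (fun v => κ * max (ℓ v) δ) ∧
      (Finset.univ.image ((walkC.den s).vec n 13)).card < (Finset.univ.image (s.vec n 13)).card) := by
  unfold walkC
  simp only [den_seq]
  set s₁ := (argmaxC 13 7 16).den s with hs₁
  have a₁ : AgreeOff [21, 16] [] s s₁ := (den_agree _ _).mono (by decide) (by decide)
  obtain ⟨top, htop⟩ : ∃ top : Fin n → Fin n, ∀ v : Fin n, s₁.nat 16 (s.nat 13 v 0) 0 = top v ∧
      s.nat 13 (top v) 0 = s.nat 13 v 0 ∧
      ∀ u : Fin n, s.nat 13 u 0 = s.nat 13 v 0 → s.real 7 u 0 ≤ s.real 7 (top v) 0 :=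
    den_argmaxC hG.size (by decide)
  have hG₁ : HasGraph G s₁ := hG.congr (a₁.1 0 (by decide)) (a₁.1 1 (by decide)) (a₁.2 0 (by decide))
  have e13 : s₁.nat 13 = s.nat 13 := a₁.1 13 (by decide)
  set cond : BExp := .and (.natLe (.const 1) (.get 1 (.var 26) (.var 27)))
    (.and (.not (.natEq (.at 13 (.var 26)) (.at 13 (.var 27))))
      (.and (.realLe (.at 7 (.at 16 (.at 13 (.var 26)))) (.at 7 (.at 16 (.at 13 (.var 27)))))
        (.realLe (.add (.get 0 (.var 26) (.var 27)) (.get 12 (.var 0) (.var 27))) (.var 13)))) with hcond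
  have a₂ : AgreeOff [26, 27, 28, 29, 30, 14, 20, 21, 22] [12, 13, 14] s₁
      ((findC (thresholdC (.var 26)) cond).den s₁) := (den_agree _ _).mono (by decide) (by decide)
  have hfind := den_findC (s := s₁) hG₁.size (pre := thresholdC (.var 26)) (cond := cond)
    (by decide) (by decide)
    (P := fun a b => s.vec n 13 a ≠ s.vec n 13 b ∧ ℓ (top a) ≤ ℓ (top b) ∧
      Linked G a b (κ * max (ℓ (top a)) δ)) (by
      intro a b s' ha hb hs'
      have hs'' : AgreeOff [26, 27, 28, 29, 30, 14, 20, 21, 22] [12, 13, 14] s₁ s' :=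
        hs'.mono (by decide) (by decide)
      have hG' : HasGraph G s' := hG₁.congr (hs''.1 0 (by decide)) (hs''.1 1 (by decide))
        (hs''.2 0 (by decide))
      have h16 : s'.nat 16 = s₁.nat 16 := hs''.1 16 (by decide)
      have h13 : s'.nat 13 = s.nat 13 := by rw [hs''.1 13 (by decide), e13]
      have h7 : s'.real 7 = s.real 7 := by rw [hs''.2 7 (by decide), a₁.2 7 (by decide)]
      have h2 : s'.real 2 0 0 = α := by rw [hs''.2 2 (by decide), a₁.2 2 (by decide), hα]
      have h5 : s'.real 5 0 0 = δ := by rw [hs''.2 5 (by decide), a₁.2 5 (by decide), hδ]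
      obtain ⟨t1, t2⟩ := den_thresholdC hG' (y := 26) (by decide) ha
        (by rw [h16, h13, (htop a).1]) (ℓ := ℓ (top a)) (by rw [h7, hℓ])
      rw [h2, h5, hακ] at t1 t2
      rw [t2.linked_iff]
      have a₃ : AgreeOff [14, 20, 21, 22] [12, 13, 14] s' ((thresholdC (.var 26)).den s') :=
        (den_agree _ _).mono (by decide) (by decide)
      simp only [hcond, BExp.holds_and, BExp.holds_natLe, NExp.eval_const, NExp.eval_get,
        NExp.eval_var, BExp.holds_not, BExp.holds_natEq, NExp.eval_at, BExp.holds_realLe,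
        RExp.eval_at, RExp.eval_add, RExp.eval_get, RExp.eval_var, a₃.1 1 (by decide),
        a₃.1 26 (by decide), a₃.1 27 (by decide), a₃.1 13 (by decide), a₃.1 16 (by decide),
        a₃.1 0 (by decide), a₃.2 7 (by decide), a₃.2 0 (by decide), t1, ha, hb, h16, h13, h7,
        (htop a).1, (htop b).1, hℓ, hG'.size, hG'.adj, hG'.weight, Store.vec]
      tauto)
  set s₂ := (findC (thresholdC (.var 26)) cond).den s₁ with hs₂
  have e12 : s₂.nat 12 = s.nat 12 := by rw [a₂.1 12 (by decide), a₁.1 12 (by decide)]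
  have e13' : s₂.nat 13 = s.nat 13 := by rw [a₂.1 13 (by decide), e13]
  have hm12 : s₂.mat n 12 = s.mat n 12 := by unfold Store.mat; rw [e12]
  have hv13 : s₂.vec n 13 = s.vec n 13 := by unfold Store.vec; rw [e13']
  rcases hfind with ⟨hf, a, b, ⟨hab, hle, hlink⟩, ha, hb⟩ | ⟨hf, hno⟩
  · rw [den_ite_pos _ _ (by simp [hf])]
    simp only [den_seq]
    have hG₂ : HasGraph G s₂ := hG₁.congr (a₂.1 0 (by decide)) (a₂.1 1 (by decide))
      (a₂.2 0 (by decide))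
    have h7 : s₂.real 7 = s.real 7 := by rw [a₂.2 7 (by decide), a₁.2 7 (by decide)]
    have h2 : s₂.real 2 0 0 = α := by rw [a₂.2 2 (by decide), a₁.2 2 (by decide), hα]
    have h5 : s₂.real 5 0 0 = δ := by rw [a₂.2 5 (by decide), a₁.2 5 (by decide), hδ]
    -- The search leaves the distances for the last pair tried, so the table for the vertex found is
    -- computed again.
    obtain ⟨-, t2⟩ := den_thresholdC hG₂ (y := 29) (by decide) ha
      (by rw [a₂.1 16 (by decide), e13', (htop a).1]) (ℓ := ℓ (top a)) (by rw [h7, hℓ])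
    rw [h2, h5, hακ] at t2
    set s₃ := (thresholdC (.var 29)).den s₂ with hs₃
    have a₃ : AgreeOff [14, 20, 21, 22] [12, 13, 14] s₂ s₃ := (den_agree _ _).mono (by decide) (by decide)
    have hn₃ : s₃.nat 0 0 0 = n := by rw [a₃.1 0 (by decide), hG₂.size]
    obtain ⟨Z, r, hZ, hr, hmat⟩ := den_traceC hn₃ (by rw [a₃.1 29 (by decide), ha])
      (by rw [a₃.1 30 (by decide), hb]) t2 hlink
    have hm12' : s₃.mat n 12 = s.mat n 12 := by
      rw [← hm12]; unfold Store.mat; rw [a₃.1 12 (by decide)]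
    rw [hm12'] at hmat
    set s₄ := traceC.den s₃ with hs₄
    have hn₄ : s₄.nat 0 0 0 = n := by rw [hs₄, den_nat _ _ (by decide), hn₃]
    obtain ⟨g1, -⟩ := den_compC (n := n) (s := s₄) hn₄ (src := 12) (dst := 13) (by decide) (by decide)
    have hm : ((compC 12 13).den s₄).mat n 12 = fun u v => s.mat n 12 u v + Z u v := by
      rw [← hmat]; unfold Store.mat; rw [den_nat _ _ (by decide)]
    rw [hmat] at g1
    rw [hm]
    obtain ⟨w1, w2⟩ := hW.step hκ (fun v => (hℓ0 v).trans (le_max_left _ _)) hab (htop a).2.1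
      (htop b).2.1 (fun v hv => max_le_max_right δ (by
        have := (htop a).2.2 v hv
        rwa [hℓ, hℓ] at this)) (max_le_max_right δ hle) hZ hr g1
    refine ⟨w1, Or.inr ⟨fun hst => ?_, w2⟩⟩
    have hmax : ∀ a v, s.vec n 13 v = s.vec n 13 a → ℓ v ≤ ℓ (top a) := fun a v hv => by
      have := (htop a).2.2 v hv
      rwa [hℓ, hℓ] at this
    exact hst a b (top a) (top b) (htop a).2.1 (htop b).2.1 (hmax a) (hmax b) hab hle hlink
  · rw [den_ite_neg _ _ (by simp [hf]), den_skip, hm12, hv13]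
    refine ⟨hW, Or.inl ?_⟩
    intro a b ta tb hta htb hmaxa hmaxb hab hle hlink
    have ha : ℓ ta = ℓ (top a) := le_antisymm (by
      have := (htop a).2.2 ta hta
      rwa [hℓ, hℓ] at this) (hmaxa _ (htop a).2.1)
    have hb : ℓ tb = ℓ (top b) := le_antisymm (by
      have := (htop b).2.2 tb htb
      rwa [hℓ, hℓ] at this) (hmaxb _ (htop b).2.1)
    exact hno a b ⟨hab, by rw [← ha, ← hb]; exact hle, by rw [← ha]; exact hlink⟩

end ATSP

/-! ### The program for one merging step -/

namespace ATSP

open Cmd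

variable {n : ℕ}

/-- Add the crossing components and cheap closed walks to the multigraph in the array `7`, and keep
the result on a component of least value. -/
def mergeC : Cmd :=
  each 20 (each 21 (ite (.natLe (.const 1) (.at 10 (.at 9 (.var 20))))
    (nset 12 (.var 20) (.var 21) (.add (.get 7 (.var 20) (.var 21)) (.get 4 (.var 20) (.var 21))))
    (nset 12 (.var 20) (.var 21) (.get 7 (.var 20) (.var 21))))) ;;
  compC 12 13 ;;
  each 25 walkC ;;
  argmaxC 13 7 16 ;;
  nset 36 (.const 0) (.const 0) (.const 0) ;;
  each 21 (ite (.realLe (.at 7 (.at 16 (.at 13 (.var 21)))) (.at 7 (.at 16 (.at 13 (.var 36)))))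
    (nset 36 (.const 0) (.const 0) (.var 21)) skip) ;;
  each 20 (each 21 (ite (.natEq (.at 13 (.var 20)) (.at 13 (.var 36)))
    (nset 7 (.var 20) (.var 21) (.get 12 (.var 20) (.var 21))) skip)) ;;
  compC 7 8

/-- The program follows `MergeState.commit`: the array 12 holds `W` with labels in 13, and a scan
over the vertices finds a component of least top value, represented by the vertex in the array 36.
Comparing `ℓ` is enough because the maximum with `δ` is monotone. -/
theorem den_mergeC {G : Instance (Fin n)} {s : Store} (hG : HasGraph G s) {lb : Fin n → ℝ}
    (hlb : ∀ v, 0 ≤ lb v) {top : Fin n → Fin n}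
    (hch : IsCharged lb (s.vec n 6) (s.vec n 8) (s.mat n 4) top s) {δ α κ γ base : ℝ}
    (hδ : s.real 5 0 0 = δ) (hα : s.real 2 0 0 = α) {m : ℕ → ℝ}
    (hm : ∀ j, m j = max (∑ u with s.vec n 6 u = j, lb u) δ)
    (hακ : ∀ j, 3 * α * m j = κ * m j) (hκ : 0 ≤ κ)
    (hE : MergeState G (s.vec n 6) m κ γ base (s.mat n 7) (s.vec n 8)) {ind : ℕ → ℕ}
    (hF : IsCheap G (s.vec n 6) (s.vec n 8) m κ γ (s.mat n 4) (s.vec n 9) (s.crossed n) ind) :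
    MergeState G (s.vec n 6) m κ γ base ((mergeC.den s).mat n 7) ((mergeC.den s).vec n 8) ∧
    (Finset.univ.image ((mergeC.den s).vec n 8)).card < (Finset.univ.image (s.vec n 8)).card ∧
    ∀ v, (mergeC.den s).vec n 8 v < n := by
  have hne : Nonempty (Fin n) := G.nonempty
  have hn0 : 0 < n := Fin.pos_iff_nonempty.2 hne
  set h := s.vec n 6 with hh
  set ℓ : Fin n → ℝ := fun v => ∑ u with h u = h v, lb u with hℓdef
  have hℓ0 : ∀ v, 0 ≤ ℓ v := fun v => Finset.sum_nonneg fun u _ => hlb u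
  have hmℓ : ∀ v, m (h v) = max (ℓ v) δ := fun v => hm _
  obtain ⟨ψ, Ch, hCh, hcred, hbase, hclosed⟩ := hE.credit
  unfold mergeC
  simp only [den_seq]
  set s₁ := (each 20 (each 21 (ite (.natLe (.const 1) (.at 10 (.at 9 (.var 20))))
    (nset 12 (.var 20) (.var 21) (.add (.get 7 (.var 20) (.var 21)) (.get 4 (.var 20) (.var 21))))
    (nset 12 (.var 20) (.var 21) (.get 7 (.var 20) (.var 21)))))).den s with hs₁
  have a₁ : AgreeOff [20, 21, 12] [] s s₁ := (den_agree _ _).mono (by decide) (by decide)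
  have h1 : s₁.mat n 12 = fun u v => s.mat n 7 u v + markedPart (s.mat n 4) (s.crossed n) u v := by
    funext u v
    have := den_each_each (s := s) hG.size (dst := 12) (c := ite (.natLe (.const 1) (.at 10 (.at 9 (.var 20))))
      (nset 12 (.var 20) (.var 21) (.add (.get 7 (.var 20) (.var 21)) (.get 4 (.var 20) (.var 21))))
      (nset 12 (.var 20) (.var 21) (.get 7 (.var 20) (.var 21)))) (by decide) (by decide)
      (fun u v => s.nat 7 u v + if 1 ≤ s.nat 10 (s.nat 9 u 0) 0 then s.nat 4 u v else 0) (by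
        intro u v hu hv s' hu' hv' hs' _ i j
        have e10 := hs'.1 10 (by decide)
        have e9 := hs'.1 9 (by decide)
        have e7 := hs'.1 7 (by decide)
        have e4 := hs'.1 4 (by decide)
        by_cases hc : 1 ≤ s.nat 10 (s.nat 9 u 0) 0
        · rw [den_ite_pos _ _ (by simpa [e10, e9, hu'] using hc)]
          simp only [den_nset, NExp.eval_var, NExp.eval_add, NExp.eval_get, hu', hv', e7, e4,
            Store.setNat_nat_same, hc, if_true]
        · rw [den_ite_neg _ _ (by simpa [e10, e9, hu'] using hc)]
          simp only [den_nset, NExp.eval_var, NExp.eval_get, hu', hv', e7,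
            Store.setNat_nat_same, hc, if_false, add_zero]) u v u.2 v.2
    simp only [Store.mat, hs₁, this, markedPart, Store.crossed_iff]
  have hn₁ : s₁.nat 0 0 0 = n := by rw [a₁.1 0 (by decide), hG.size]
  obtain ⟨g1, -⟩ := den_compC (s := s₁) hn₁ (src := 12) (dst := 13) (by decide) (by decide)
  set s₂ := (compC 12 13).den s₁ with hs₂
  have a₂ : AgreeOff [12, 13, 20, 21, 22, 23, 24] [] s s₂ := (a₁.mono (by decide) (by decide)).trans
    ((den_agree _ _).mono (by decide) (by decide))
  have h2 : s₂.mat n 12 = s₁.mat n 12 := by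
    unfold Store.mat; rw [hs₂, den_nat _ _ (by decide)]
  have hW₂ : WalkState G (s.mat n 7) (markedPart (s.mat n 4) (s.crossed n)) ψ
      (fun v => max (ℓ v) δ) κ (s₂.mat n 12) (s₂.vec n 13) := by
    rw [h1] at g1
    rw [h2, h1]
    exact WalkState.init hE.eulerian hF.eulerian_marked hE.labeling g1 hκ
      (fun v => (hℓ0 v).trans (le_max_left _ _)) (fun t => by rw [← hmℓ]; exact hcred t)
  have hG₂ : HasGraph G s₂ := hG.congr (a₂.1 0 (by decide)) (a₂.1 1 (by decide)) (a₂.2 0 (by decide))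
  have em : ∀ t : Store, ∀ i, (t.setNat 25 0 0 i).mat n 12 = t.mat n 12 := fun t i => by
    unfold Store.mat; rw [Store.setNat_nat_of_ne _ _ _ _ (by decide)]
  have ev : ∀ t : Store, ∀ i, (t.setNat 25 0 0 i).vec n 13 = t.vec n 13 := fun t i => by
    unfold Store.vec; rw [Store.setNat_nat_of_ne _ _ _ _ (by decide)]
  have hwalk := den_each (x := 25) (c := walkC) (by decide) s₂
    (fun k s' => WalkState G (s.mat n 7) (markedPart (s.mat n 4) (s.crossed n)) ψ
      (fun v => max (ℓ v) δ) κ (s'.mat n 12) (s'.vec n 13) ∧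
      (Stable G (s'.vec n 13) ℓ (fun v => κ * max (ℓ v) δ) ∨
        (Finset.univ.image (s'.vec n 13)).card + k ≤ n)) (by
      rw [em, ev]
      refine ⟨hW₂, Or.inr ?_⟩
      have : (Finset.univ.image (s₂.vec n 13)).card ≤ (Finset.univ : Finset (Fin n)).card :=
        Finset.card_image_le
      simpa using this) (by
      intro k s' hk hk' hs' hP
      have hG' : HasGraph G s' := hG₂.congr (hs'.1 0 (by decide)) (hs'.1 1 (by decide))
        (hs'.2 0 (by decide))
      rw [em, ev]
      obtain ⟨w1, w2⟩ := den_walkC hG' (ℓ := ℓ)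
        (fun v => by rw [hs'.2 7 (by decide), a₂.2 7 (by decide), hch.value v])
        (by rw [hs'.2 5 (by decide), a₂.2 5 (by decide), hδ])
        (by rw [hs'.2 2 (by decide), a₂.2 2 (by decide), hα])
        (fun v => by rw [← hmℓ]; exact hακ _) hκ hℓ0 hP.1
      refine ⟨w1, w2.imp_right fun h => ?_⟩
      have := hP.2.resolve_left h.1
      omega)
  have a₃ : AgreeOff [25, 12, 13, 14, 16, 20, 21, 22, 23, 24, 26, 27, 28, 29, 30, 37, 38]
      [12, 13, 14] s ((each 25 walkC).den s₂) := (a₂.mono (by decide) (by decide)).trans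
    ((den_agree _ _).mono (by decide) (by decide))
  set s₃ := (each 25 walkC).den s₂ with hs₃
  rw [hG₂.size] at hwalk
  obtain ⟨hW₃, hst⟩ := hwalk
  -- After `n` passes the other alternative would leave no class at all.
  replace hst := hst.resolve_right fun hle => by
    have := (Finset.univ_nonempty.image (s₃.vec n 13)).card_pos
    omega
  have hn₃ : s₃.nat 0 0 0 = n := by rw [a₃.1 0 (by decide), hG.size]
  obtain ⟨top', htop⟩ := den_argmaxC (s := s₃) hn₃ (key := 13) (val := 7) (dst := 16) (by decide)
  set s₄ := (argmaxC 13 7 16).den s₃ with hs₄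
  have h7₃ : ∀ v : Fin n, s₃.real 7 v 0 = ℓ v := fun v => by
    rw [a₃.2 7 (by decide), hch.value v]
  simp only [h7₃] at htop
  set s₅ := (nset 36 (.const 0) (.const 0) (.const 0)).den s₄ with hs₅
  have a₅ : AgreeOff [16, 21, 36] [] s₃ s₅ := ((den_agree _ _).mono (by decide) (by decide)).trans
    ((den_agree _ _).mono (by decide) (by decide))
  have h16₅ : s₅.nat 16 = s₄.nat 16 := den_nat _ _ (by decide)
  have h36₅ : s₅.nat 36 0 0 = 0 := by simp [hs₅]
  have hn₅ : s₅.nat 0 0 0 = n := by rw [a₅.1 0 (by decide), hn₃]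
  have hmin := den_each (x := 21)
    (c := ite (.realLe (.at 7 (.at 16 (.at 13 (.var 21)))) (.at 7 (.at 16 (.at 13 (.var 36)))))
      (nset 36 (.const 0) (.const 0) (.var 21)) skip) (by decide) s₅
    (fun k s' => ∃ t : Fin n, s'.nat 36 0 0 = t ∧ ∀ v : Fin n, (v : ℕ) < k →
      ℓ (top' t) ≤ ℓ (top' v))
    ⟨⟨0, hn0⟩, by rw [Store.setNat_nat_of_ne _ _ _ _ (by decide), h36₅], by simp⟩ (by
      rintro k s' hk hk' hs' ⟨t, ht, hP⟩
      rw [hn₅] at hk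
      rw [Store.setNat_nat_of_ne _ _ _ _ (by decide)]
      have e16 : s'.nat 16 = s₄.nat 16 := by rw [hs'.1 16 (by decide), h16₅]
      have e13 : s'.nat 13 = s₃.nat 13 := by rw [hs'.1 13 (by decide), a₅.1 13 (by decide)]
      have e7 : s'.real 7 = s₃.real 7 := by rw [hs'.2 7 (by decide), a₅.2 7 (by decide)]
      have hk1 : s₄.nat 16 (s₃.nat 13 k 0) 0 = top' ⟨k, hk⟩ := (htop ⟨k, hk⟩).1
      by_cases hle : ℓ (top' ⟨k, hk⟩) ≤ ℓ (top' t)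
      · rw [den_ite_pos _ _ (by simpa [hk', ht, e16, e13, e7, hk1, (htop t).1, h7₃] using hle)]
        refine ⟨⟨k, hk⟩, by simp [hk'], fun v hv => ?_⟩
        by_cases hvk : (v : ℕ) = k
        · have : v = ⟨k, hk⟩ := Fin.ext hvk
          rw [this]
        · exact hle.trans (hP v (by omega))
      · rw [den_ite_neg _ _ (by simpa [hk', ht, e16, e13, e7, hk1, (htop t).1, h7₃] using hle)]
        refine ⟨t, ht, fun v hv => ?_⟩
        by_cases hvk : (v : ℕ) = k
        · have : v = ⟨k, hk⟩ := Fin.ext hvk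
          rw [this]
          exact le_of_not_ge hle
        · exact hP v (by omega))
  set s₆ := (each 21 (ite (.realLe (.at 7 (.at 16 (.at 13 (.var 21)))) (.at 7 (.at 16 (.at 13 (.var 36)))))
    (nset 36 (.const 0) (.const 0) (.var 21)) skip)).den s₅ with hs₆
  have a₆ : AgreeOff [16, 21, 36] [] s₃ s₆ := a₅.trans ((den_agree _ _).mono (by decide) (by decide))
  have hn₆ : s₆.nat 0 0 0 = n := by rw [a₆.1 0 (by decide), hn₃]
  rw [hn₅] at hmin
  obtain ⟨z, hz, hzmin⟩ := hmin
  set s₇ := (each 20 (each 21 (ite (.natEq (.at 13 (.var 20)) (.at 13 (.var 36)))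
    (nset 7 (.var 20) (.var 21) (.get 12 (.var 20) (.var 21))) skip))).den s₆ with hs₇
  have h7 : s₇.mat n 7 = ATSP.commit (s.mat n 7) (s₃.mat n 12) (s₃.vec n 13) z := by
    funext u v
    have := den_each_each (s := s₆) hn₆ (dst := 7)
      (c := ite (.natEq (.at 13 (.var 20)) (.at 13 (.var 36)))
        (nset 7 (.var 20) (.var 21) (.get 12 (.var 20) (.var 21))) skip) (by decide) (by decide)
      (fun u v => if s₃.nat 13 u 0 = s₃.nat 13 z 0 then s₃.nat 12 u v else s.nat 7 u v) (by
        intro u v hu hv s' hu' hv' hs' hold i j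
        have e13 : s'.nat 13 = s₃.nat 13 := by rw [hs'.1 13 (by decide), a₆.1 13 (by decide)]
        have e12 : s'.nat 12 = s₃.nat 12 := by rw [hs'.1 12 (by decide), a₆.1 12 (by decide)]
        have e36 : s'.nat 36 0 0 = z := by rw [hs'.1 36 (by decide), hz]
        rw [a₆.1 7 (by decide), a₃.1 7 (by decide)] at hold
        by_cases hc : s₃.nat 13 u 0 = s₃.nat 13 z 0
        · rw [den_ite_pos _ _ (by simpa [e13, e36, hu'] using hc)]
          simp only [den_nset, NExp.eval_var, NExp.eval_get, hu', hv', e12, Store.setNat_nat_same,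
            hc, if_true]
        · rw [den_ite_neg _ _ (by simpa [e13, e36, hu'] using hc), den_skip]
          simp only [hc, if_false]
          split_ifs with hij
          · rw [hij.1, hij.2, hold]
          · rfl) u v u.2 v.2
    exact this
  have hn₇ : s₇.nat 0 0 0 = n := by rw [hs₇, den_nat _ _ (by decide), hn₆]
  obtain ⟨l1, l2⟩ := den_compC (s := s₇) hn₇ (src := 7) (dst := 8) (by decide) (by decide)
  have h7' : ((compC 7 8).den s₇).mat n 7 = s₇.mat n 7 := by
    unfold Store.mat; rw [den_nat _ _ (by decide)]
  rw [h7']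
  rw [h7] at l1 ⊢
  have hW : WalkState G (s.mat n 7) (markedPart (s.mat n 4) (s.crossed n)) ψ
      (fun v => m (h v)) κ (s₃.mat n 12) (s₃.vec n 13) := by
    simp only [hmℓ]; exact hW₃
  obtain ⟨c1, c2⟩ := MergeState.commit hF hκ hE.eulerian hE.labeling hE.coarser hCh hcred hbase hclosed
    hW (s := z) (M := m (h (top' z))) (fun v hv => by
      rw [hmℓ, hmℓ]; exact max_le_max_right δ ((htop z).2.2 v hv)) (fun a b ha hb => by
      rw [hmℓ]
      exact hst a b (top' z) (top' b) ((htop z).2.1.trans ha.symm) (htop b).2.1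
        (fun v hv => (htop z).2.2 v (hv.trans ha)) (htop b).2.2 (by rw [ha]; exact hb.symm)
        (hzmin b b.2)) l1
  exact ⟨c1, c2, l2⟩

end ATSP

/-! ### The program for a replacement -/

namespace ATSP

open Cmd

variable {n : ℕ}

/-- Start the merging procedure with the multigraph in the array `5`. -/
def restartC : Cmd :=
  compC 5 6 ;;
  each 20 (each 21 (nset 7 (.var 20) (.var 21) (.get 5 (.var 20) (.var 21)))) ;;
  compC 7 8

theorem den_restartC {s : Store} (hn : s.nat 0 0 0 = n) :
    IsLabeling (s.mat n 5) ((restartC.den s).vec n 6) ∧ (∀ v, (restartC.den s).vec n 6 v < n) ∧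
    (restartC.den s).mat n 5 = s.mat n 5 ∧ (restartC.den s).mat n 7 = s.mat n 5 ∧
    IsLabeling (s.mat n 5) ((restartC.den s).vec n 8) ∧ ∀ v, (restartC.den s).vec n 8 v < n := by
  unfold restartC
  simp only [den_seq]
  obtain ⟨h1, h2⟩ := den_compC (s := s) hn (src := 5) (dst := 6) (by decide) (by decide)
  set s₁ := (compC 5 6).den s with hs₁
  have a₁ : AgreeOff [6, 20, 21, 22, 23, 24] [] s s₁ := (den_agree _ _).mono (by decide) (by decide)
  have hn₁ : s₁.nat 0 0 0 = n := by rw [a₁.1 0 (by decide), hn]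
  have h7 := den_each_each (s := s₁) hn₁ (dst := 7)
    (c := nset 7 (.var 20) (.var 21) (.get 5 (.var 20) (.var 21))) (by decide) (by decide)
    (fun u v => s.nat 5 u v) (by
      intro u v hu hv s' hu' hv' hs' _ i j
      simp only [den_nset, NExp.eval_var, NExp.eval_get, hu', hv', Store.setNat_nat_same,
        hs'.1 5 (by decide), a₁.1 5 (by decide)])
  set s₂ := (each 20 (each 21 (nset 7 (.var 20) (.var 21) (.get 5 (.var 20) (.var 21))))).den s₁
    with hs₂
  have a₂ : AgreeOff [7, 20, 21] [] s₁ s₂ := (den_agree _ _).mono (by decide) (by decide)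
  have hn₂ : s₂.nat 0 0 0 = n := by rw [a₂.1 0 (by decide), hn₁]
  have hm7 : s₂.mat n 7 = s.mat n 5 := by
    funext u v
    exact h7 u v u.2 v.2
  obtain ⟨h3, h4⟩ := den_compC (s := s₂) hn₂ (src := 7) (dst := 8) (by decide) (by decide)
  have a₃ : AgreeOff [8, 20, 21, 22, 23, 24] [] s₂ ((compC 7 8).den s₂) :=
    (den_agree _ _).mono (by decide) (by decide)
  have e6 : ((compC 7 8).den s₂).vec n 6 = s₁.vec n 6 := by
    unfold Store.vec; rw [a₃.1 6 (by decide), a₂.1 6 (by decide)]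
  have e5 : ((compC 7 8).den s₂).mat n 5 = s.mat n 5 := by
    unfold Store.mat; rw [a₃.1 5 (by decide), a₂.1 5 (by decide), a₁.1 5 (by decide)]
  have e7 : ((compC 7 8).den s₂).mat n 7 = s.mat n 5 := by
    rw [← hm7]; unfold Store.mat; rw [a₃.1 7 (by decide)]
  rw [e6, e5, e7]
  exact ⟨h1, h2, rfl, rfl, hm7 ▸ h3, h4⟩

/-- The vertex `v` is in a crossing component that is charged to the component `32`. -/
def chargedB (v : NExp) : BExp :=
  .and (.natLe (.const 1) (.at 10 (.at 9 v))) (.natEq (.at 6 (.at 11 (.at 9 v))) (.var 32))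

/-- The component `l` is the component `32` or it is met and between `p` and `q`. -/
def keptB (p q : ℕ) (l : NExp) : BExp :=
  .or (.natEq l (.var 32))
    (.and (.natLe (.const 1) (.at 15 l)) (.and (.natLe (.var p) l) (.natLe l (.var q))))

/-- The meaning of `chargedB`. -/
theorem holds_chargedB {s s' : Store} {h L : Fin n → ℕ} {F : Fin n → Fin n → ℕ} {lb : Fin n → ℝ}
    {top : Fin n → Fin n} (hch : IsCharged lb h L F top s) (hh : h = s.vec n 6) {N R : List ℕ}
    (ha : AgreeOff N R s s') (hN : ∀ a ∈ [6, 9, 10, 11], a ∉ N) {j : ℕ} (hj : s'.nat 32 0 0 = j)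
    {e : NExp} {v : Fin n} (he : e.eval s' = v) :
    (chargedB e).Holds s' ↔ s.crossed n v = true ∧ h (top v) = j := by
  simp only [chargedB, BExp.holds_and, BExp.holds_natLe, BExp.holds_natEq, NExp.eval_at,
    NExp.eval_const, NExp.eval_var, he, hj, ha.1 9 (hN 9 (by simp)), ha.1 10 (hN 10 (by simp)),
    ha.1 11 (hN 11 (by simp)), ha.1 6 (hN 6 (by simp)), hch.top_eq, Store.crossed_iff, hh, Store.vec]

/-- Find the components that are kept when the components that are met by the crossing components
charged to the component `29` are replaced. -/
def chooseC : Cmd :=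
  nset 32 (.const 0) (.const 0) (.var 29) ;;
  markC 15 (chargedB (.var 21)) (.at 6 (.var 21)) ;;
  scatterC 9 (.natLe (.const 1) (.at 15 (.at 6 (.var 21)))) (.const 0) (.at 4 (.var 21)) ;;
  maxC 14 (.at 6 (.var 32)) (.var 5) ;;
  findC (scatterC 10 (keptB 26 27 (.at 6 (.var 21))) (.const 0) (.at 4 (.var 21)) ;;
      scatterC 11 (.and (chargedB (.var 21)) (keptB 26 27 (.at 6 (.var 21)))) (.const 0)
        (.at 4 (.var 21)))
    (.and (.realLe (.mul (.const 3) (.var 11)) (.mul (.const 2) (.at 8 (.var 32))))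
      (.realLe (.add (.mul (.at 6 (.var 32)) (.var 9)) (.mul (.var 14) (.var 14)))
        (.mul (.sub (.add (.var 10) (.at 8 (.var 32))) (.var 11))
          (.sub (.add (.var 10) (.at 8 (.var 32))) (.var 11)))))

/-- Replace the components that are not kept by crossing components. -/
def replaceC : Cmd :=
  each 20 (each 21 (nset 39 (.const 0) (.const 0) (.const 0) ;;
    ite (chargedB (.var 20)) (nset 39 (.const 0) (.const 0) (.get 4 (.var 20) (.var 21))) skip ;;
    ite (.or (keptB 29 30 (.at 6 (.var 20))) (.not (.natLe (.const 1) (.at 15 (.at 6 (.var 20))))))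
      (nset 5 (.var 20) (.var 21) (.add (.var 39) (.get 5 (.var 20) (.var 21))))
      (nset 5 (.var 20) (.var 21) (.var 39))))

/-- The components met by `Q` can be replaced, those with labels between `p` and `q` being kept. -/
def IsGoodInterval (lb : Fin n → ℝ) (h : Fin n → ℕ) (Q : Fin n → Prop) (I : ℕ → Prop)
    [DecidablePred Q] [DecidablePred I] (j : ℕ) (m : ℝ) (p q : ℕ) : Prop :=
  3 * ∑ v with (Q v ∧ (h v = j ∨ I (h v) ∧ p ≤ h v ∧ h v ≤ q)), lb v
    ≤ 2 * ∑ v with Q v, lb v ∧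
  (∑ u with h u = j, lb u) * (∑ v with I (h v), lb v) + m * m
    ≤ (∑ v with (h v = j ∨ I (h v) ∧ p ≤ h v ∧ h v ≤ q), lb v + ∑ v with Q v, lb v
        - ∑ v with (Q v ∧ (h v = j ∨ I (h v) ∧ p ≤ h v ∧ h v ≤ q)), lb v)
      * (∑ v with (h v = j ∨ I (h v) ∧ p ≤ h v ∧ h v ≤ q), lb v + ∑ v with Q v, lb v
        - ∑ v with (Q v ∧ (h v = j ∨ I (h v) ∧ p ≤ h v ∧ h v ≤ q)), lb v)

section Augment

variable {s : Store} {lb : Fin n → ℝ} {top : Fin n → Fin n}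
  {Q : Fin n → Prop} {I : ℕ → Prop} [DecidablePred Q] [DecidablePred I] {j : Fin n}

/-- All pairs of ends are tried, and `hex` ensures that the search succeeds. The real arrays 9, 10,
11 and 14 hold the `lb` of the met components, of the retained ones, of their overlap with `Q`, and
the value of `j` raised to `δ`. -/
theorem den_chooseC (hn : s.nat 0 0 0 = n) {h : Fin n → ℕ} (hhdef : h = s.vec n 6)
    (hlb4 : ∀ v : Fin n, s.real 4 v 0 = lb v) (hlt : ∀ v, h v < n)
    (hch : IsCharged lb (h) (s.vec n 8) (s.mat n 4) top s) {δ : ℝ}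
    (hδ : s.real 5 0 0 = δ) (hj : s.nat 29 0 0 = j)
    (hQ : ∀ v, Q v ↔ s.crossed n v = true ∧ h (top v) = j)
    (hI : ∀ l, I l ↔ ∃ v, Q v ∧ h v = l)
    (hex : ∃ p < n, ∃ q < n, IsGoodInterval lb (h) Q I j
      (max (∑ u with h u = j, lb u) δ) p q) :
    (chooseC.den s).nat 32 0 0 = j ∧ (∀ v, 1 ≤ (chooseC.den s).nat 15 (h v) 0 ↔ I (h v)) ∧
    IsGoodInterval lb (h) Q I j (max (∑ u with h u = j, lb u) δ)
      ((chooseC.den s).nat 29 0 0) ((chooseC.den s).nat 30 0 0) := by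
  have hn0 : 0 < n := (Nat.zero_le _).trans_lt j.2
  unfold chooseC
  simp only [den_seq]
  set s₁ := (nset 32 (.const 0) (.const 0) (.var 29)).den s with hs₁
  have a₁ : AgreeOff [32] [] s s₁ := (den_agree _ _).mono (by decide) (by decide)
  have h32₁ : s₁.nat 32 0 0 = j := by simp [hs₁, hj]
  have hn₁ : s₁.nat 0 0 0 = n := by rw [a₁.1 0 (by decide), hn]
  have hmark := den_markC (s := s₁) hn₁ (dst := 15) (by decide) (cond := chargedB (.var 21))
    (key := .at 6 (.var 21)) (C := fun _ v => Q v) (K := fun _ v => h v) (by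
      intro u v s' hu hv hs'
      refine ⟨(holds_chargedB hch hhdef ((a₁.mono (N' := [32, 20, 21, 15]) (R' := []) (by decide)
        (by decide)).trans (hs'.mono (by decide) (by decide))) (by decide)
        (by rw [hs'.1 32 (by decide), h32₁]) (by simpa using hv)).trans (hQ v).symm, ?_⟩
      rw [NExp.eval_at, NExp.eval_var, hv, hs'.1 6 (by decide), a₁.1 6 (by decide), hhdef]
      rfl)
  set s₂ := (markC 15 (chargedB (.var 21)) (.at 6 (.var 21))).den s₁ with hs₂
  have a₂ : AgreeOff [15, 20, 21, 32] [] s s₂ := (a₁.mono (by decide) (by decide)).trans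
    ((den_agree _ _).mono (by decide) (by decide))
  have h32₂ : s₂.nat 32 0 0 = j := by rw [hs₂, den_nat _ _ (by decide), h32₁]
  have hI15 : ∀ v : Fin n, 1 ≤ s₂.nat 15 (h v) 0 ↔ I (h v) := by
    intro v
    rw [hmark ⟨h v, hlt v⟩, hI]
    exact ⟨fun ⟨_, w, hw⟩ => ⟨w, hw⟩, fun ⟨w, hw⟩ => ⟨v, w, hw⟩⟩
  have hkept : ∀ (s' : Store) (e : NExp) (v : Fin n) (x y p q : ℕ), e.eval s' = h v →
      s'.nat 15 = s₂.nat 15 → s'.nat 32 0 0 = j → s'.nat x 0 0 = p → s'.nat y 0 0 = q →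
      ((keptB x y e).Holds s' ↔ (h v = j ∨ I (h v) ∧ p ≤ h v ∧ h v ≤ q)) := by
    intro s' e v x y p q he e15 e32 hx hy
    simp [keptB, he, e15, e32, hx, hy, hI15]
  have hn₂ : s₂.nat 0 0 0 = n := by rw [a₂.1 0 (by decide), hn]
  have hS := den_scatterC (s := s₂) hn₂ (a := 9)
    (cond := .natLe (.const 1) (.at 15 (.at 6 (.var 21)))) (key := .const 0) (val := .at 4 (.var 21))
    (C := fun v => I (h v)) (K := fun _ => 0) (X := lb) (by
      intro v s' hv hs'
      have e6 : s'.nat 6 v 0 = h v := by rw [hs'.1 6 (by decide), a₂.1 6 (by decide), hhdef]; rfl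
      refine ⟨?_, rfl, ?_⟩
      · simp only [BExp.holds_natLe, NExp.eval_const, NExp.eval_at, NExp.eval_var, hv, e6,
          hs'.1 15 (by decide), hI15]
      · simp only [RExp.eval_at, NExp.eval_var, hv, hs'.2 4 (by decide), a₂.2 4 (by decide), hlb4])
    0 hn0
  simp only [and_true] at hS
  set s₃ := (scatterC 9 (.natLe (.const 1) (.at 15 (.at 6 (.var 21)))) (.const 0)
    (.at 4 (.var 21))).den s₂ with hs₃
  have a₃ : AgreeOff [20, 21, 15, 32] [9] s s₃ := (a₂.mono (by decide) (by decide)).trans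
    ((den_agree _ _).mono (by decide) (by decide))
  have h32₃ : s₃.nat 32 0 0 = j := by rw [hs₃, den_nat _ _ (by decide), h32₂]
  set s₄ := (maxC 14 (.at 6 (.var 32)) (.var 5)).den s₃ with hs₄
  have hm14 : s₄.real 14 0 0 = max (∑ u with h u = j, lb u) δ := by
    rw [hs₄, den_maxC]
    simp [h32₃, a₃.2 5 (by decide), a₃.2 6 (by decide), hch.classValue j j.2, hδ]
  have a₄ : AgreeOff [20, 21, 15, 32] [9, 14] s s₄ := (a₃.mono (by decide) (by decide)).trans
    ((den_agree _ _).mono (by decide) (by decide))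
  have h32₄ : s₄.nat 32 0 0 = j := by rw [hs₄, den_nat _ _ (by decide), h32₃]
  have h15₄ : s₄.nat 15 = s₂.nat 15 := by
    rw [hs₄, den_nat _ _ (by decide), hs₃, den_nat _ _ (by decide)]
  have hS₄ : s₄.real 9 0 0 = ∑ v with I (h v), lb v := by
    rw [hs₄, den_real _ _ (by decide), hS]
  have hn₄ : s₄.nat 0 0 0 = n := by rw [a₄.1 0 (by decide), hn]
  have h6₄ : ∀ v : Fin n, s₄.nat 6 v 0 = h v := fun v => by rw [a₄.1 6 (by decide), hhdef]; rfl
  have hLam₄ : s₄.real 8 j 0 = ∑ v with Q v, lb v := by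
    rw [a₄.2 8 (by decide), hch.charge j j.2]
    simp only [hQ]
  have ha₄ : s₄.real 6 j 0 = ∑ u with h u = j, lb u := by
    rw [a₄.2 6 (by decide), hch.classValue j j.2]
  have hlb₄ : ∀ v : Fin n, s₄.real 4 v 0 = lb v := fun v => by rw [a₄.2 4 (by decide), hlb4]
  clear_value s₁ s₂ s₃ s₄
  set pre : Cmd := scatterC 10 (keptB 26 27 (.at 6 (.var 21))) (.const 0) (.at 4 (.var 21)) ;;
      scatterC 11 (.and (chargedB (.var 21)) (keptB 26 27 (.at 6 (.var 21)))) (.const 0)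
        (.at 4 (.var 21)) with hpre
  set cond : BExp := .and (.realLe (.mul (.const 3) (.var 11)) (.mul (.const 2) (.at 8 (.var 32))))
      (.realLe (.add (.mul (.at 6 (.var 32)) (.var 9)) (.mul (.var 14) (.var 14)))
        (.mul (.sub (.add (.var 10) (.at 8 (.var 32))) (.var 11))
          (.sub (.add (.var 10) (.at 8 (.var 32))) (.var 11)))) with hcond
  have hfind := den_findC (s := s₄) hn₄ (pre := pre) (cond := cond) (by decide) (by decide)
    (P := fun p q => IsGoodInterval lb h Q I j (max (∑ u with h u = j, lb u) δ) p q) (by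
      intro p q s' hp hq hs'
      have hs'' : AgreeOff [26, 27, 28, 29, 30, 21] [10, 11] s₄ s' := hs'.mono (by decide) (by decide)
      have hn' : s'.nat 0 0 0 = n := by rw [hs''.1 0 (by decide), hn₄]
      have hsum1 := den_scatterC (s := s') hn' (a := 10) (cond := keptB 26 27 (.at 6 (.var 21)))
        (key := .const 0) (val := .at 4 (.var 21))
        (C := fun v => h v = j ∨ I (h v) ∧ p ≤ h v ∧ h v ≤ q) (K := fun _ => 0) (X := lb) (by
          intro v t hv ht
          refine ⟨hkept t _ v 26 27 p q ?_ ?_ ?_ ?_ ?_, rfl, ?_⟩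
          · rw [NExp.eval_at, NExp.eval_var, hv, ht.1 6 (by decide), hs''.1 6 (by decide), h6₄]
          · rw [ht.1 15 (by decide), hs''.1 15 (by decide), h15₄]
          · rw [ht.1 32 (by decide), hs''.1 32 (by decide), h32₄]
          · rw [ht.1 26 (by decide), hp]
          · rw [ht.1 27 (by decide), hq]
          · rw [RExp.eval_at, NExp.eval_var, hv, ht.2 4 (by decide), hs''.2 4 (by decide), hlb₄])
        0 hn0
      simp only [and_true] at hsum1
      rw [hpre, den_seq]
      set t₁ := (scatterC 10 (keptB 26 27 (.at 6 (.var 21))) (.const 0) (.at 4 (.var 21))).den s'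
        with ht₁
      have b₁ : AgreeOff [21] [10] s' t₁ := (den_agree _ _).mono (by decide) (by decide)
      have hnt₁ : t₁.nat 0 0 0 = n := by rw [b₁.1 0 (by decide), hn']
      have hsum2 := den_scatterC (s := t₁) hnt₁ (a := 11)
        (cond := .and (chargedB (.var 21)) (keptB 26 27 (.at 6 (.var 21))))
        (key := .const 0) (val := .at 4 (.var 21))
        (C := fun v => Q v ∧ (h v = j ∨ I (h v) ∧ p ≤ h v ∧ h v ≤ q)) (K := fun _ => 0) (X := lb) (by
          intro v t hv ht
          have e32 : t.nat 32 0 0 = j := by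
            rw [ht.1 32 (by decide), b₁.1 32 (by decide), hs''.1 32 (by decide), h32₄]
          have hall : AgreeOff [26, 27, 28, 29, 30, 20, 21, 15, 32] [9, 14, 10, 11] s t :=
            ((a₄.mono (by decide) (by decide)).trans (hs''.mono (by decide) (by decide))).trans
              ((b₁.mono (by decide) (by decide)).trans (ht.mono (by decide) (by decide)))
          refine ⟨and_congr ((holds_chargedB hch hhdef hall (by decide) e32
            (by simpa using hv)).trans (hQ v).symm) (hkept t _ v 26 27 p q ?_ ?_ e32 ?_ ?_), rfl, ?_⟩
          · rw [NExp.eval_at, NExp.eval_var, hv, hall.1 6 (by decide), hhdef]; rfl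
          · rw [ht.1 15 (by decide), b₁.1 15 (by decide), hs''.1 15 (by decide), h15₄]
          · rw [ht.1 26 (by decide), b₁.1 26 (by decide), hp]
          · rw [ht.1 27 (by decide), b₁.1 27 (by decide), hq]
          · rw [RExp.eval_at, NExp.eval_var, hv, hall.2 4 (by decide), hlb4]) 0 hn0
      simp only [and_true] at hsum2
      set t₂ := (scatterC 11 (.and (chargedB (.var 21)) (keptB 26 27 (.at 6 (.var 21)))) (.const 0)
        (.at 4 (.var 21))).den t₁ with ht₂
      have b₂ : AgreeOff [21] [11] t₁ t₂ := (den_agree _ _).mono (by decide) (by decide)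
      have e10 : t₂.real 10 0 0 = ∑ v with (h v = j ∨ I (h v) ∧ p ≤ h v ∧ h v ≤ q), lb v := by
        rw [b₂.2 10 (by decide), hsum1]
      have e32 : t₂.nat 32 0 0 = j := by
        rw [b₂.1 32 (by decide), b₁.1 32 (by decide), hs''.1 32 (by decide), h32₄]
      have e8 : t₂.real 8 j 0 = ∑ v with Q v, lb v := by
        rw [b₂.2 8 (by decide), b₁.2 8 (by decide), hs''.2 8 (by decide), hLam₄]
      have e6 : t₂.real 6 j 0 = ∑ u with h u = j, lb u := by
        rw [b₂.2 6 (by decide), b₁.2 6 (by decide), hs''.2 6 (by decide), ha₄]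
      have e9 : t₂.real 9 0 0 = ∑ v with I (h v), lb v := by
        rw [b₂.2 9 (by decide), b₁.2 9 (by decide), hs''.2 9 (by decide), hS₄]
      have e14 : t₂.real 14 0 0 = max (∑ u with h u = j, lb u) δ := by
        rw [b₂.2 14 (by decide), b₁.2 14 (by decide), hs''.2 14 (by decide), hm14]
      simp only [hcond, BExp.holds_and, BExp.holds_realLe, RExp.eval_mul, RExp.eval_add,
        RExp.eval_sub, RExp.eval_const, RExp.eval_var, RExp.eval_at, NExp.eval_var, e32, e8, e6, e9,
        e10, e14, hsum2, Rat.cast_ofNat]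
      exact Iff.rfl)
  have a₅ : AgreeOff [26, 27, 28, 29, 30, 21] [10, 11] s₄ ((findC pre cond).den s₄) :=
    (den_agree _ _).mono (by decide) (by decide)
  refine ⟨by rw [a₅.1 32 (by decide), h32₄], fun v => ?_, ?_⟩
  · rw [a₅.1 15 (by decide), h15₄, hI15]
  · rcases hfind with ⟨-, p, q, hP, hp, hq⟩ | ⟨-, hno⟩
    · rw [hp, hq]; exact hP
    · obtain ⟨p, hp, q, hq, hP⟩ := hex
      exact absurd hP (hno ⟨p, hp⟩ ⟨q, hq⟩)

theorem den_replaceC (hn : s.nat 0 0 0 = n) {h L : Fin n → ℕ} {F : Fin n → Fin n → ℕ}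
    (hhdef : h = s.vec n 6) (hch : IsCharged lb h L F top s) (h32 : s.nat 32 0 0 = j)
    (hQ : ∀ v, Q v ↔ s.crossed n v = true ∧ h (top v) = j)
    (h15 : ∀ v, 1 ≤ s.nat 15 (h v) 0 ↔ I (h v)) :
    (replaceC.den s).mat n 5 = replaced (s.mat n 5) (s.mat n 4) h Q I
      (fun l => l = j ∨ I l ∧ s.nat 29 0 0 ≤ l ∧ l ≤ s.nat 30 0 0) := by
  funext u v
  have key := den_each_each (s := s) hn (dst := 5)
    (c := nset 39 (.const 0) (.const 0) (.const 0) ;;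
      ite (chargedB (.var 20)) (nset 39 (.const 0) (.const 0) (.get 4 (.var 20) (.var 21))) skip ;;
      ite (.or (keptB 29 30 (.at 6 (.var 20))) (.not (.natLe (.const 1) (.at 15 (.at 6 (.var 20))))))
        (nset 5 (.var 20) (.var 21) (.add (.var 39) (.get 5 (.var 20) (.var 21))))
        (nset 5 (.var 20) (.var 21) (.var 39))) (by decide) (by decide)
    (fun u v => if hu : u < n ∧ v < n then replaced (s.mat n 5) (s.mat n 4) h Q I
      (fun l => l = j ∨ I l ∧ s.nat 29 0 0 ≤ l ∧ l ≤ s.nat 30 0 0) ⟨u, hu.1⟩ ⟨v, hu.2⟩ else 0) (by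
      intro u v hu hv s' hu' hv' hs' hold i k
      rw [dif_pos ⟨hu, hv⟩]
      simp only [den_seq]
      set s₁ := (nset 39 (.const 0) (.const 0) (.const 0)).den s' with hs₁
      have a₁ : AgreeOff [20, 21, 39, 5] [] s s₁ := (hs'.mono (by decide) (by decide)).trans
        ((den_agree _ _).mono (by decide) (by decide))
      have hu₁ : s₁.nat 20 0 0 = u := by rw [hs₁, den_nat _ _ (by decide), hu']
      have hv₁ : s₁.nat 21 0 0 = v := by rw [hs₁, den_nat _ _ (by decide), hv']
      have h39₁ : s₁.nat 39 0 0 = 0 := by simp [hs₁]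
      have h5₁ : s₁.nat 5 = s'.nat 5 := by rw [hs₁, den_nat _ _ (by decide)]
      have hc := holds_chargedB hch hhdef a₁ (by decide) (j := j) (by rw [a₁.1 32 (by decide), h32])
        (e := .var 20) (v := ⟨u, hu⟩) hu₁
      rw [← hQ] at hc
      set s₂ := (ite (chargedB (.var 20))
        (nset 39 (.const 0) (.const 0) (.get 4 (.var 20) (.var 21))) skip).den s₁ with hs₂
      have a₂ : AgreeOff [39] [] s₁ s₂ := (den_agree _ _).mono (by decide) (by decide)
      have h39₂ : s₂.nat 39 0 0 = if Q ⟨u, hu⟩ then s.nat 4 u v else 0 := by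
        by_cases hq : Q ⟨u, hu⟩
        · rw [hs₂, den_ite_pos _ _ (hc.2 hq), if_pos hq]
          simp [hu₁, hv₁, a₁.1 4 (by decide)]
        · rw [hs₂, den_ite_neg _ _ fun h => hq (hc.1 h), if_neg hq, den_skip, h39₁]
      have hu₂ : s₂.nat 20 0 0 = u := by rw [a₂.1 20 (by decide), hu₁]
      have hv₂ : s₂.nat 21 0 0 = v := by rw [a₂.1 21 (by decide), hv₁]
      have h5₂ : s₂.nat 5 = s'.nat 5 := by rw [a₂.1 5 (by decide), h5₁]
      have h6₂ : s₂.nat 6 u 0 = h ⟨u, hu⟩ := by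
        rw [a₂.1 6 (by decide), a₁.1 6 (by decide), hhdef]; rfl
      have h15₂ : s₂.nat 15 = s.nat 15 := by rw [a₂.1 15 (by decide), a₁.1 15 (by decide)]
      have hiff : (BExp.or (keptB 29 30 (.at 6 (.var 20)))
          (.not (.natLe (.const 1) (.at 15 (.at 6 (.var 20)))))).Holds s₂ ↔
          ((h ⟨u, hu⟩ = j ∨ I (h ⟨u, hu⟩) ∧ s.nat 29 0 0 ≤ h ⟨u, hu⟩ ∧ h ⟨u, hu⟩ ≤ s.nat 30 0 0) ∨
            ¬ I (h ⟨u, hu⟩)) := by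
        simp only [keptB, BExp.holds_or, BExp.holds_and, BExp.holds_natEq, BExp.holds_natLe,
          BExp.holds_not, NExp.eval_at, NExp.eval_var, NExp.eval_const, hu₂, h6₂, h15₂, h15,
          a₂.1 32 (by decide), a₁.1 32 (by decide), a₂.1 29 (by decide), a₁.1 29 (by decide),
          a₂.1 30 (by decide), a₁.1 30 (by decide), h32]
      by_cases hk : (h ⟨u, hu⟩ = j ∨ I (h ⟨u, hu⟩) ∧ s.nat 29 0 0 ≤ h ⟨u, hu⟩ ∧
          h ⟨u, hu⟩ ≤ s.nat 30 0 0) ∨ ¬ I (h ⟨u, hu⟩)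
      · rw [den_ite_pos _ _ (hiff.2 hk)]
        simp only [den_nset, NExp.eval_var, NExp.eval_add, NExp.eval_get, hu₂, hv₂, h39₂, h5₂,
          Store.setNat_nat_same, replaced, hk, if_true, hold, Store.mat]
      · rw [den_ite_neg _ _ fun h => hk (hiff.1 h)]
        simp only [den_nset, NExp.eval_var, hu₂, hv₂, h39₂, h5₂,
          Store.setNat_nat_same, replaced, hk, if_false, Store.mat, add_zero]) u v u.2 v.2
  rw [dif_pos ⟨u.2, v.2⟩] at key
  exact key

/-- `3 lb(Q ∩ J) ≤ 2 lb(Q)` is the lightness condition `α lb(Q) + 3α lb(J) ≤ 3α lb(Q ∪ J)` in other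
terms. The removed squares sum to at most `lb(j) lb(I)` because `j` is the most valuable met
component, so the second inequality leaves a gain of `m² ≥ δ²`. -/
theorem IsGoodInterval.replace {G : Instance (Fin n)} {H F : Fin n → Fin n → ℕ}
    {h f h' : Fin n → ℕ} {m δ α : ℝ} {p q : ℕ} (hlb : ∀ v, 0 ≤ lb v)
    (hgood : IsGoodInterval lb h Q I j m p q) (hα : 0 ≤ α) (hδ : 0 ≤ δ) (hδm : δ ≤ m)
    (hh : IsLabeling H h) (hf : IsLabeling F f)
    (hHl : ∀ t, ∑ u with h u = h t, G.rowW H u ≤ 3 * α * ∑ u with h u = h t, lb u)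
    (hFl : ∀ t, ∑ u with f u = f t, G.rowW F u ≤ α * ∑ u with f u = f t, lb u)
    (hQ : ∀ u v, f u = f v → (Q u ↔ Q v)) (hI : ∀ l, I l ↔ ∃ v, Q v ∧ h v = l) (hj : I j)
    (htouch : ∀ v, Q v → ∃ t, f t = f v ∧ h t = j)
    (hmax : ∀ v, Q v → ∑ u with h u = h v, lb u ≤ ∑ u with h u = j, lb u)
    (hh' : IsLabeling (replaced H F h Q I (fun l => l = j ∨ I l ∧ p ≤ l ∧ l ≤ q)) h') :
    (∀ t, ∑ u with h' u = h' t,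
        G.rowW (replaced H F h Q I (fun l => l = j ∨ I l ∧ p ≤ l ∧ l ≤ q)) u
      ≤ 3 * α * ∑ u with h' u = h' t, lb u) ∧
    potential lb 1 h + δ * δ ≤ potential lb 1 h' := by
  set J : ℕ → Prop := fun l => l = j ∨ I l ∧ p ≤ l ∧ l ≤ q with hJdef
  have hQI : ∀ v, Q v → I (h v) := fun v hv => (hI _).2 ⟨v, hv, rfl⟩
  have hJI : ∀ l, J l → I l := by
    rintro l (rfl | h1)
    · exact hj
    · exact h1.1
  have hlab := replaced_labels hh hf hQ hQI
    (connected_replaced (I := I) (J := J) hh hf hQ (j := j) (Or.inl rfl) htouch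
      fun l hl => (hI l).1 (hJI l hl)) hh'
  obtain ⟨g1, g2⟩ := hgood
  have hun : ∑ v with (Q v ∨ J (h v)), lb v
      = ∑ v with J (h v), lb v + ∑ v with Q v, lb v - ∑ v with (Q v ∧ J (h v)), lb v := by
    rw [eq_sub_iff_add_eq]
    simp only [Finset.sum_filter, ← Finset.sum_add_distrib]
    refine Finset.sum_congr rfl fun v _ => ?_
    by_cases h1 : Q v <;> by_cases h2 : J (h v) <;> simp [h1, h2]
  refine ⟨light_replaced (A := α) (by positivity) hlb hlab hQ hQI hJI hHl hFl ?_, ?_⟩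
  · rw [hun]
    have := mul_le_mul_of_nonneg_left g1 hα
    linarith
  · have h1 := potential_replaced hlb 1 hlab hQI hJI
    have h2 : ∑ v with I (h v), lb v * (∑ u with h u = h v, lb u) ^ 1
        ≤ (∑ u with h u = j, lb u) * ∑ v with I (h v), lb v := by
      rw [Finset.mul_sum]
      refine Finset.sum_le_sum fun v hv => ?_
      simp only [Finset.mem_filter, Finset.mem_univ, true_and] at hv
      obtain ⟨w, hw, hwv⟩ := (hI _).1 hv
      have := hmax w hw
      rw [hwv] at this
      rw [pow_one, mul_comm]
      exact mul_le_mul_of_nonneg_right this (hlb v)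
    have h3 : δ * δ ≤ m * m := mul_le_mul hδm hδm hδ (hδ.trans hδm)
    rw [hun, one_add_one_eq_two, sq] at h1
    linarith

end Augment

/-- Replace components, and start the merging procedure again. -/
def augmentC : Cmd :=
  chooseC ;; replaceC ;; restartC

/-- The violated bound `hviol` is what `exists_good_interval` needs. Since `H` has changed, merging
starts again from it and previous merges are lost. -/
theorem den_augmentC {G : Instance (Fin n)} {s : Store} (hn : s.nat 0 0 0 = n)
    {h : Fin n → ℕ} (hhdef : h = s.vec n 6) {lb : Fin n → ℝ}
    (hlb : ∀ v, 0 ≤ lb v) (hlb4 : ∀ v : Fin n, s.real 4 v 0 = lb v) {top : Fin n → Fin n}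
    (hlt : ∀ v, h v < n)
    (hch : IsCharged lb (h) (s.vec n 8) (s.mat n 4) top s) {δ α : ℝ}
    (hδ : s.real 5 0 0 = δ) (hδ0 : 0 ≤ δ) (hα : 0 ≤ α)
    (hH : G.IsEulerian (s.mat n 5)) (hh : IsLabeling (s.mat n 5) (h))
    (hHl : ∀ t, ∑ u with h u = h t, G.rowW (s.mat n 5) u
      ≤ 3 * α * ∑ u with h u = h t, lb u)
    (hF : G.IsEulerian (s.mat n 4))
    (hFl : ∀ t, ∑ u with s.vec n 9 u = s.vec n 9 t, G.rowW (s.mat n 4) u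
      ≤ α * ∑ u with s.vec n 9 u = s.vec n 9 t, lb u) {j : Fin n} (hj : s.nat 29 0 0 = j)
    (hviol : 3 * max (∑ u with h u = j, lb u) δ
      < ∑ v with (s.crossed n v = true ∧ h (top v) = j), lb v) :
    G.IsEulerian ((augmentC.den s).mat n 5) ∧
    IsLabeling ((augmentC.den s).mat n 5) ((augmentC.den s).vec n 6) ∧
    (∀ v, (augmentC.den s).vec n 6 v < n) ∧
    (∀ t, ∑ u with (augmentC.den s).vec n 6 u = (augmentC.den s).vec n 6 t,
        G.rowW ((augmentC.den s).mat n 5) u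
      ≤ 3 * α * ∑ u with (augmentC.den s).vec n 6 u = (augmentC.den s).vec n 6 t, lb u) ∧
    potential lb 1 (h) + δ * δ ≤ potential lb 1 ((augmentC.den s).vec n 6) ∧
    (augmentC.den s).mat n 7 = (augmentC.den s).mat n 5 ∧
    IsLabeling ((augmentC.den s).mat n 5) ((augmentC.den s).vec n 8) ∧
    ∀ v, (augmentC.den s).vec n 8 v < n := by
  classical
  obtain ⟨Q, hQdef⟩ : ∃ Q : Fin n → Prop, ∀ v, Q v ↔ s.crossed n v = true ∧ h (top v) = j :=
    ⟨_, fun _ => Iff.rfl⟩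
  obtain ⟨I, hIdef⟩ : ∃ I : ℕ → Prop, ∀ l, I l ↔ ∃ v, Q v ∧ h v = l := ⟨_, fun _ => Iff.rfl⟩
  have hviol' : 3 * max (∑ u with h u = j, lb u) δ < ∑ v with Q v, lb v := by
    simpa only [hQdef] using hviol
  have hQf : ∀ u v, s.vec n 9 u = s.vec n 9 v → (Q u ↔ Q v) := by
    intro u v huv
    have e1 : s.crossed n u = s.crossed n v := by
      simp only [Store.crossed]
      rw [show s.nat 9 u 0 = s.nat 9 v 0 from huv]
    have e2 : top u = top v := by
      refine Fin.ext ?_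
      rw [← hch.top_eq, ← hch.top_eq, show s.nat 9 u 0 = s.nat 9 v 0 from huv]
    rw [hQdef, hQdef, e1, e2]
  have htouch : ∀ v, Q v → ∃ t, s.vec n 9 t = s.vec n 9 v ∧ h t = j := fun v hv =>
    ⟨top v, hch.top_label v, ((hQdef v).1 hv).2⟩
  have hmax : ∀ v, Q v → ∑ u with h u = h v, lb u ≤ ∑ u with h u = j, lb u := by
    intro v hv
    have := hch.top_max v v rfl
    rwa [hch.value, hch.value, ((hQdef v).1 hv).2] at this
  -- Something is charged to `j` since the charged sum is positive, and each charged component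
  -- contains a vertex of `j`.
  have hIj : I j := by
    by_contra hno
    have hemp : ∀ v, ¬ Q v := fun v hv => by
      obtain ⟨t, ht, htj⟩ := htouch v hv
      exact hno ((hIdef j).2 ⟨t, (hQf t v ht).2 hv, htj⟩)
    have e : ∑ v with Q v, lb v = 0 := by
      rw [Finset.sum_filter, Finset.sum_eq_zero fun v _ => if_neg (hemp v)]
    rw [e] at hviol'
    have := le_max_right (∑ u with h u = j, lb u) δ
    linarith
  obtain ⟨c1, c2, c3⟩ := den_chooseC hn hhdef hlb4 hlt hch hδ hj hQdef hIdef
    (exists_good_interval hlt hlb hIdef hIj hmax (le_max_left _ _) hviol')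
  unfold augmentC
  simp only [den_seq]
  have a₁ : AgreeOff [15, 20, 21, 26, 27, 28, 29, 30, 32] [9, 10, 11, 14] s (chooseC.den s) :=
    (den_agree _ _).mono (by decide) (by decide)
  set s₁ := chooseC.den s with hs₁
  have e6 : h = s₁.vec n 6 := by rw [hhdef]; unfold Store.vec; rw [a₁.1 6 (by decide)]
  have e5 : s₁.mat n 5 = s.mat n 5 := by unfold Store.mat; rw [a₁.1 5 (by decide)]
  have e4 : s₁.mat n 4 = s.mat n 4 := by unfold Store.mat; rw [a₁.1 4 (by decide)]
  have ec : s₁.crossed n = s.crossed n := by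
    unfold Store.crossed; rw [a₁.1 9 (by decide), a₁.1 10 (by decide)]
  have hr := den_replaceC (s := s₁) (Q := Q) (I := I) (by rw [a₁.1 0 (by decide), hn]) e6
    (hch.congr a₁ (by decide) (by decide)) c1 (by simpa only [ec] using hQdef) c2
  rw [e5, e4] at hr
  have hn₂ : (replaceC.den s₁).nat 0 0 0 = n := by
    rw [den_nat _ _ (by decide), a₁.1 0 (by decide), hn]
  obtain ⟨r1, r2, r3, r4, r5, r6⟩ := den_restartC hn₂
  rw [r3, r4]
  rw [hr] at r1 r5 ⊢
  obtain ⟨k1, k2⟩ := c3.replace hlb hα hδ0 (le_max_right _ _) hh hch.labeling hHl hFl hQf hIdef hIj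
    htouch hmax r1
  exact ⟨eulerian_replaced hH hh hF hch.labeling hQf, r1, r2, k1, k2, rfl, r5, r6⟩

end ATSP

/-! ### One round and the number of rounds -/

namespace ATSP

open Cmd

variable {n : ℕ}

/-- One round after the call of the subroutine, up to the new partition. -/
def updateC : Cmd :=
  chargeC ;;
  findC skip (.and (.not (.realLe (.at 8 (.var 26)) (.mul (.const 3) (.at 6 (.var 26)))))
    (.not (.realLe (.at 8 (.var 26)) (.mul (.const 3) (.var 5))))) ;;
  ite (.natLe (.const 1) (.var 28)) augmentC mergeC

/-- The value of the component with label `j`, at least `δ`. -/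
noncomputable def classVal (lb : Fin n → ℝ) (δ : ℝ) (h : Fin n → ℕ) (j : ℕ) : ℝ :=
  max (∑ u with h u = j, lb u) δ

/-- The invariant of the rounds: the array `5` contains a light multigraph, its components have the
labels in the array `6`; the arrays `7` and `8` contain the state of the merging procedure. -/
structure RoundState (G : Instance (Fin n)) (lb : Fin n → ℝ) (α δ : ℝ) (s : Store) : Prop where
  label_lt : ∀ v, s.vec n 6 v < n
  class_lt : ∀ v, s.vec n 8 v < n
  eulerian : G.IsEulerian (s.mat n 5)
  labeling : IsLabeling (s.mat n 5) (s.vec n 6)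
  light : ∀ t, ∑ u with s.vec n 6 u = s.vec n 6 t, G.rowW (s.mat n 5) u
    ≤ 3 * α * ∑ u with s.vec n 6 u = s.vec n 6 t, lb u
  merge : MergeState G (s.vec n 6) (classVal lb δ (s.vec n 6)) (3 * α) (3 * α)
    (∑ v, 3 * α * (lb v + δ) + G.totalWeight (s.mat n 5)) (s.mat n 7) (s.vec n 8)

theorem RoundState.congr {G : Instance (Fin n)} {lb : Fin n → ℝ} {α δ : ℝ} {s s' : Store}
    (hs : RoundState G lb α δ s) {N R : List ℕ} (ha : AgreeOff N R s s')
    (hN : ∀ a ∈ [5, 6, 7, 8], a ∉ N) : RoundState G lb α δ s' := by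
  have e5 : s'.mat n 5 = s.mat n 5 := by unfold Store.mat; rw [ha.1 5 (hN 5 (by simp))]
  have e6 : s'.vec n 6 = s.vec n 6 := by unfold Store.vec; rw [ha.1 6 (hN 6 (by simp))]
  have e7 : s'.mat n 7 = s.mat n 7 := by unfold Store.mat; rw [ha.1 7 (hN 7 (by simp))]
  have e8 : s'.vec n 8 = s.vec n 8 := by unfold Store.vec; rw [ha.1 8 (hN 8 (by simp))]
  obtain ⟨h1, h2, h3, h4, h5, h6⟩ := hs
  exact ⟨by rw [e6]; exact h1, by rw [e8]; exact h2, by rw [e5]; exact h3, by rw [e5, e6]; exact h4,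
    by rw [e5, e6]; exact h5, by rw [e5, e6, e7, e8]; exact h6⟩

theorem classVal_nonneg {lb : Fin n → ℝ} (hlb : ∀ v, 0 ≤ lb v) (δ : ℝ) (h : Fin n → ℕ) (j : ℕ) :
    0 ≤ classVal lb δ h j :=
  (Finset.sum_nonneg fun v _ => hlb v).trans (le_max_left _ _)

/-- The surplus over `lb` is paid by the `δ` of a single vertex of the class, so the values of all
classes add up to at most `lb(V) + n δ`. -/
theorem classVal_le {lb : Fin n → ℝ} (hlb : ∀ v, 0 ≤ lb v) {δ : ℝ} (hδ : 0 ≤ δ) (h : Fin n → ℕ)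
    (t : Fin n) : classVal lb δ h (h t) ≤ ∑ v with h v = h t, (lb v + δ) := by
  refine max_le (Finset.sum_le_sum fun v _ => by linarith) ?_
  refine le_trans ?_ (Finset.single_le_sum (f := fun v => lb v + δ)
    (fun v _ => add_nonneg (hlb v) hδ) (Finset.mem_filter.2 ⟨Finset.mem_univ t, rfl⟩))
  linarith [hlb t]

theorem RoundState.start {G : Instance (Fin n)} {lb : Fin n → ℝ} {α δ : ℝ} {s : Store}
    (hlb : ∀ v, 0 ≤ lb v) (hδ : 0 ≤ δ) (hα : 0 ≤ α) (h1 : ∀ v, s.vec n 6 v < n)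
    (h2 : ∀ v, s.vec n 8 v < n) (h3 : G.IsEulerian (s.mat n 5))
    (h4 : IsLabeling (s.mat n 5) (s.vec n 6))
    (h5 : ∀ t, ∑ u with s.vec n 6 u = s.vec n 6 t, G.rowW (s.mat n 5) u
      ≤ 3 * α * ∑ u with s.vec n 6 u = s.vec n 6 t, lb u)
    (h6 : s.mat n 7 = s.mat n 5) (h7 : IsLabeling (s.mat n 5) (s.vec n 8)) :
    RoundState G lb α δ s := by
  refine ⟨h1, h2, h3, h4, h5, ?_⟩
  rw [h6]
  refine MergeState.init h3 h4 h7 fun t => ?_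
  rw [← Finset.mul_sum]
  exact mul_le_mul_of_nonneg_left (classVal_le hlb hδ _ t) (by positivity)

/-- A bound on the number of rounds that are left. -/
noncomputable def roundsLeft (lb : Fin n → ℝ) (δ : ℝ) (h L : Fin n → ℕ) : ℕ :=
  (n + 1) * ⌊((∑ v, lb v) * (∑ v, lb v) - potential lb 1 h) / (δ * δ)⌋₊
    + (Finset.univ.image L).card

theorem potential_one_le {lb : Fin n → ℝ} (hlb : ∀ v, 0 ≤ lb v) (h : Fin n → ℕ) :
    potential lb 1 h ≤ (∑ v, lb v) * ∑ v, lb v := by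
  unfold potential
  rw [Finset.sum_mul]
  refine Finset.sum_le_sum fun v _ => mul_le_mul_of_nonneg_left ?_ (hlb v)
  rw [pow_one]
  exact Finset.sum_le_sum_of_subset_of_nonneg (Finset.filter_subset _ _) fun v _ _ => hlb v

/-- A gain of `δ²` lowers the floor by at least one, worth `n + 1` rounds, while the restart raises
the number of classes to at most `n`. -/
theorem roundsLeft_lt {lb : Fin n → ℝ} (hlb : ∀ v, 0 ≤ lb v) {δ : ℝ} (hδ : 0 < δ)
    {h h' L L' : Fin n → ℕ} (hpot : potential lb 1 h + δ * δ ≤ potential lb 1 h') :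
    roundsLeft lb δ h' L' < roundsLeft lb δ h L := by
  have hcard : (Finset.univ.image L').card ≤ n := by
    refine Finset.card_image_le.trans ?_
    simp
  set X := (∑ v, lb v) * ∑ v, lb v with hX
  have hd : 0 < δ * δ := by positivity
  have h1 : (X - potential lb 1 h') / (δ * δ) + 1 ≤ (X - potential lb 1 h) / (δ * δ) := by
    rw [div_add_one hd.ne']
    exact div_le_div_of_nonneg_right (by linarith) hd.le
  have h0 : 0 ≤ (X - potential lb 1 h') / (δ * δ) :=
    div_nonneg (sub_nonneg.2 (potential_one_le hlb h')) hd.le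
  have h2 : ⌊(X - potential lb 1 h') / (δ * δ)⌋₊ + 1 ≤ ⌊(X - potential lb 1 h) / (δ * δ)⌋₊ := by
    rw [← Nat.floor_add_one h0]
    exact Nat.floor_le_floor h1
  unfold roundsLeft
  rw [← hX]
  have h3 := Nat.mul_le_mul_left (n + 1) h2
  rw [Nat.mul_add] at h3
  omega

/-- Either some label is charged more than three times its value, and a replacement raises the
potential, or `IsCheap` holds with `κ = γ = 3α` and merging lowers the number of classes. -/
theorem den_updateC {G : Instance (Fin n)} {s : Store} (hG : HasGraph G s) {lb : Fin n → ℝ}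
    (hlb : ∀ v, 0 ≤ lb v) (hlb4 : ∀ v : Fin n, s.real 4 v 0 = lb v) {α₀ α δ : ℝ}
    (hα₀ : s.real 2 0 0 = α₀) (hα : 0 ≤ α) (hδ : s.real 5 0 0 = δ) (hδ0 : 0 ≤ δ)
    (hδpos : 0 < ∑ v, lb v → 0 < δ)
    (hαα : ∀ h j, α₀ * classVal lb δ h j = α * classVal lb δ h j)
    (hs : RoundState G lb α δ s) (hF : G.IsEulerian (s.mat n 4))
    (hleaves : ∀ v, ∃ a b, s.vec n 8 a = s.vec n 8 v ∧ s.vec n 8 b ≠ s.vec n 8 v ∧ s.mat n 4 a b ≠ 0)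
    (hFl : ∀ f, IsLabeling (s.mat n 4) f → ∀ t, ∑ u with f u = f t, G.rowW (s.mat n 4) u
      ≤ α * ∑ u with f u = f t, lb u) :
    RoundState G lb α δ (updateC.den s) ∧
    roundsLeft lb δ ((updateC.den s).vec n 6) ((updateC.den s).vec n 8)
      < roundsLeft lb δ (s.vec n 6) (s.vec n 8) := by
  unfold updateC
  simp only [den_seq]
  obtain ⟨top, hch⟩ := den_chargeC hG.size hlb4 hs.label_lt
  have a₁ : AgreeOff [9, 10, 11, 20, 21, 22, 23, 24] [6, 7, 8] s (chargeC.den s) :=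
    (den_agree _ _).mono (by decide) (by decide)
  set s₁ := chargeC.den s with hs₁
  set cond : BExp := .and (.not (.realLe (.at 8 (.var 26)) (.mul (.const 3) (.at 6 (.var 26)))))
    (.not (.realLe (.at 8 (.var 26)) (.mul (.const 3) (.var 5)))) with hcond
  have hfind := den_findC (s := s₁) (n := n) (by rw [a₁.1 0 (by decide), hG.size]) (pre := skip)
    (cond := cond) (by decide) (by decide)
    (P := fun j _ => 3 * classVal lb δ (s.vec n 6) j
      < ∑ v with (s₁.crossed n v = true ∧ s.vec n 6 (top v) = j), lb v) (by
      intro j b s' hj hb hs'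
      rw [← hch.charge j j.2, classVal, ← hch.classValue j j.2]
      simp only [hcond, den_skip, BExp.holds_and, BExp.holds_not, BExp.holds_realLe, RExp.eval_at,
        RExp.eval_mul, RExp.eval_const, RExp.eval_var, NExp.eval_var, hj, Rat.cast_ofNat,
        hs'.2 8 (by decide), hs'.2 6 (by decide), hs'.2 5 (by decide), a₁.2 5 (by decide), hδ, not_le]
      rw [mul_max_of_nonneg _ _ (by norm_num : (0 : ℝ) ≤ 3), max_lt_iff])
  have a₂ : AgreeOff [26, 27, 28, 29, 30] [] s₁ ((findC skip cond).den s₁) :=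
    (den_agree _ _).mono (by decide) (by decide)
  set s₂ := (findC skip cond).den s₁ with hs₂
  have hch₂ := hch.congr a₂ (by decide) (by decide)
  have a : AgreeOff [9, 10, 11, 20, 21, 22, 23, 24, 26, 27, 28, 29, 30] [6, 7, 8] s s₂ :=
    (a₁.mono (by decide) (by decide)).trans (a₂.mono (by decide) (by decide))
  have hs₂' := hs.congr a (by decide)
  have hG₂ : HasGraph G s₂ := hG.congr (a.1 0 (by decide)) (a.1 1 (by decide)) (a.2 0 (by decide))
  have e4 : s₂.mat n 4 = s.mat n 4 := by unfold Store.mat; rw [a.1 4 (by decide)]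
  have e6 : s₂.vec n 6 = s.vec n 6 := by unfold Store.vec; rw [a.1 6 (by decide)]
  have e8 : s₂.vec n 8 = s.vec n 8 := by unfold Store.vec; rw [a.1 8 (by decide)]
  have ec : s₂.crossed n = s₁.crossed n := by
    unfold Store.crossed; rw [a₂.1 9 (by decide), a₂.1 10 (by decide)]
  have hδ₂ : s₂.real 5 0 0 = δ := by rw [a.2 5 (by decide), hδ]
  have hlb₂ : ∀ v : Fin n, s₂.real 4 v 0 = lb v := fun v => by rw [a.2 4 (by decide), hlb4]
  have hα₂ : s₂.real 2 0 0 = α₀ := by rw [a.2 2 (by decide), hα₀]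
  rw [← e6, ← e8, ← e4] at hch₂
  simp only [← e6, ← ec] at hfind
  rw [← e6, ← e8]
  rw [← e4] at hF hFl hleaves
  rw [← e8] at hleaves
  clear_value s₂
  clear hs₁ hch hs a a₁ a₂ e4 e6 e8 ec hlb4 hδ
  rcases hfind with ⟨hf, j, -, hP, hj, -⟩ | ⟨hf, hno⟩
  · rw [den_ite_pos _ _ (by simp [hf])]
    obtain ⟨r1, r2, r3, r4, r5, r6, r7, r8⟩ := den_augmentC hG₂.size rfl hlb hlb₂ hs₂'.label_lt hch₂
      hδ₂ hδ0 hα hs₂'.eulerian hs₂'.labeling hs₂'.light hF (hFl _ hch₂.labeling) hj hP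
    -- The case `δ = 0` does not arise: a violated bound makes the total of `lb` positive.
    refine ⟨RoundState.start hlb hδ0 hα r3 r8 r1 r2 r4 r6 r7, roundsLeft_lt hlb (hδpos ?_) r5⟩
    have h1 := classVal_nonneg hlb δ (s₂.vec n 6) j
    have h2 : ∑ v with (s₂.crossed n v = true ∧ s₂.vec n 6 (top v) = j), lb v ≤ ∑ v, lb v :=
      Finset.sum_le_sum_of_subset_of_nonneg (Finset.filter_subset _ _) fun v _ _ => hlb v
    linarith
  · rw [den_ite_neg _ _ (by simp [hf])]
    set ind : ℕ → ℕ := fun c => s₂.nat 6 (s₂.nat 11 c 0) 0 with hind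
    have hindv : ∀ v, ind (s₂.vec n 9 v) = s₂.vec n 6 (top v) := fun v => by
      simp only [hind]
      rw [show s₂.vec n 9 v = s₂.nat 9 v 0 from rfl, hch₂.top_eq]
      rfl
    have hcrf : ∀ u v, s₂.vec n 9 u = s₂.vec n 9 v → s₂.crossed n u = s₂.crossed n v := by
      intro u v huv
      simp only [Store.crossed]
      rw [show s₂.nat 9 u 0 = s₂.nat 9 v 0 from huv]
    have hsum : ∀ j : ℕ, ∑ u with (s₂.crossed n u = true ∧ ind (s₂.vec n 9 u) = j), G.rowW (s₂.mat n 4) u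
        ≤ 3 * α * classVal lb δ (s₂.vec n 6) j := by
      intro j
      by_cases hj : j < n
      · have h1 := hno ⟨j, hj⟩ ⟨j, hj⟩
        simp only [not_lt] at h1
        have h2 := sum_nonneg_of_classes (g := s₂.vec n 9) (q := fun v => α * lb v - G.rowW (s₂.mat n 4) v)
          (fun t => by
            rw [Finset.sum_sub_distrib, ← Finset.mul_sum]
            linarith [hFl _ hch₂.labeling t])
          (fun u => s₂.crossed n u = true ∧ ind (s₂.vec n 9 u) = j)
          (fun u v huv => by rw [huv, hcrf u v huv])
        rw [Finset.sum_sub_distrib, ← Finset.mul_sum] at h2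
        simp only [hindv] at h2 ⊢
        have h3 := mul_le_mul_of_nonneg_left h1 hα
        linarith
      · rw [Finset.sum_eq_zero fun u hu => ?_]
        · have := classVal_nonneg hlb δ (s₂.vec n 6) j
          positivity
        · simp only [Finset.mem_filter, Finset.mem_univ, true_and, hindv] at hu
          have := hs₂'.label_lt (top u)
          omega
    obtain ⟨m1, m2, m3⟩ := den_mergeC hG₂ hlb hch₂ hδ₂ hα₂ (m := classVal lb δ (s₂.vec n 6))
      (κ := 3 * α) (fun _ => rfl) (fun j => by rw [mul_assoc, hαα]; ring) (by positivity) hs₂'.merge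
      (ind := ind) {
        eulerian := hF
        labeling := hch₂.labeling
        leaves := hleaves
        crossing := hch₂.crossing
        touch := fun v _ => ⟨top v, hch₂.top_label v, (hindv v).symm⟩
        comp_le := fun v hv => by
          -- As `κ = γ`, the bound for a single component follows from the bound for all that are
          -- charged to its index.
          refine le_trans ?_ (hsum (ind (s₂.vec n 9 v)))
          refine Finset.sum_le_sum_of_subset_of_nonneg (fun u hu => ?_) fun u _ _ => G.rowW_nonneg _ u
          simp only [Finset.mem_filter, Finset.mem_univ, true_and] at hu ⊢
          rw [hu, hcrf u v hu]
          exact ⟨hv, rfl⟩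
        sum_le := hsum }
    have em5 : (mergeC.den s₂).mat n 5 = s₂.mat n 5 := by
      unfold Store.mat; rw [den_nat _ _ (by decide)]
    have em6 : (mergeC.den s₂).vec n 6 = s₂.vec n 6 := by
      unfold Store.vec; rw [den_nat _ _ (by decide)]
    obtain ⟨h1, h2, h3, h4, h5, h6⟩ := hs₂'
    refine ⟨⟨by rw [em6]; exact h1, m3, by rw [em5]; exact h3, by rw [em5, em6]; exact h4,
      by rw [em5, em6]; exact h5, by rw [em5, em6]; exact m1⟩, ?_⟩
    · rw [em6]
      unfold roundsLeft
      omega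

end ATSP

/-! ### Initialization and the invariant of the main loop -/

namespace ATSP

open Cmd

variable {n : ℕ}

/-- Compute `lb` and the threshold `δ`, and start with the multigraph without edges. -/
def initC : Cmd :=
  each 20 (scatterC 15 (.not (.natEq (.var 20) (.var 21))) (.const 0)
      (.mul (.get 1 (.var 20) (.var 21)) (.get 0 (.var 20) (.var 21))) ;;
    rset 4 (.var 20) (.const 0) (.var 15)) ;;
  scatterC 15 (.natLe (.const 0) (.const 0)) (.const 0) (.at 4 (.var 21)) ;;
  -- With `δ = ε lb(V) / (6n)`, raising the values at `n` vertices costs `6 α n δ = ε α lb(V)`.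
  rset 5 (.const 0) (.const 0)
    (.div (.mul (.div (.var 3) (.const 6)) (.var 15)) (.ofNat (.var 0))) ;;
  restartC ;;
  partitionC

/-- A round after the call of the subroutine. -/
def roundC : Cmd :=
  updateC ;; partitionC

/-- Copy the result into the array `4`. -/
def outputC : Cmd :=
  each 20 (each 21 (nset 4 (.var 20) (.var 21) (.get 7 (.var 20) (.var 21))))

/-- Loop edges do not leave `{u}` and are not counted in `lb`, so the program has to test for them.
-/
theorem lb_eq_sum (G : Instance (Fin n)) (x : Fin n → Fin n → ℝ) (u : Fin n) :
    G.lb x u = ∑ v with ¬ u = v, x u v * G.weight u v := by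
  rw [Instance.lb, outCut, Finset.sum_singleton]
  refine Finset.sum_congr ?_ fun _ _ => rfl
  ext v
  simp [eq_comm]

/-- The input is in place, and the arrays `2` and `3` contain the partition into the classes of the
array `8`. -/
structure LoopState (G : Instance (Fin n)) (x : Fin n → Fin n → ℝ) (α₀ α δ : ℝ) (s : Store) :
    Prop where
  size : s.nat 0 = scalar n
  adj : s.nat 1 = matrix G.adj
  weight : s.real 0 = matrix G.weight
  sol : s.real 1 = matrix x
  factor : s.real 2 0 0 = α₀
  lb : ∀ v : Fin n, s.real 4 v 0 = G.lb x v
  delta : s.real 5 0 0 = δ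
  round : RoundState G (G.lb x) α δ s
  partition : ∃ (k : ℕ) (c : Fin n → Fin k), Function.Surjective c ∧
    (∀ u v, c u = c v ↔ s.vec n 8 u = s.vec n 8 v) ∧ s.nat 2 = scalar k ∧
    s.nat 3 = vector fun v => (c v : ℕ)

theorem hasGraph_of_matrix {G : Instance (Fin n)} {s : Store} (h0 : s.nat 0 = scalar n)
    (h1 : s.nat 1 = matrix G.adj) (h2 : s.real 0 = matrix G.weight) : HasGraph G s where
  size := by rw [h0]; simp [scalar]
  adj u v := by
    rw [h1]
    by_cases h : G.graph.Adj u v <;> simp [matrix, Instance.adj, h]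
  weight u v := by rw [h2]; simp [matrix]

/-- The behaviour of the subroutine is known only on memories of the form `lcInput`, so the whole
memory it receives must agree with one of them. -/
theorem arguments_eq_lcInput {G : Instance (Fin n)} {x : Fin n → Fin n → ℝ} {s : Store} {k : ℕ}
    {c : Fin n → Fin k} (h0 : s.nat 0 = scalar n) (h1 : s.nat 1 = matrix G.adj)
    (h2 : s.nat 2 = scalar k) (h3 : s.nat 3 = vector fun v => (c v : ℕ))
    (r0 : s.real 0 = matrix G.weight) (r1 : s.real 1 = matrix x) :
    s.arguments = G.lcInput x c := by
  unfold Store.arguments Instance.lcInput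
  congr 1
  · funext a
    rcases a with _ | _ | _ | _ | a
    · simpa using h0
    · simpa using h1
    · simpa using h2
    · simpa using h3
    · simp
  · funext a
    rcases a with _ | _ | a
    · simpa using r0
    · simpa using r1
    · simp

theorem den_initC {G : Instance (Fin n)} {x : Fin n → Fin n → ℝ} (hx : G.HKFeasible x)
    {α₀ α ε δ : ℝ} (hα : 0 ≤ α) (hδ : δ = ε / 6 * (∑ v, G.lb x v) / n) (hδ0 : 0 ≤ δ) :
    LoopState G x α₀ α δ (initC.den (G.atspInput x α₀ ε)) := by
  have hne : Nonempty (Fin n) := G.nonempty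
  have hn0 : 0 < n := Fin.pos_iff_nonempty.2 hne
  set s := G.atspInput x α₀ ε with hs
  have hn : s.nat 0 0 0 = n := by simp [hs, Instance.atspInput, scalar]
  have hG : HasGraph G s := hasGraph_of_matrix rfl rfl rfl
  have hx1 : ∀ u v : Fin n, s.real 1 u v = x u v := fun u v => by
    simp [hs, Instance.atspInput, matrix]
  unfold initC
  simp only [den_seq]
  have hrow := den_each (x := 20) (c := scatterC 15 (.not (.natEq (.var 20) (.var 21))) (.const 0)
      (.mul (.get 1 (.var 20) (.var 21)) (.get 0 (.var 20) (.var 21))) ;;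
    rset 4 (.var 20) (.const 0) (.var 15)) (by decide) s
    (fun k s' => ∀ v : Fin n, (v : ℕ) < k → s'.real 4 v 0 = G.lb x v) (by simp) (by
      intro k s' hk hk' hs' hP v hv
      rw [hn] at hk
      have h15 := den_scatterC (s := s') (n := n) (by rw [hs'.1 0 (by decide), hn]) (a := 15)
        (cond := .not (.natEq (.var 20) (.var 21))) (key := .const 0)
        (val := .mul (.get 1 (.var 20) (.var 21)) (.get 0 (.var 20) (.var 21)))
        (C := fun v => ¬ (⟨k, hk⟩ : Fin n) = v) (K := fun _ => 0)
        (X := fun v => x ⟨k, hk⟩ v * G.weight ⟨k, hk⟩ v) (by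
          intro v t hv ht
          have e20 : t.nat 20 0 0 = k := by rw [ht.1 20 (by decide), hk']
          refine ⟨?_, rfl, ?_⟩
          · simp [e20, hv, Fin.ext_iff]
          · simp only [RExp.eval_mul, RExp.eval_get, NExp.eval_var, e20, hv, ht.2 1 (by decide),
              ht.2 0 (by decide), hs'.2 1 (by decide), hs'.2 0 (by decide)]
            rw [← hx1 ⟨k, hk⟩ v, ← hG.weight ⟨k, hk⟩ v]) 0 hn0
      simp only [and_true] at h15
      rw [← lb_eq_sum] at h15
      rw [den_seq, Store.setNat_real]
      set t := (scatterC 15 (.not (.natEq (.var 20) (.var 21))) (.const 0)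
        (.mul (.get 1 (.var 20) (.var 21)) (.get 0 (.var 20) (.var 21)))).den s' with ht
      have e20 : t.nat 20 0 0 = k := by rw [ht, den_nat _ _ (by decide), hk']
      have e4 : t.real 4 = s'.real 4 := by rw [ht, den_real _ _ (by decide)]
      simp only [den_rset, NExp.eval_var, NExp.eval_const, RExp.eval_var, e20, h15,
        Store.setReal_real_same, and_true, e4]
      split_ifs with hvk
      · have : v = ⟨k, hk⟩ := Fin.ext hvk
        rw [this]
      · exact hP v (by omega))
  set s₁ := (each 20 (scatterC 15 (.not (.natEq (.var 20) (.var 21))) (.const 0)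
      (.mul (.get 1 (.var 20) (.var 21)) (.get 0 (.var 20) (.var 21))) ;;
    rset 4 (.var 20) (.const 0) (.var 15))).den s with hs₁
  have a₁ : AgreeOff [20, 21] [4, 15] s s₁ := (den_agree _ _).mono (by decide) (by decide)
  have hlb₁ : ∀ v : Fin n, s₁.real 4 v 0 = G.lb x v := fun v => hrow v (by rw [hn]; exact v.2)
  have hn₁ : s₁.nat 0 0 0 = n := by rw [a₁.1 0 (by decide), hn]
  have h15 := den_scatterC (s := s₁) hn₁ (a := 15) (cond := .natLe (.const 0) (.const 0))
    (key := .const 0) (val := .at 4 (.var 21)) (C := fun _ => True) (K := fun _ => 0) (X := G.lb x)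
    (by
      intro v t hv ht
      refine ⟨by simp, rfl, ?_⟩
      rw [RExp.eval_at, NExp.eval_var, hv, ht.2 4 (by decide), hlb₁]) 0 hn0
  simp only [and_true, Finset.filter_true] at h15
  set s₂ := (scatterC 15 (.natLe (.const 0) (.const 0)) (.const 0) (.at 4 (.var 21))).den s₁ with hs₂
  have a₂ : AgreeOff [20, 21] [4, 15] s s₂ := a₁.trans ((den_agree _ _).mono (by decide) (by decide))
  have hlb₂ : ∀ v : Fin n, s₂.real 4 v 0 = G.lb x v := fun v => by
    rw [hs₂, den_real _ _ (by decide), hlb₁]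
  set s₃ := (rset 5 (.const 0) (.const 0)
    (.div (.mul (.div (.var 3) (.const 6)) (.var 15)) (.ofNat (.var 0)))).den s₂ with hs₃
  have hδ₃ : s₃.real 5 0 0 = δ := by
    have e3 : s₂.real 3 0 0 = ε := by
      rw [a₂.2 3 (by decide)]; simp [hs, Instance.atspInput, scalar]
    have e0 : s₂.nat 0 0 0 = n := by rw [a₂.1 0 (by decide), hn]
    rw [hδ]
    simp [hs₃, e3, e0, h15]
  have hlb₃ : ∀ v : Fin n, s₃.real 4 v 0 = G.lb x v := fun v => by
    rw [hs₃, den_real _ _ (by decide), hlb₂]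
  have a₃ : AgreeOff [20, 21] [4, 15, 5] s s₃ := (a₂.mono (by decide) (by decide)).trans
    ((den_agree _ _).mono (by decide) (by decide))
  have hn₃ : s₃.nat 0 0 0 = n := by rw [a₃.1 0 (by decide), hn]
  have hm5 : s₃.mat n 5 = 0 := by
    unfold Store.mat
    rw [a₃.1 5 (by decide)]
    rfl
  obtain ⟨r1, r2, r3, r4, r5, r6⟩ := den_restartC hn₃
  have a₄ : AgreeOff [5, 6, 7, 8, 20, 21, 22, 23, 24] [4, 15, 5] s (restartC.den s₃) :=
    (a₃.mono (by decide) (by decide)).trans ((den_agree _ _).mono (by decide) (by decide))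
  have hlb₄ : ∀ v : Fin n, (restartC.den s₃).real 4 v 0 = G.lb x v := fun v => by
    rw [den_real _ _ (by decide), hlb₃]
  have hδ₄ : (restartC.den s₃).real 5 0 0 = δ := by rw [den_real _ _ (by decide), hδ₃]
  set s₄ := restartC.den s₃ with hs₄
  have hlb := lb_nonneg hx
  rw [← r3] at r1 r4 r5
  have hround : RoundState G (G.lb x) α δ s₄ := by
    refine RoundState.start hlb hδ0 hα r2 r6 ?_ r1 (fun t => ?_) r4 r5
    · rw [r3, hm5]
      exact ⟨fun u v h => absurd rfl h, fun v => by simp [outCut, inCut]⟩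
    · rw [Finset.sum_eq_zero fun u _ => Instance.rowW_eq_zero G fun v => by rw [r3, hm5]; rfl]
      exact mul_nonneg (by positivity) (Finset.sum_nonneg fun v _ => hlb v)
  have hn₄ : s₄.nat 0 0 0 = n := by rw [a₄.1 0 (by decide), hn]
  obtain ⟨k, c, c1, c2, c3, c4⟩ := den_partitionC (s := s₄) hn₄ r6
    (fun i j _ => by rw [a₄.1 2 (by decide)]; rfl) (fun i j _ => by rw [a₄.1 3 (by decide)]; rfl)
  have a₅ : AgreeOff [2, 3, 17, 20, 21] [] s₄ (partitionC.den s₄) :=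
    (den_agree _ _).mono (by decide) (by decide)
  exact {
    size := by rw [a₅.1 0 (by decide), a₄.1 0 (by decide)]; rfl
    adj := by rw [a₅.1 1 (by decide), a₄.1 1 (by decide)]; rfl
    weight := by rw [a₅.2 0 (by decide), a₄.2 0 (by decide)]; rfl
    sol := by rw [a₅.2 1 (by decide), a₄.2 1 (by decide)]; rfl
    factor := by
      rw [a₅.2 2 (by decide), a₄.2 2 (by decide)]
      simp [hs, Instance.atspInput, scalar]
    lb := fun v => by rw [a₅.2 4 (by decide), hlb₄]
    delta := by rw [a₅.2 5 (by decide), hδ₄]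
    round := hround.congr a₅ (by decide)
    partition := ⟨k, c, c1, fun u v => by
      rw [c2]; unfold Store.vec; rw [a₅.1 8 (by decide)], c3, c4⟩ }

theorem LoopState.den_roundC {G : Instance (Fin n)} {x : Fin n → Fin n → ℝ} {α₀ α δ : ℝ}
    {s r : Store} (hs : LoopState G x α₀ α δ s) (hx : G.HKFeasible x) (hα : 0 ≤ α) (hδ0 : 0 ≤ δ)
    (hδpos : 0 < ∑ v, G.lb x v → 0 < δ) (hα₀ : ∀ v, α₀ * G.lb x v = α * G.lb x v)
    (hαα : ∀ h j, α₀ * classVal (G.lb x) δ h j = α * classVal (G.lb x) δ h j)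
    {k : ℕ} {c : Fin n → Fin k} (hc : ∀ u v, c u = c v ↔ s.vec n 8 u = s.vec n 8 v)
    (hr : G.IsLightSolution x α₀ c (r.output n)) :
    LoopState G x α₀ α δ (roundC.den (s.afterCall r)) ∧
    roundsLeft (G.lb x) δ ((roundC.den (s.afterCall r)).vec n 6) ((roundC.den (s.afterCall r)).vec n 8)
      < roundsLeft (G.lb x) δ (s.vec n 6) (s.vec n 8) := by
  have a₀ : AgreeOff [4] [] s (s.afterCall r) :=
    ⟨fun a ha => by simp only [List.mem_singleton] at ha; simp [Store.afterCall, ha],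
      fun a _ => rfl⟩
  have h4 : (s.afterCall r).mat n 4 = r.output n := by
    funext u v
    simp [Store.mat, Store.afterCall, Store.output]
  set s₀ := s.afterCall r with hs₀
  have e6 : s₀.vec n 6 = s.vec n 6 := by unfold Store.vec; rw [a₀.1 6 (by decide)]
  have e8 : s₀.vec n 8 = s.vec n 8 := by unfold Store.vec; rw [a₀.1 8 (by decide)]
  have hG : HasGraph G s₀ := hasGraph_of_matrix (by rw [a₀.1 0 (by decide), hs.size])
    (by rw [a₀.1 1 (by decide), hs.adj]) (by rw [a₀.2 0 (by decide), hs.weight])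
  obtain ⟨u1, u2⟩ := den_updateC hG (lb_nonneg hx) (fun v => by rw [a₀.2 4 (by decide), hs.lb])
    (by rw [a₀.2 2 (by decide), hs.factor]) hα (by rw [a₀.2 5 (by decide), hs.delta]) hδ0 hδpos hαα
    (hs.round.congr a₀ (by decide)) (by rw [h4]; exact hr.eulerian)
    (by rw [h4, e8]; exact IsLightSolution.leaves hr hc) (by
      rw [h4]
      intro f hf t
      refine (IsLightSolution.comp_le hr hf t).trans (le_of_eq ?_)
      rw [Finset.mul_sum, Finset.mul_sum]
      exact Finset.sum_congr rfl fun v _ => hα₀ v)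
  unfold roundC
  rw [den_seq]
  have a₁ : AgreeOff (4 :: updateC.nw) updateC.rw s (updateC.den s₀) :=
    (a₀.mono (by decide) (by decide)).trans ((den_agree _ _).mono (by simp) (by simp))
  set s₁ := updateC.den s₀ with hs₁
  obtain ⟨k₀, c₀, -, -, p2, p3⟩ := hs.partition
  obtain ⟨k', c', q1, q2, q3, q4⟩ := den_partitionC (s := s₁) (by rw [a₁.1 0 (by decide), hs.size]; simp [scalar])
    u1.class_lt (fun i j hij => by rw [a₁.1 2 (by decide), p2]; simp [scalar, hij])
    (fun i j hij => by rw [a₁.1 3 (by decide), p3]; simp only [vector]; rw [dif_neg hij])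
  have a₂ : AgreeOff [2, 3, 17, 20, 21] [] s₁ (partitionC.den s₁) :=
    (den_agree _ _).mono (by decide) (by decide)
  have f6 : (partitionC.den s₁).vec n 6 = s₁.vec n 6 := by unfold Store.vec; rw [a₂.1 6 (by decide)]
  have f8 : (partitionC.den s₁).vec n 8 = s₁.vec n 8 := by unfold Store.vec; rw [a₂.1 8 (by decide)]
  refine ⟨?_, by rw [f6, f8, ← e6, ← e8]; exact u2⟩
  exact {
    size := by rw [a₂.1 0 (by decide), a₁.1 0 (by decide), hs.size]
    adj := by rw [a₂.1 1 (by decide), a₁.1 1 (by decide), hs.adj]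
    weight := by rw [a₂.2 0 (by decide), a₁.2 0 (by decide), hs.weight]
    sol := by rw [a₂.2 1 (by decide), a₁.2 1 (by decide), hs.sol]
    factor := by rw [a₂.2 2 (by decide), a₁.2 2 (by decide), hs.factor]
    lb := fun v => by rw [a₂.2 4 (by decide), a₁.2 4 (by decide), hs.lb]
    delta := by rw [a₂.2 5 (by decide), a₁.2 5 (by decide), hs.delta]
    round := u1.congr a₂ (by decide)
    partition := ⟨k', c', q1, fun u v => by rw [q2, f8], q3, q4⟩ }

end ATSP

/-! ### Running time and weight of the tour -/

namespace ATSP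

open Cmd

variable {n : ℕ}

/-- A loop whose body decreases `μ` and preserves `Inv`. -/
theorem exec_loop {O : Store → ℕ → Store → Prop} {b : BExp} {p : Prog} (Inv : Store → Prop)
    (μ : Store → ℕ) (B : ℕ) (hstep : ∀ s, Inv s → b.Holds s →
      ∃ t s', Exec O p s t s' ∧ t ≤ B ∧ Inv s' ∧ μ s' < μ s) (s : Store) (hs : Inv s) :
    ∃ t s', Exec O (.loop b p) s t s' ∧ t ≤ μ s * (B + b.cost + 1) + b.cost + 1 ∧ Inv s' ∧
      ¬ b.Holds s' := by
  induction hN : μ s using Nat.strong_induction_on generalizing s with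
  | _ N ih =>
    by_cases hb : b.Holds s
    · obtain ⟨t, s', h1, h2, h3, h4⟩ := hstep s hs hb
      obtain ⟨t', s'', h5, h6, h7, h8⟩ := ih _ (hN ▸ h4) s' h3 rfl
      refine ⟨_, s'', Exec.loop_true hb h1 h5, ?_, h7, h8⟩
      have h9 : (μ s' + 1) * (B + b.cost + 1) ≤ N * (B + b.cost + 1) :=
        Nat.mul_le_mul_right _ (hN ▸ h4)
      rw [Nat.add_mul, one_mul] at h9
      omega
    · exact ⟨_, s, Exec.loop_false hb, by omega, hs, hb⟩

/-- The algorithm for ATSP. -/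
def tourProg : Prog :=
  .seq initC.compile (.seq (.loop (.natLe (.const 2) (.var 2)) (.seq .call roundC.compile))
    outputC.compile)

/-- A bound on the number of steps of `tourProg`. -/
noncomputable def tourPoly : MvPolynomial (Fin 3) ℕ :=
  initC.boundPoly + ((MvPolynomial.X 0 + 1) * (36 * MvPolynomial.X 0 ^ 2 * MvPolynomial.X 1 ^ 2)
      + MvPolynomial.X 0) * (MvPolynomial.X 2 + 1 + roundC.boundPoly + 6)
    + 6 + outputC.boundPoly

/-- The potential lies between `0` and `lb(V)²`, and `lb(V)² / δ² = 36 n² / ε²`. If `lb(V) = 0`, the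
quotient is `0` because division by zero gives zero. -/
theorem roundsLeft_le {lb : Fin n → ℝ} (hlb : ∀ v, 0 ≤ lb v) {ε : ℝ} (hn : 0 < n) (hε : 0 < ε)
    {h L : Fin n → ℕ} : (roundsLeft lb (ε / 6 * (∑ v, lb v) / n) h L : ℝ)
      ≤ (n + 1) * (36 * n ^ 2 * (1 / ε) ^ 2) + n := by
  set X := ∑ v, lb v with hX
  have hX0 : 0 ≤ X := Finset.sum_nonneg fun v _ => hlb v
  have hn' : (0 : ℝ) < n := by exact_mod_cast hn
  have hcard : ((Finset.univ.image L).card : ℝ) ≤ n := by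
    have : (Finset.univ.image L).card ≤ n := Finset.card_image_le.trans (by simp)
    exact_mod_cast this
  have hpot : 0 ≤ potential lb 1 h := Finset.sum_nonneg fun v _ => mul_nonneg (hlb v)
    (pow_nonneg (Finset.sum_nonneg fun u _ => hlb u) _)
  set δ := ε / 6 * X / n with hδ
  have hq : (X * X - potential lb 1 h) / (δ * δ) ≤ 36 * n ^ 2 * (1 / ε) ^ 2 := by
    rcases hX0.eq_or_lt with h0 | hpos
    · rw [hδ, ← h0]
      simp only [mul_zero, zero_div, div_zero]
      positivity
    · have hδ0 : 0 < δ := by positivity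
      rw [div_le_iff₀ (by positivity)]
      have e : 36 * (n : ℝ) ^ 2 * (1 / ε) ^ 2 * (δ * δ) = X * X := by
        rw [hδ]; field_simp; norm_num
      rw [e]
      linarith
  have hfl : (⌊(X * X - potential lb 1 h) / (δ * δ)⌋₊ : ℝ) ≤ 36 * n ^ 2 * (1 / ε) ^ 2 := by
    rcases le_or_gt 0 ((X * X - potential lb 1 h) / (δ * δ)) with h1 | h1
    · exact (Nat.floor_le h1).trans hq
    · rw [Nat.floor_of_nonpos h1.le]
      simp only [Nat.cast_zero]
      positivity
  unfold roundsLeft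
  rw [← hX]
  push_cast
  have := mul_le_mul_of_nonneg_left hfl (by positivity : (0 : ℝ) ≤ n + 1)
  linarith

theorem den_outputC {s : Store} (hn : s.nat 0 0 0 = n) : (outputC.den s).output n = s.mat n 7 := by
  funext u v
  exact den_each_each (s := s) hn (dst := 4)
    (c := nset 4 (.var 20) (.var 21) (.get 7 (.var 20) (.var 21))) (by decide) (by decide)
    (fun u v => s.nat 7 u v) (by
      intro u v hu hv s' hu' hv' hs' _ i j
      simp only [den_nset, NExp.eval_var, NExp.eval_get, hu', hv', Store.setNat_nat_same,
        hs'.1 7 (by decide)]) u v u.2 v.2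

/-- `H`, the initial credits and the charges contribute `3α` each. The surplus `δ` per vertex enters
only the last two, which gives `6 α n δ`. -/
theorem RoundState.totalWeight_le {G : Instance (Fin n)} {lb : Fin n → ℝ} {α δ : ℝ} {s : Store}
    (hs : RoundState G lb α δ s) (hlb : ∀ v, 0 ≤ lb v) (hα : 0 ≤ α) (hδ : 0 ≤ δ) :
    G.totalWeight (s.mat n 7) ≤ 9 * α * ∑ v, lb v + 6 * α * (n * δ) := by
  have h1 := hs.merge.totalWeight_le (by positivity) (by positivity) (classVal_nonneg hlb δ _)
    (b := fun v => lb v + δ) (classVal_le hlb hδ _)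
  have h2 : G.totalWeight (s.mat n 5) ≤ 3 * α * ∑ v, lb v := by
    have := sum_nonneg_of_classes (g := s.vec n 6) (q := fun v => 3 * α * lb v - G.rowW (s.mat n 5) v)
      (fun t => by
        rw [Finset.sum_sub_distrib, ← Finset.mul_sum]
        linarith [hs.light t]) (fun _ => True) (fun _ _ _ => Iff.rfl)
    rw [Finset.filter_true, Finset.sum_sub_distrib, ← Finset.mul_sum] at this
    have e : G.totalWeight (s.mat n 5) = ∑ v, G.rowW (s.mat n 5) v := rfl
    linarith
  rw [← Finset.mul_sum, Finset.sum_add_distrib] at h1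
  simp only [Finset.sum_const, Finset.card_univ, Fintype.card_fin, nsmul_eq_mul] at h1
  linarith

/-- The program computes with the given factor `α₀`, the analysis uses a nonnegative `α` with `α₀ lb
= α lb`; the two agree on everything that is compared. -/
theorem tourProg_correct {A : Prog} {G : Instance (Fin n)} {x : Fin n → Fin n → ℝ} {α₀ : ℝ} {T : ℕ}
    {ε : ℝ} (hx : G.HKFeasible x) (hA : A.IsLightOn G x α₀) (hT : A.RunningTimeLE G x T)
    (hε : 0 < ε) :
    ∃ t s, tourProg.RunWith A (G.atspInput x α₀ ε) t s ∧
      (t : ℝ) ≤ MvPolynomial.aeval ![(n : ℝ), 1 / ε, (T : ℝ)] tourPoly ∧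
      G.IsTour (s.output n) ∧ G.totalWeight (s.output n) ≤ (9 + ε) * α₀ * G.lbOn x Set.univ := by
  have hne : Nonempty (Fin n) := G.nonempty
  have hn0 : 0 < n := Fin.pos_iff_nonempty.2 hne
  have hn0' : (0 : ℝ) < n := by exact_mod_cast hn0
  obtain ⟨α, hα, hαα⟩ := exists_nonneg_factor (α := α₀) hx fun k c hc => by
    obtain ⟨t, s, -, h⟩ := hA k c hc
    exact ⟨_, h⟩
  have hlb := lb_nonneg hx
  have hsum : ∀ S : Finset (Fin n), α₀ * ∑ v ∈ S, G.lb x v = α * ∑ v ∈ S, G.lb x v := fun S => by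
    rw [Finset.mul_sum, Finset.mul_sum]
    exact Finset.sum_congr rfl fun v _ => hαα v
  have hX0 : 0 ≤ ∑ v, G.lb x v := Finset.sum_nonneg fun v _ => hlb v
  obtain ⟨δ, hδ⟩ : ∃ δ, δ = ε / 6 * (∑ v, G.lb x v) / n := ⟨_, rfl⟩
  have hδ0 : 0 ≤ δ := by rw [hδ]; positivity
  have hδpos : 0 < ∑ v, G.lb x v → 0 < δ := fun h => by rw [hδ]; positivity
  -- `δ` is itself a multiple of `lb(V)`, so the two factors agree on the raised values too.
  have hcv : ∀ h j, α₀ * classVal (G.lb x) δ h j = α * classVal (G.lb x) δ h j := by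
    intro h j
    unfold classVal
    rcases max_choice (∑ u with h u = j, G.lb x u) δ with h1 | h1
    · rw [h1, hsum]
    · rw [h1, hδ]
      have := hsum Finset.univ
      calc α₀ * (ε / 6 * (∑ v, G.lb x v) / n) = ε / 6 / n * (α₀ * ∑ v, G.lb x v) := by ring
        _ = ε / 6 / n * (α * ∑ v, G.lb x v) := by rw [this]
        _ = _ := by ring
  set s₀ := G.atspInput x α₀ ε with hs₀
  have hn₀ : s₀.nat 0 0 0 = n := by simp [hs₀, Instance.atspInput, scalar]
  obtain ⟨t₁, ht₁, hb₁⟩ := initC.exec A.Run (by decide) s₀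
  have hinit : LoopState G x α₀ α δ (initC.den s₀) := den_initC hx hα hδ hδ0
  obtain ⟨t₂, s₂, ht₂, hb₂, hs₂, hk₂⟩ := exec_loop (O := A.Run)
    (b := .natLe (.const 2) (.var 2)) (p := .seq .call roundC.compile) (LoopState G x α₀ α δ)
    (fun s => roundsLeft (G.lb x) δ (s.vec n 6) (s.vec n 8)) (T + 1 + roundC.bound n) (by
      intro s hs hb
      obtain ⟨k, c, c1, c2, c3, c4⟩ := hs.partition
      have hk : 2 ≤ k := by
        simpa [c3, scalar] using hb
      have hpart := isLCPartition_of_labeling hs.round.merge.eulerian hs.round.merge.labeling hk c1 c2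
      obtain ⟨t, r, hrun, hlight⟩ := hA k c hpart
      have harg := arguments_eq_lcInput hs.size hs.adj c3 c4 hs.weight hs.sol
      obtain ⟨d1, d2⟩ := hs.den_roundC hx hα hδ0 hδpos hαα hcv c2 hlight
      obtain ⟨t', ht', hb'⟩ := roundC.exec A.Run (by decide) (s.afterCall r)
      have hn' : (s.afterCall r).nat 0 0 0 = n := by
        simp [Store.afterCall, hs.size, scalar]
      rw [hn'] at hb'
      refine ⟨_, _, Exec.seq (Exec.call (by rw [harg]; exact hrun)) ht', ?_, d1, d2⟩
      have := hT k c hpart t r hrun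
      omega) (initC.den s₀) hinit
  have hn₂ : s₂.nat 0 0 0 = n := by rw [hs₂.size]; simp [scalar]
  obtain ⟨t₃, ht₃, hb₃⟩ := outputC.exec A.Run (by decide) s₂
  rw [hn₀] at hb₁
  rw [hn₂] at hb₃
  refine ⟨_, _, Exec.seq ht₁ (Exec.seq ht₂ ht₃), ?_, ?_, ?_⟩
  · have hR := roundsLeft_le hlb hn0 hε (h := (initC.den s₀).vec n 6) (L := (initC.den s₀).vec n 8)
    rw [← hδ] at hR
    have hcost : (BExp.natLe (.const 2) (.var 2)).cost = 5 := rfl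
    rw [hcost] at hb₂
    simp only [tourPoly, map_add, map_mul, map_pow, aeval_boundPoly, MvPolynomial.aeval_X, map_one,
      map_ofNat, Matrix.cons_val_zero, Matrix.cons_val_one, Matrix.cons_val]
    have h1 : (t₁ : ℝ) ≤ initC.bound n := by exact_mod_cast hb₁
    have h3 : (t₃ : ℝ) ≤ outputC.bound n := by exact_mod_cast hb₃
    have h2 : (t₂ : ℝ) ≤ roundsLeft (G.lb x) δ ((initC.den s₀).vec n 6) ((initC.den s₀).vec n 8)
        * ((T : ℝ) + 1 + roundC.bound n + 6) + 6 := by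
      have : t₂ ≤ roundsLeft (G.lb x) δ ((initC.den s₀).vec n 6) ((initC.den s₀).vec n 8)
        * (T + 1 + roundC.bound n + 6) + 6 := hb₂
      exact_mod_cast this
    have h4 := mul_le_mul_of_nonneg_right hR
      (by positivity : (0 : ℝ) ≤ (T : ℝ) + 1 + roundC.bound n + 6)
    push_cast
    linarith
  · rw [den_outputC hn₂]
    -- The loop stops with fewer than two classes, so all vertices lie in one component.
    refine hs₂.round.merge.isTour fun u v => ?_
    obtain ⟨k, c, c1, c2, c3, c4⟩ := hs₂.partition
    have hk : k < 2 := by simpa [c3, scalar] using hk₂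
    rw [← c2]
    have := (c u).2
    have := (c v).2
    exact Fin.ext (by omega)
  · rw [den_outputC hn₂, lbOn_univ]
    refine (hs₂.round.totalWeight_le hlb hα hδ0).trans (le_of_eq ?_)
    have h1 := hsum Finset.univ
    have h2 : (n : ℝ) * δ = ε / 6 * ∑ v, G.lb x v := by rw [hδ]; field_simp
    rw [h2]
    calc 9 * α * ∑ v, G.lb x v + 6 * α * (ε / 6 * ∑ v, G.lb x v)
        = (9 + ε) * (α * ∑ v, G.lb x v) := by ring
      _ = (9 + ε) * α₀ * ∑ v, G.lb x v := by rw [← h1]; ring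

end ATSP

theorem mainTheorem2 :
    (∀ (A : ATSP.Prog) (n : ℕ) (G : ATSP.Instance (Fin n)) (x : Fin n → Fin n → ℝ) (α : ℝ),
      G.HKOptimal x → A.IsLightOn G x α →
        ∃ F, G.IsTour F ∧ G.totalWeight F ≤ 5 * α * G.lbOn x Set.univ) ∧
    ∃ (P : ATSP.Prog) (p : MvPolynomial (Fin 3) ℕ),
      ∀ (A : ATSP.Prog) (n : ℕ) (G : ATSP.Instance (Fin n)) (x : Fin n → Fin n → ℝ) (α : ℝ)
        (T : ℕ) (ε : ℝ),
        G.HKOptimal x → A.IsLightOn G x α → A.RunningTimeLE G x T → 0 < ε →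
          ∃ t s, P.RunWith A (G.atspInput x α ε) t s ∧
            (t : ℝ) ≤ MvPolynomial.aeval ![(n : ℝ), 1 / ε, (T : ℝ)] p ∧
            G.IsTour (s.output n) ∧
            G.totalWeight (s.output n) ≤ (9 + ε) * α * G.lbOn x Set.univ := by
  refine ⟨fun A n G x α hx hA => ATSP.exists_tour_five hx.1 fun k c hc => ?_,
    ATSP.tourProg, ATSP.tourPoly, fun A n G x α T ε hx hA hT hε =>
      ATSP.tourProg_correct hx.1 hA hT hε⟩
  obtain ⟨t, s, -, h⟩ := hA k c hc
  exact ⟨_, h⟩
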